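/- Let $\ell_0>0$, write $J=[-\ell_0/2,\ell_0/2]$, $I_-=(-\infty,0]\times J$, $I_+=[0,\infty)\times J$, and for $k\in\mathbb N\cup\{0\}$, $0\le\theta<1$ let $C_\sharp^{k+\theta}$ be the space of all $f\in C^{k+\theta}(J)$ with $f^{(j)}(-\ell_0/2)=f^{(j)}(\ell_0/2)$ for $j=0,\dots,k$, with the norm of $C^{k+\theta}(J)$. Let $\mathscr X$ be the space of all pairs ${\bf f}=(f_1,f_2)\in C(I_-)\times C(I_+)$ for which $e^{-x/2}f_1$ and $e^{-x/2}f_2$ are bounded, with norm $\|{\bf f}\|_{\mathscr X}=\sup_{I_-}|e^{-x/2}f_1|+\sup_{I_+}|e^{-x/2}f_2|$. Consider the functions of $x$ (first component for $x\le 0$, second for $x\ge 0$) $${\bf T}=(e^x,\,1),\qquad {\bf U}=\Big(\tfrac{1-x}{3}e^x,\ \tfrac13\Big),\qquad {\bf V}=\Big(\big(1-\tfrac23x+\tfrac{x^2}{6}\big)e^x,\ 1+\tfrac x3\Big),$$ and the projection $\mathscr P{\bf f}=\Big(\int_{-\infty}^0f_1(x,\cdot)\,dx+\int_0^{\infty}e^{-x}f_2(x,\cdot)\,dx\Big){\bf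 U}$. For $\varepsilon>0$ let $L+\varepsilon A$ be the operator in $\mathscr X$ given by $$(L+\varepsilon A){\bf u}=\big(D_{xx}u_1+\varepsilon D_{\eta\eta}u_1-D_xu_1+e^xu_1(0,\cdot),\ \ D_{xx}u_2+\varepsilon D_{\eta\eta}u_2-D_xu_2\big)$$ on the domain of all ${\bf u}\in\mathscr X$ whose components are twice continuously differentiable with respect to $x$ and with respect to $\eta$ (on $I_-$ and on $I_+$ respectively), such that ${\bf u}_{\eta\eta}\in\mathscr X$ and $(L+\varepsilon A){\bf u}\in\mathscr X$, with $D_x^{j}u_1(0,\cdot)=D_x^{j}u_2(0,\cdot)$ and $D_\eta^{j}u_i(\cdot,-\ell_0/2)=D_\eta^{j}u_i(\cdot,\ell_0/2)$ for $j=0,1$, $i=1,2$. Let $L_\varepsilon$ be its closure in $\mathscr X$, and let $R(0,L_\varepsilon)$ be the inverse of $-L_\varepsilon$ in $(I-\mathscr P)(\mathscr X)$. Set $$\mathscr B_\varepsilon\psi=\psi-\frac{13\varepsilon}{3}\psi_{\eta\eta}+3\varepsilon^2\Big(D_{\eta\eta}R(0,L_\varepsilon)\big[\psi_{\eta\eta}\big({\bf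 V}-{\bf T}-\tfrac43{\bf U}\big)\big]\Big)_1(0,\cdot).$$ Proposition. For every $\varepsilon\in(0,1/2]$ and every $\theta\in(0,1)$, $\mathscr B_\varepsilon$ is a well-defined linear operator from $C_\sharp^{2+\theta}$ to $C_\sharp^{\theta}$ and it is invertible: it maps $C_\sharp^{2+\theta}$ bijectively onto $C_\sharp^{\theta}$, and both $\mathscr B_\varepsilon$ and its inverse are bounded. -/

import Mathlib

open Filter Topology MeasureTheory
open scoped NNReal

noncomputable section

namespace FrontB

/-! ### Derivatives of functions given on a subset of the line -/

/-- `g` is the derivative of `f : S → ℝ` on `S` (one-sided at the points of `S` that are end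
points).  Only the values of `f` on `S` matter, the extension by `0` being irrelevant. -/
def HasDerivOn {S : Set ℝ} (f g : S → ℝ) : Prop :=
  ∀ x : S, HasDerivWithinAt (Function.extend Subtype.val f 0) (g x) S x

/-- The derivative of `f : S → ℝ`, as a function on `S`. -/
def derivOn {S : Set ℝ} (f : S → ℝ) : S → ℝ :=
  fun x => derivWithin (Function.extend Subtype.val f 0) S x

lemma extend_val {S : Set ℝ} (f : S → ℝ) (x : S) :
    Function.extend Subtype.val f 0 (x : ℝ) = f x :=
  Subtype.val_injective.extend_apply f 0 x

lemma HasDerivOn.add {S : Set ℝ} {f f' g g' : S → ℝ} (h : HasDerivOn f f')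
    (k : HasDerivOn g g') : HasDerivOn (f + g) (f' + g') := fun x => by
  refine (HasDerivWithinAt.add (h x) (k x)).congr_of_mem (fun y hy => ?_) x.2
  have e := fun F : S → ℝ => extend_val F ⟨y, hy⟩
  simp only [] at e
  simp [e]

lemma HasDerivOn.smul {S : Set ℝ} {f f' : S → ℝ} (c : ℝ) (h : HasDerivOn f f') :
    HasDerivOn (c • f) (c • f') := fun x => by
  refine ((h x).const_smul c).congr_of_mem (fun y hy => ?_) x.2
  have e := fun F : S → ℝ => extend_val F ⟨y, hy⟩
  simp only [] at e
  simp [e]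

lemma HasDerivOn.zero {S : Set ℝ} : HasDerivOn (0 : S → ℝ) 0 := fun x => by
  refine (hasDerivWithinAt_const (x : ℝ) S (0 : ℝ)).congr_of_mem (fun y hy => ?_) x.2
  have e := fun F : S → ℝ => extend_val F ⟨y, hy⟩
  simp only [] at e
  simp [e]

/-! ### The spaces of periodic Hölder functions -/

/-- The interval `[-ℓ/2, ℓ/2]`. -/
abbrev Cell (ℓ : ℝ) : Set ℝ := Set.Icc (-ℓ / 2) (ℓ / 2)

/-- `f` takes the same value at `-ℓ/2` and at `ℓ/2`. -/
def EndsAgree {ℓ : ℝ} (f : Cell ℓ → ℝ) : Prop :=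
  ∀ a b : Cell ℓ, (a : ℝ) = -ℓ / 2 → (b : ℝ) = ℓ / 2 → f a = f b

/-- The space `C_♯^{k+θ}` of the functions of class `C^{k+θ}` on `[-ℓ/2, ℓ/2]` whose derivatives
of order `0, …, k` take the same value at the two end points (`0 ≤ θ < 1`).  Here `d j` is the
derivative of order `j`. -/
def CSharp (ℓ : ℝ) (k : ℕ) (θ : ℝ≥0) : Submodule ℝ (Cell ℓ → ℝ) where
  carrier := {f | ∃ d : ℕ → Cell ℓ → ℝ, d 0 = f ∧ (∀ j < k, HasDerivOn (d j) (d (j + 1))) ∧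
    Continuous (d k) ∧ MemHolder θ (d k) ∧ ∀ j ≤ k, EndsAgree (d j)}
  zero_mem' := ⟨0, rfl, fun _ _ => HasDerivOn.zero, continuous_const,
    ⟨0, fun x y => by simp⟩,
    fun _ _ _ _ _ _ => rfl⟩
  add_mem' := by
    rintro f g ⟨d, hd, h1, h2, h3, h4⟩ ⟨e, he, k1, k2, k3, k4⟩
    refine ⟨d + e, by simp [hd, he], fun j hj => (h1 j hj).add (k1 j hj), h2.add k2,
      h3.add k3, fun j hj a b ha hb => ?_⟩
    simp [h4 j hj a b ha hb, k4 j hj a b ha hb]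
  smul_mem' := by
    rintro c f ⟨d, hd, h1, h2, h3, h4⟩
    refine ⟨fun j => c • d j, by simp [hd], fun j hj => (h1 j hj).smul c, h2.const_smul c,
      h3.smul, fun j hj a b ha hb => ?_⟩
    simp [h4 j hj a b ha hb]

/-- The norm of `C^{k+θ}([-ℓ/2, ℓ/2])`, `0 < θ < 1`: the sum of the sup norms of the derivatives of
order `0, …, k` and of the `θ`-Hölder seminorm of the derivative of order `k`. -/
def holderNorm {ℓ : ℝ} (k : ℕ) (θ : ℝ≥0) (f : Cell ℓ → ℝ) : ℝ :=
  (∑ j ∈ Finset.range (k + 1), ⨆ η : Cell ℓ, |(derivOn^[j] f) η|)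
    + (nnHolderNorm θ (derivOn^[k] f) : ℝ)

/-! ### The space `𝓧` -/

/-- `I₋ = (-∞, 0] × [-ℓ/2, ℓ/2]`. -/
abbrev StripNeg (ℓ : ℝ) : Type := Set.Iic (0 : ℝ) × Cell ℓ

/-- `I₊ = [0, ∞) × [-ℓ/2, ℓ/2]`. -/
abbrev StripPos (ℓ : ℝ) : Type := Set.Ici (0 : ℝ) × Cell ℓ

/-- `C(I₋) × C(I₊)`. -/
abbrev Pair (ℓ : ℝ) : Type := C(StripNeg ℓ, ℝ) × C(StripPos ℓ, ℝ)

/-- The space `𝓧` of the pairs `(f₁, f₂) ∈ C(I₋) × C(I₊)` such that the functions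
`e^{-x/2} fᵢ(x, η)` are bounded. -/
def XSpace (ℓ : ℝ) : Submodule ℝ (Pair ℓ) where
  carrier := {f | (∃ C : ℝ, ∀ p, |Real.exp (-(p.1 : ℝ) / 2) * f.1 p| ≤ C) ∧
    ∃ C : ℝ, ∀ p, |Real.exp (-(p.1 : ℝ) / 2) * f.2 p| ≤ C}
  zero_mem' := ⟨⟨0, fun p => by simp⟩, ⟨0, fun p => by simp⟩⟩
  add_mem' := by
    rintro f g ⟨⟨A, hA⟩, ⟨B, hB⟩⟩ ⟨⟨A', hA'⟩, ⟨B', hB'⟩⟩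
    refine ⟨⟨A + A', fun p => ?_⟩, ⟨B + B', fun p => ?_⟩⟩
    · have : Real.exp (-(p.1 : ℝ) / 2) * (f + g).1 p =
          Real.exp (-(p.1 : ℝ) / 2) * f.1 p + Real.exp (-(p.1 : ℝ) / 2) * g.1 p := by
        simp [mul_add]
      rw [this]
      exact (abs_add_le _ _).trans (add_le_add (hA p) (hA' p))
    · have : Real.exp (-(p.1 : ℝ) / 2) * (f + g).2 p =
          Real.exp (-(p.1 : ℝ) / 2) * f.2 p + Real.exp (-(p.1 : ℝ) / 2) * g.2 p := by
        simp [mul_add]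
      rw [this]
      exact (abs_add_le _ _).trans (add_le_add (hB p) (hB' p))
  smul_mem' := by
    rintro c f ⟨⟨A, hA⟩, ⟨B, hB⟩⟩
    refine ⟨⟨|c| * A, fun p => ?_⟩, ⟨|c| * B, fun p => ?_⟩⟩
    · have : Real.exp (-(p.1 : ℝ) / 2) * (c • f).1 p =
          c * (Real.exp (-(p.1 : ℝ) / 2) * f.1 p) := by
        simp only [Prod.smul_fst, ContinuousMap.smul_apply, smul_eq_mul]; ring
      rw [this, abs_mul]
      exact mul_le_mul_of_nonneg_left (hA p) (abs_nonneg c)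
    · have : Real.exp (-(p.1 : ℝ) / 2) * (c • f).2 p =
          c * (Real.exp (-(p.1 : ℝ) / 2) * f.2 p) := by
        simp only [Prod.smul_snd, ContinuousMap.smul_apply, smul_eq_mul]; ring
      rw [this, abs_mul]
      exact mul_le_mul_of_nonneg_left (hB p) (abs_nonneg c)

/-- The norm of `𝓧`. -/
def xNorm {ℓ : ℝ} (f : XSpace ℓ) : ℝ :=
  (⨆ p : StripNeg ℓ, |Real.exp (-(p.1 : ℝ) / 2) * f.1.1 p|)
    + ⨆ p : StripPos ℓ, |Real.exp (-(p.1 : ℝ) / 2) * f.1.2 p|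

/-! ### The generalized functions `T`, `U`, `V` (index `1` for `x ≤ 0`, `2` for `x ≥ 0`) -/

def T₁ (x : ℝ) : ℝ := Real.exp x
def T₂ (_x : ℝ) : ℝ := 1
def U₁ (x : ℝ) : ℝ := (1 - x) / 3 * Real.exp x
def U₂ (_x : ℝ) : ℝ := 1 / 3
def V₁ (x : ℝ) : ℝ := (1 - 2 / 3 * x + x ^ 2 / 6) * Real.exp x
def V₂ (x : ℝ) : ℝ := 1 + x / 3

/-! ### The projection `𝓟` and the operator `L + εA` -/

/-- `Q(f)(η) = ∫_{-∞}^0 f₁(x, η) dx + ∫_0^∞ e^{-x} f₂(x, η) dx`. -/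
def Q {ℓ : ℝ} (f : XSpace ℓ) (η : Cell ℓ) : ℝ :=
  (∫ x : Set.Iic (0 : ℝ), f.1.1 (x, η) ∂(volume.comap Subtype.val))
    + ∫ x : Set.Ici (0 : ℝ), Real.exp (-(x : ℝ)) * f.1.2 (x, η) ∂(volume.comap Subtype.val)

/-- `f ∈ (I - 𝓟)(𝓧)`, where `𝓟(f) = Q(f) U`; since `𝓟` is a projection, this is its kernel. -/
def InComplement {ℓ : ℝ} (f : XSpace ℓ) : Prop :=
  (∀ p : StripNeg ℓ, Q f p.2 * U₁ p.1 = 0) ∧ ∀ p : StripPos ℓ, Q f p.2 * U₂ p.1 = 0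

/-- `v = D_x u` on `I₋` and on `I₊`. -/
def HasDx {ℓ : ℝ} (u v : Pair ℓ) : Prop :=
  (∀ η : Cell ℓ, HasDerivOn (fun x : Set.Iic (0 : ℝ) => u.1 (x, η)) fun x => v.1 (x, η)) ∧
    ∀ η : Cell ℓ, HasDerivOn (fun x : Set.Ici (0 : ℝ) => u.2 (x, η)) fun x => v.2 (x, η)

/-- `v = D_η u` on `I₋` and on `I₊`. -/
def HasDeta {ℓ : ℝ} (u v : Pair ℓ) : Prop :=
  (∀ x : Set.Iic (0 : ℝ), HasDerivOn (fun η : Cell ℓ => u.1 (x, η)) fun η => v.1 (x, η)) ∧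
    ∀ x : Set.Ici (0 : ℝ), HasDerivOn (fun η : Cell ℓ => u.2 (x, η)) fun η => v.2 (x, η)

/-- Both components of `u` are periodic in `η`. -/
def PeriodicEta {ℓ : ℝ} (u : Pair ℓ) : Prop :=
  (∀ x : Set.Iic (0 : ℝ), EndsAgree fun η : Cell ℓ => u.1 (x, η)) ∧
    ∀ x : Set.Ici (0 : ℝ), EndsAgree fun η : Cell ℓ => u.2 (x, η)

/-- The point `x = 0` of `(-∞, 0]`. -/
def zeroNeg : Set.Iic (0 : ℝ) := ⟨0, Set.self_mem_Iic⟩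

/-- The point `x = 0` of `[0, ∞)`. -/
def zeroPos : Set.Ici (0 : ℝ) := ⟨0, Set.self_mem_Ici⟩

/-- `u₁(0, ·) = u₂(0, ·)`. -/
def MatchAtZero {ℓ : ℝ} (u : Pair ℓ) : Prop :=
  ∀ η : Cell ℓ, u.1 (zeroNeg, η) = u.2 (zeroPos, η)

/-- `u ∈ D(L + εA)` and `(L + εA) u = f`, where `A = D_ηη` and `L` acts as
`D_xx u₁ - D_x u₁ + u₁(0, ·) e^x` for `x ≤ 0` and as `D_xx u₂ - D_x u₂` for `x ≥ 0`.  The requirement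
that `𝓛 u` belongs to `𝓧` holds because `f` and `D_ηη u` do. -/
def GraphLA {ℓ : ℝ} (ε : ℝ) (u f : XSpace ℓ) : Prop :=
  ∃ ux uxx uη uηη : Pair ℓ,
    HasDx u.1 ux ∧ HasDx ux uxx ∧ HasDeta u.1 uη ∧ HasDeta uη uηη ∧ uηη ∈ XSpace ℓ ∧
    MatchAtZero u.1 ∧ MatchAtZero ux ∧ PeriodicEta u.1 ∧ PeriodicEta uη ∧
    (∀ p : StripNeg ℓ, f.1.1 p =
      uxx.1 p + ε * uηη.1 p - ux.1 p + u.1.1 (zeroNeg, p.2) * Real.exp p.1) ∧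
    ∀ p : StripPos ℓ, f.1.2 p = uxx.2 p + ε * uηη.2 p - ux.2 p

/-- `u ∈ D(L_ε)` and `L_ε u = f`, where `L_ε` is the closure of `L + εA` in `𝓧`. -/
def GraphLEps {ℓ : ℝ} (ε : ℝ) (u f : XSpace ℓ) : Prop :=
  ∃ un fn : ℕ → XSpace ℓ, (∀ n, GraphLA ε (un n) (fn n)) ∧
    Tendsto (fun n => xNorm (un n - u)) atTop (𝓝 0) ∧
    Tendsto (fun n => xNorm (fn n - f)) atTop (𝓝 0)

/-- `u = R(0, L_ε) f`, the inverse of `-L_ε` being taken in `(I - 𝓟)(𝓧)`. -/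
def IsResolventZero {ℓ : ℝ} (ε : ℝ) (f u : XSpace ℓ) : Prop :=
  InComplement f ∧ InComplement u ∧ GraphLEps ε u (-f)

/-! ### The operator `𝓑_ε` -/

/-- `ψ` belongs to the domain of `𝓑_ε` and `𝓑_ε ψ = g`, where
`𝓑_ε ψ = ψ - (13 ε / 3) ψ_ηη + 3 ε² (D_ηη R(0, L_ε)[ψ_ηη (V - T - (4/3) U)])₁(0, ·)`.
Here `ψ₂ = ψ_ηη`, `f = ψ_ηη (V - T - (4/3) U)`, `u = R(0, L_ε) f` and `w₂ = D_ηη u₁(0, ·)`. -/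
def GraphB {ℓ : ℝ} (ε : ℝ) (ψ g : Cell ℓ → ℝ) : Prop :=
  ∃ (ψ₁ ψ₂ w₁ w₂ : Cell ℓ → ℝ) (f u : XSpace ℓ),
    HasDerivOn ψ ψ₁ ∧ HasDerivOn ψ₁ ψ₂ ∧
    (∀ p : StripNeg ℓ, f.1.1 p = ψ₂ p.2 * (V₁ p.1 - T₁ p.1 - 4 / 3 * U₁ p.1)) ∧
    (∀ p : StripPos ℓ, f.1.2 p = ψ₂ p.2 * (V₂ p.1 - T₂ p.1 - 4 / 3 * U₂ p.1)) ∧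
    IsResolventZero ε f u ∧
    HasDerivOn (fun η => u.1.1 (zeroNeg, η)) w₁ ∧ HasDerivOn w₁ w₂ ∧
    ∀ η, g η = ψ η - 13 * ε / 3 * ψ₂ η + 3 * ε ^ 2 * w₂ η

end FrontB

end

/-! The operator 𝓑_ε is a Fourier multiplier in η with a computable symbol. On the n-th mode, -ε
D_ηη is multiplication by μ = ε(2πn/ℓ)², written μ = r(r - 1) with r ≥ 1. For n ≠ 0 the resolvent
equation becomes an ODE on each half-line, with elementary solutions: a quadratic times e^x plus a
multiple of e^{rx} for x ≤ 0, an affine function plus a multiple of e^{(1-r)x} for x ≥ 0. Matching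
values and first derivatives at x = 0 gives the trace -(8r+3)/(9r²(2r+1)) (`traceSymb`), and 𝓑_ε
gets the symbol 3r(2r²-1)/(2r+1) ≥ r² (`symbB`, `le_symbB`), which has no zero.

Hölder bounds need no general multiplier theorem. A square-summable symbol sends continuous
functions to absolutely convergent Fourier series, by Parseval and Cauchy–Schwarz
(`exists_multiplier`); such an operator commutes with translations, so its sup norm bound is also a
Hölder bound (`HolderWith.multiplier`). The symbol equals 1 + 3μ + μκ(r) with κ(r) = O(1/r)
(`symbB_eq`), so that 𝓑_ε ψ = ψ - 3ε ψ_ηη - ε K ψ_ηη with K of this kind. The inverse N and its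
first derivative N₁ are of this kind too, and the second derivative of N G is -(G - N₂ G)/(3ε) with
a third such operator N₂ (`exists_inverse`, `coef_inverse_deriv`).

What remains is that the relation `GraphB`, in which L_ε is a closure, is the graph of this
multiplier. Existence: the Fourier series of the explicit modes defines a bounded map into 𝓧; for
trigonometric polynomials it solves the equation for L + εA exactly, and density reaches the closure
(`isResolventZero_of_monomial`, `graphB_restr`). Uniqueness: for n ≠ 0 the n-th mode of the trace at
x = 0 is bounded by the norm of the right-hand side alone (`norm_cellMode_zero_le`); this passes to
the closure, so the trace is determined up to an additive constant, which D_ηη removes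
(`GraphB.unique`). -/

open Filter Topology MeasureTheory
open scoped NNReal

set_option linter.unusedSectionVars false

noncomputable section

namespace FrontB

/-! ### Fourier coefficients of continuous real functions on the circle -/

open Complex ComplexConjugate AddCircle

section Circle

variable {ℓ : ℝ} [hℓ : Fact (0 < ℓ)]

/-- The complex-valued function underlying a real continuous function on the circle. -/
def toComplex (F : C(AddCircle ℓ, ℝ)) : C(AddCircle ℓ, ℂ) :=
  ⟨fun t => (F t : ℂ), Complex.continuous_ofReal.comp F.continuous⟩

@[simp] lemma toComplex_apply (F : C(AddCircle ℓ, ℝ)) (t : AddCircle ℓ) :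
    toComplex F t = (F t : ℂ) := rfl

lemma integrable_circle {E : Type*} [NormedAddCommGroup E] (F : C(AddCircle ℓ, E)) :
    Integrable F (haarAddCircle (T := ℓ)) :=
  F.continuous.integrable_of_hasCompactSupport (HasCompactSupport.of_compactSpace _)

/-- The `n`-th Fourier coefficient of a complex continuous function, as a linear functional. -/
def ccoef (n : ℤ) : C(AddCircle ℓ, ℂ) →L[ℂ] ℂ :=
  LinearMap.mkContinuous
    { toFun := fun F => fourierCoeff F n
      map_add' := fun F G =>
        congrFun (fourierCoeff.add (integrable_circle F) (integrable_circle G)) n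
      map_smul' := fun c F => fourierCoeff.const_smul F c n } 1 (fun F => by
    have h : ‖∫ t : AddCircle ℓ, fourier (-n) t • F t ∂haarAddCircle‖ ≤
        ‖F‖ * (haarAddCircle (T := ℓ)).real Set.univ := by
      refine norm_integral_le_of_norm_le_const (Eventually.of_forall fun t => ?_)
      rw [norm_smul]
      have : ‖fourier (-n) t‖ = 1 := by rw [fourier_apply]; exact Circle.norm_coe _
      rw [this, one_mul]
      exact F.norm_coe_le_norm t
    simpa [fourierCoeff] using h)

lemma ccoef_apply (n : ℤ) (F : C(AddCircle ℓ, ℂ)) : ccoef n F = fourierCoeff F n := rfl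

lemma norm_ccoef_le (n : ℤ) (F : C(AddCircle ℓ, ℂ)) : ‖ccoef n F‖ ≤ ‖F‖ := by
  have h := (ccoef (ℓ := ℓ) n).le_of_opNorm_le (LinearMap.mkContinuous_norm_le _ zero_le_one _) F
  simpa using h

lemma ccoef_fourier (m n : ℤ) : ccoef n (fourier m : C(AddCircle ℓ, ℂ)) = if n = m then 1 else 0 := by
  rw [ccoef_apply, fourierCoeff_fourier, Pi.single_apply]

/-- The difference has the zero sequence of coefficients, which is summable, so its Fourier series
converges uniformly to it; but that series is zero. -/
lemma ccoef_ext {F G : C(AddCircle ℓ, ℂ)} (h : ∀ n, ccoef n F = ccoef n G) : F = G := by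
  have h0 : ∀ n, ccoef n (F - G) = 0 := fun n => by rw [map_sub, h n, sub_self]
  have hs : Summable (fourierCoeff (F - G : C(AddCircle ℓ, ℂ))) := by
    have : fourierCoeff (F - G : C(AddCircle ℓ, ℂ)) = 0 := funext fun n => h0 n
    rw [this]; exact summable_zero
  have h1 := hasSum_fourier_series_of_summable hs
  have h2 : (fun i => fourierCoeff (F - G : C(AddCircle ℓ, ℂ)) i • (fourier i : C(AddCircle ℓ, ℂ))) =
      0 := funext fun n => by
    change ccoef n (F - G) • _ = _
    rw [h0 n, zero_smul]; rfl
  rw [h2] at h1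
  exact sub_eq_zero.1 (h1.unique hasSum_zero)

/-- The `n`-th Fourier coefficient of a real continuous function. -/
def coef (F : C(AddCircle ℓ, ℝ)) (n : ℤ) : ℂ := ccoef n (toComplex F)

lemma coef_eq_integral (F : C(AddCircle ℓ, ℝ)) (n : ℤ) :
    coef F n = ∫ t : AddCircle ℓ, fourier (-n) t * F t ∂haarAddCircle := rfl

lemma coef_add (F G : C(AddCircle ℓ, ℝ)) (n : ℤ) : coef (F + G) n = coef F n + coef G n := by
  rw [coef, coef, coef, ← map_add]; congr 1; ext t; simp

lemma coef_smul (c : ℝ) (F : C(AddCircle ℓ, ℝ)) (n : ℤ) : coef (c • F) n = c * coef F n := by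
  rw [coef, coef, ← smul_eq_mul, ← map_smul]; congr 1; ext t; simp

lemma coef_sub (F G : C(AddCircle ℓ, ℝ)) (n : ℤ) : coef (F - G) n = coef F n - coef G n := by
  rw [coef, coef, coef, ← map_sub]; congr 1; ext t; simp

lemma coef_ext {F G : C(AddCircle ℓ, ℝ)} (h : ∀ n, coef F n = coef G n) : F = G := by
  have := ccoef_ext h
  ext t
  simpa using congrArg (fun H : C(AddCircle ℓ, ℂ) => H t) this

lemma coef_const (c : ℝ) (n : ℤ) :
    coef (ContinuousMap.const (AddCircle ℓ) c) n = if n = 0 then (c : ℂ) else 0 := by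
  have h : toComplex (ContinuousMap.const (AddCircle ℓ) c) = (c : ℂ) • (fourier 0) := by
    ext t; simp
  rw [coef, h, map_smul, ccoef_fourier]; split_ifs <;> simp

/-- The constant is the mean of F, which is real because F is. -/
lemma eq_const_of_coef {F : C(AddCircle ℓ, ℝ)} (h : ∀ n ≠ 0, coef F n = 0) :
    ∃ c : ℝ, ∀ t, F t = c := by
  have h0 : ccoef 0 (toComplex F) = ((∫ t : AddCircle ℓ, F t ∂haarAddCircle : ℝ) : ℂ) := by
    rw [← integral_complex_ofReal]
    simp [ccoef_apply, fourierCoeff]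
  have : F = ContinuousMap.const _ (∫ t : AddCircle ℓ, F t ∂haarAddCircle) := by
    refine coef_ext fun n => ?_
    rw [coef_const]
    split_ifs with hn
    · rw [hn]; exact h0
    · exact h n hn
  exact ⟨_, fun t => by rw [this]; rfl⟩

lemma norm_toComplex_le (F : C(AddCircle ℓ, ℝ)) : ‖toComplex F‖ ≤ ‖F‖ := by
  rw [ContinuousMap.norm_le _ (norm_nonneg _)]
  intro t
  simpa using F.norm_coe_le_norm t

lemma norm_coef_le (F : C(AddCircle ℓ, ℝ)) (n : ℤ) : ‖coef F n‖ ≤ ‖F‖ :=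
  (norm_ccoef_le n _).trans (norm_toComplex_le F)

/-- Parseval; the L² norm is at most the sup norm because the Haar measure is a probability measure.
-/
lemma hasSum_sq_coef (F : C(AddCircle ℓ, ℝ)) :
    ∃ S ≤ ‖F‖ ^ 2, HasSum (fun n => ‖coef F n‖ ^ 2) S := by
  have h := hasSum_sq_fourierCoeff (ContinuousMap.toLp (E := ℂ) 2 haarAddCircle ℂ (toComplex F))
  refine ⟨_, ?_, by simp only [fourierCoeff_toLp] at h; exact h⟩
  have h1 : ∫ t : AddCircle ℓ, ‖(ContinuousMap.toLp (E := ℂ) 2 haarAddCircle ℂ (toComplex F)) t‖ ^ 2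
      ∂haarAddCircle = ∫ t : AddCircle ℓ, ‖F t‖ ^ 2 ∂haarAddCircle := by
    refine integral_congr_ae ?_
    filter_upwards [ContinuousMap.coeFn_toLp (p := 2) (𝕜 := ℂ) haarAddCircle (toComplex F)] with t ht
    rw [ht]; simp
  rw [h1]
  have h2 : ∀ t, ‖F t‖ ^ 2 ≤ ‖F‖ ^ 2 := fun t =>
    pow_le_pow_left₀ (norm_nonneg _) (F.norm_coe_le_norm t) 2
  have h3 := integral_mono (μ := haarAddCircle (T := ℓ))
    (integrable_circle (⟨fun t => ‖F t‖ ^ 2, by fun_prop⟩ : C(AddCircle ℓ, ℝ)))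
    (integrable_const (‖F‖ ^ 2)) h2
  simpa using h3

lemma ccoef_conj {F G : C(AddCircle ℓ, ℂ)} (h : ∀ t, G t = conj (F t)) (n : ℤ) :
    ccoef n G = conj (ccoef (-n) F) := by
  rw [ccoef_apply, ccoef_apply, fourierCoeff, fourierCoeff, ← integral_conj]
  congr 1
  ext t
  simp only [smul_eq_mul, map_mul, h, neg_neg]
  rw [fourier_neg]

lemma coef_neg (F : C(AddCircle ℓ, ℝ)) (n : ℤ) : coef F (-n) = conj (coef F n) := by
  have := ccoef_conj (F := toComplex F) (G := toComplex F) (fun t => by simp) (-n)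
  rwa [neg_neg] at this

lemma summable_smul_fourier {a : ℤ → ℂ} (ha : Summable fun n => ‖a n‖) :
    Summable fun n => a n • (fourier n : C(AddCircle ℓ, ℂ)) :=
  Summable.of_norm (by simpa only [norm_smul, fourier_norm, mul_one] using ha)

/-- An absolutely summable Hermitian sequence is the sequence of Fourier coefficients of a real
continuous function. -/
lemma exists_coef_eq {a : ℤ → ℂ} (ha : Summable fun n => ‖a n‖) (hc : ∀ n, a (-n) = conj (a n)) :
    ∃ F : C(AddCircle ℓ, ℝ), (∀ n, coef F n = a n) ∧ ‖F‖ ≤ ∑' n, ‖a n‖ := by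
  set H : C(AddCircle ℓ, ℂ) := ∑' n, a n • fourier n with hH
  have hs := summable_smul_fourier (ℓ := ℓ) ha
  have hcoef : ∀ n, ccoef n H = a n := fun n => by
    rw [hH, ContinuousLinearMap.map_tsum _ hs, tsum_eq_single n]
    · simp [ccoef_fourier]
    · intro m hm
      rw [map_smul, ccoef_fourier, if_neg hm.symm, smul_zero]
  have hnorm : ‖H‖ ≤ ∑' n, ‖a n‖ := by
    refine (norm_tsum_le_tsum_norm ?_).trans (le_of_eq ?_)
    · simpa only [norm_smul, fourier_norm, mul_one] using ha
    · simp only [norm_smul, fourier_norm, mul_one]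
  -- Hermitian symmetry says that H and its conjugate have the same coefficients, so H is
  -- real-valued and taking the real part loses nothing.
  have hreal : (⟨fun t => conj (H t), by fun_prop⟩ : C(AddCircle ℓ, ℂ)) = H := by
    refine ccoef_ext fun n => ?_
    rw [ccoef_conj (F := H) (fun t => rfl), hcoef, hcoef, hc, Complex.conj_conj]
  refine ⟨⟨fun t => (H t).re, by fun_prop⟩, fun n => ?_, ?_⟩
  · rw [coef, ← hcoef n]
    congr 1
    ext t
    have := congrArg (fun G : C(AddCircle ℓ, ℂ) => G t) hreal
    exact Complex.conj_eq_iff_re.1 this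
  · refine (ContinuousMap.norm_le _ (by positivity)).2 fun t => ?_
    exact (Complex.abs_re_le_norm _).trans ((H.norm_coe_le_norm t).trans hnorm)

/-- Fourier multipliers with square-summable symbol act on the continuous functions. -/
theorem exists_multiplier (κ : ℤ → ℂ) (hκ : Summable fun n => ‖κ n‖ ^ 2)
    (hc : ∀ n, κ (-n) = conj (κ n)) :
    ∃ M : C(AddCircle ℓ, ℝ) →L[ℝ] C(AddCircle ℓ, ℝ), ∀ F n, coef (M F) n = κ n * coef F n := by
  have key : ∀ F : C(AddCircle ℓ, ℝ), ∃ G : C(AddCircle ℓ, ℝ), (∀ n, coef G n = κ n * coef F n) ∧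
      ‖G‖ ≤ √(∑' n, ‖κ n‖ ^ 2) * ‖F‖ := fun F => by
    obtain ⟨S, hS, hF⟩ := hasSum_sq_coef F
    -- Cauchy–Schwarz: the product of two square-summable sequences is summable, which yields both
    -- convergence and the operator bound.
    have hh := Real.summable_and_inner_le_Lp_mul_Lq_tsum_of_nonneg Real.HolderConjugate.two_two
      (f := fun n => ‖κ n‖) (g := fun n => ‖coef F n‖) (fun n => norm_nonneg _)
      (fun n => norm_nonneg _) (by simpa using hκ) (by simpa using hF.summable)
    obtain ⟨G, hG, hG'⟩ := exists_coef_eq (ℓ := ℓ) (a := fun n => κ n * coef F n)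
      (by simpa only [norm_mul] using hh.1)
      (fun n => by rw [hc, coef_neg, map_mul])
    refine ⟨G, hG, hG'.trans ?_⟩
    simp only [norm_mul]
    refine hh.2.trans ?_
    simp only [Real.rpow_two, ← Real.sqrt_eq_rpow]
    rw [hF.tsum_eq]
    gcongr
    exact Real.sqrt_le_iff.2 ⟨norm_nonneg _, hS⟩
  choose G hG hG' using key
  refine ⟨LinearMap.mkContinuous
    { toFun := G
      map_add' := fun F F' => coef_ext fun n => by simp only [hG, coef_add, mul_add]
      map_smul' := fun c F => coef_ext fun n => by
        simp only [hG, coef_smul, RingHom.id_apply]; ring } _ hG', hG⟩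

/-! ### Translations and derivatives -/

/-- The translate `F(· + h)`. -/
def translate (h : AddCircle ℓ) (F : C(AddCircle ℓ, ℝ)) : C(AddCircle ℓ, ℝ) :=
  ⟨fun t => F (t + h), by fun_prop⟩

lemma coef_translate (h : AddCircle ℓ) (F : C(AddCircle ℓ, ℝ)) (n : ℤ) :
    coef (translate h F) n = fourier n h * coef F n := by
  have e : ∀ t : AddCircle ℓ, fourier (-n) t * ((translate h F) t : ℂ) =
      (fun s => fourier n h * (fourier (-n) s * (F s : ℂ))) (t + h) := fun t => by
    have h1 : fourier n h * fourier (-n) h = (1 : ℂ) := by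
      rw [← fourier_add, add_neg_cancel, fourier_zero]
    have h2 : (fourier (-n) (t + h) : ℂ) = fourier (-n) t * fourier (-n) h := by
      simp [fourier_apply, smul_add, AddCircle.toCircle_add]
    simp only [h2]
    change fourier (-n) t * (F (t + h) : ℂ) = _
    linear_combination (-fourier (-n) t * (F (t + h) : ℂ)) * h1
  rw [coef_eq_integral, coef_eq_integral, ← integral_const_mul]
  simp_rw [e]
  exact integral_add_right_eq_self (fun s => fourier n h * (fourier (-n) s * (F s : ℂ))) h

/-- Both operators are diagonal on Fourier modes. Commutation is what turns sup norm bounds into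
Hölder bounds. -/
lemma multiplier_translate {κ : ℤ → ℂ} {M : C(AddCircle ℓ, ℝ) →L[ℝ] C(AddCircle ℓ, ℝ)}
    (hM : ∀ F n, coef (M F) n = κ n * coef F n) (h : AddCircle ℓ) (F : C(AddCircle ℓ, ℝ)) :
    M (translate h F) = translate h (M F) :=
  coef_ext fun n => by rw [hM, coef_translate, coef_translate, hM]; ring

/-- The symbol `2πin/ℓ` of the derivative. -/
def freq (ℓ : ℝ) (n : ℤ) : ℂ := 2 * Real.pi * I * n / ℓ

lemma freq_ne_zero {n : ℤ} (hn : n ≠ 0) : freq ℓ n ≠ 0 := by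
  have h1 : (ℓ : ℂ) ≠ 0 := by exact_mod_cast hℓ.out.ne'
  have h2 : (n : ℂ) ≠ 0 := by exact_mod_cast hn
  have h3 : (Real.pi : ℂ) ≠ 0 := by exact_mod_cast Real.pi_ne_zero
  simp [freq, h1, h2, h3]

lemma coef_eq_intervalIntegral (F : C(AddCircle ℓ, ℝ)) (n : ℤ) :
    coef F n = (1 / ℓ : ℝ) • ∫ t in (-ℓ / 2)..(ℓ / 2),
      fourier (-n) (t : AddCircle ℓ) * (F (t : AddCircle ℓ) : ℂ) := by
  have := fourierCoeff_eq_intervalIntegral (toComplex F) n (-ℓ / 2)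
  rw [show -ℓ / 2 + ℓ = ℓ / 2 by ring] at this
  exact this

/-- Integration by parts against an exponential, for functions with periodic end values. -/
lemma integral_fourier_mul_deriv {f f' : ℝ → ℂ} (hf : ContinuousOn f (Set.Icc (-ℓ / 2) (ℓ / 2)))
    (hf' : ContinuousOn f' (Set.Icc (-ℓ / 2) (ℓ / 2)))
    (hd : ∀ t ∈ Set.Ioo (-ℓ / 2) (ℓ / 2), HasDerivAt f (f' t) t) (he : f (-ℓ / 2) = f (ℓ / 2))
    (n : ℤ) :
    ∫ t in (-ℓ / 2)..(ℓ / 2), fourier (-n) (t : AddCircle ℓ) * f' t =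
      freq ℓ n * ∫ t in (-ℓ / 2)..(ℓ / 2), fourier (-n) (t : AddCircle ℓ) * f t := by
  have hle : -ℓ / 2 ≤ ℓ / 2 := by have := hℓ.out; linarith
  have hcont : Continuous fun t : ℝ => (fourier (-n) (t : AddCircle ℓ) : ℂ) :=
    (fourier (-n) : C(AddCircle ℓ, ℂ)).continuous.comp (AddCircle.continuous_mk' ℓ)
  have h := intervalIntegral.integral_mul_deriv_eq_deriv_mul_of_hasDeriv_right
    (u := fun t : ℝ => (fourier (-n) (t : AddCircle ℓ) : ℂ)) (v := f)
    (u' := fun t : ℝ => -2 * Real.pi * I * n / ℓ * fourier (-n) (t : AddCircle ℓ)) (v' := f')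
    (a := -ℓ / 2) (b := ℓ / 2) hcont.continuousOn (by rwa [Set.uIcc_of_le hle])
    (fun x _ => (hasDerivAt_fourier_neg ℓ n x).hasDerivWithinAt)
    (fun x hx => (hd x (by simpa [min_eq_left hle, max_eq_right hle] using hx)).hasDerivWithinAt)
    ((hcont.const_mul _).intervalIntegrable _ _)
    (ContinuousOn.intervalIntegrable (by rwa [Set.uIcc_of_le hle]))
  have e1 : ((ℓ / 2 : ℝ) : AddCircle ℓ) = ((-ℓ / 2 : ℝ) : AddCircle ℓ) := by
    have := AddCircle.coe_add_period ℓ (-ℓ / 2)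
    rwa [show -ℓ / 2 + ℓ = ℓ / 2 by ring] at this
  rw [h, e1, he, sub_self, zero_sub, ← intervalIntegral.integral_neg,
    ← intervalIntegral.integral_const_mul]
  congr 1
  ext t
  rw [freq]; ring

lemma coef_of_hasDerivAt {F G : C(AddCircle ℓ, ℝ)}
    (h : ∀ t ∈ Set.Ioo (-ℓ / 2) (ℓ / 2), HasDerivAt (fun s : ℝ => F s) (G (t : AddCircle ℓ)) t)
    (n : ℤ) : coef G n = freq ℓ n * coef F n := by
  have hcF : Continuous fun t : ℝ => (F (t : AddCircle ℓ) : ℂ) :=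
    (toComplex F).continuous.comp (AddCircle.continuous_mk' ℓ)
  have hcG : Continuous fun t : ℝ => (G (t : AddCircle ℓ) : ℂ) :=
    (toComplex G).continuous.comp (AddCircle.continuous_mk' ℓ)
  have e1 : ((ℓ / 2 : ℝ) : AddCircle ℓ) = ((-ℓ / 2 : ℝ) : AddCircle ℓ) := by
    have := AddCircle.coe_add_period ℓ (-ℓ / 2)
    rwa [show -ℓ / 2 + ℓ = ℓ / 2 by ring] at this
  rw [coef_eq_intervalIntegral, coef_eq_intervalIntegral, mul_smul_comm,
    integral_fourier_mul_deriv hcF.continuousOn hcG.continuousOn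
      (fun t ht => (h t ht).ofReal_comp) (by rw [e1])]

/-- The case n = 0 says that G has mean zero, so its primitive P is periodic. Integration by parts
gives P the same nonzero-index coefficients as F, hence F - P is constant. -/
lemma hasDerivAt_of_coef {F G : C(AddCircle ℓ, ℝ)} (h : ∀ n, coef G n = freq ℓ n * coef F n)
    (t : ℝ) : HasDerivAt (fun s : ℝ => F s) (G (t : AddCircle ℓ)) t := by
  have hcG : Continuous fun t : ℝ => G (t : AddCircle ℓ) :=
    G.continuous.comp (AddCircle.continuous_mk' ℓ)
  set P : ℝ → ℝ := fun t => ∫ s in (-ℓ / 2)..t, G (s : AddCircle ℓ) with hP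
  have hPd : ∀ t : ℝ, HasDerivAt P (G (t : AddCircle ℓ)) t := fun t =>
    intervalIntegral.integral_hasDerivAt_right (hcG.intervalIntegrable _ _)
      (hcG.stronglyMeasurableAtFilter _ _) hcG.continuousAt
  have hmean : ∫ s in (-ℓ / 2)..(ℓ / 2), G (s : AddCircle ℓ) = 0 := by
    have h0 : coef G 0 = 0 := by rw [h 0]; simp [freq]
    rw [coef_eq_intervalIntegral] at h0
    have hne : (1 / ℓ : ℝ) ≠ 0 := one_div_ne_zero hℓ.out.ne'
    have h1 := (smul_eq_zero.1 h0).resolve_left hne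
    simp only [neg_zero, fourier_zero, one_mul] at h1
    rw [intervalIntegral.integral_ofReal] at h1
    exact_mod_cast h1
  have hper : Function.Periodic P ℓ := fun t => by
    have h1 : Function.Periodic (fun s : ℝ => G (s : AddCircle ℓ)) ℓ := fun s => by
      simp only [AddCircle.coe_add_period]
    have h2 := h1.intervalIntegral_add_eq t (-ℓ / 2)
    rw [show -ℓ / 2 + ℓ = ℓ / 2 by ring, hmean] at h2
    rw [hP, ← sub_eq_zero]
    simp only
    rw [intervalIntegral.integral_interval_sub_left (hcG.intervalIntegrable _ _)
      (hcG.intervalIntegrable _ _), h2]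
  have hPc : Continuous P := continuous_iff_continuousAt.2 fun t => (hPd t).continuousAt
  let H : C(AddCircle ℓ, ℝ) := ⟨hper.lift,
    (QuotientAddGroup.isQuotientMap_mk (N := AddSubgroup.zmultiples ℓ)).continuous_iff.2 hPc⟩
  have hHP : ∀ t : ℝ, H (t : AddCircle ℓ) = P t := fun t => rfl
  have hcH : ∀ n, coef G n = freq ℓ n * coef H n := coef_of_hasDerivAt fun t _ => hPd t
  obtain ⟨c, hc⟩ := eq_const_of_coef (F := F - H) fun n hn => by
    rw [coef_sub, sub_eq_zero]
    exact mul_left_cancel₀ (freq_ne_zero hn) (by rw [← h, ← hcH])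
  have hF : (fun s : ℝ => F (s : AddCircle ℓ)) = fun s => P s + c := funext fun s => by
    have := hc s
    rw [ContinuousMap.sub_apply, hHP] at this
    linarith
  rw [hF]
  exact (hPd t).add_const c

end Circle

/-! ### Functions on the cell and functions on the circle -/

section Cell

variable {ℓ : ℝ} [hℓ : Fact (0 < ℓ)]

/-- The restriction to the cell of a function on the circle. -/
def restr : C(AddCircle ℓ, ℝ) →ₗ[ℝ] (Cell ℓ → ℝ) where
  toFun F η := F ((η : ℝ) : AddCircle ℓ)
  map_add' _ _ := rfl
  map_smul' _ _ := rfl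

lemma restr_apply (F : C(AddCircle ℓ, ℝ)) (η : Cell ℓ) : restr F η = F ((η : ℝ) : AddCircle ℓ) := rfl

lemma exists_cell_eq (t : AddCircle ℓ) : ∃ η : Cell ℓ, ((η : ℝ) : AddCircle ℓ) = t := by
  have h : t ∈ ((↑) : ℝ → AddCircle ℓ) '' Set.Icc (-ℓ / 2) (-ℓ / 2 + ℓ) := by
    rw [AddCircle.coe_image_Icc_eq]; trivial
  obtain ⟨x, hx, rfl⟩ := h
  rw [show -ℓ / 2 + ℓ = ℓ / 2 by ring] at hx
  exact ⟨⟨x, hx⟩, rfl⟩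

lemma restr_injective : Function.Injective (restr (ℓ := ℓ)) := fun F G h => by
  ext t
  obtain ⟨η, rfl⟩ := exists_cell_eq t
  exact congrFun h η

lemma continuous_restr (F : C(AddCircle ℓ, ℝ)) : Continuous (restr F) :=
  F.continuous.comp ((AddCircle.continuous_mk' ℓ).comp continuous_subtype_val)

lemma coe_half_eq : ((ℓ / 2 : ℝ) : AddCircle ℓ) = ((-ℓ / 2 : ℝ) : AddCircle ℓ) := by
  have := AddCircle.coe_add_period ℓ (-ℓ / 2)
  rwa [show -ℓ / 2 + ℓ = ℓ / 2 by ring] at this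

lemma endsAgree_restr (F : C(AddCircle ℓ, ℝ)) : EndsAgree (restr F) := fun a b ha hb => by
  rw [restr_apply, restr_apply, ha, hb, coe_half_eq]

lemma half_le : -ℓ / 2 ≤ ℓ / 2 := by have := hℓ.out; linarith

lemma exists_restr_eq {f : Cell ℓ → ℝ} (hf : Continuous f) (he : EndsAgree f) :
    ∃ F, restr F = f := by
  have h2 : -ℓ / 2 + ℓ = ℓ / 2 := by ring
  have hc : Continuous (Set.IccExtend (half_le (ℓ := ℓ)) f) := hf.Icc_extend'
  have hend : Set.IccExtend (half_le (ℓ := ℓ)) f (-ℓ / 2) =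
      Set.IccExtend (half_le (ℓ := ℓ)) f (-ℓ / 2 + ℓ) := by
    rw [h2, Set.IccExtend_left, Set.IccExtend_right]
    exact he _ _ rfl rfl
  refine ⟨⟨AddCircle.liftIco ℓ (-ℓ / 2) _, AddCircle.liftIco_continuous hend hc.continuousOn⟩, ?_⟩
  ext η
  rw [restr_apply, ContinuousMap.coe_mk]
  rcases η.2.2.lt_or_eq with h | h
  · refine (AddCircle.liftIco_coe_apply ⟨η.2.1, by rwa [h2]⟩).trans ?_
    rw [Set.IccExtend_of_mem _ _ η.2]
  · rw [h, coe_half_eq]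
    refine (AddCircle.liftIco_coe_apply ⟨le_rfl, lt_add_of_pos_right _ hℓ.out⟩).trans ?_
    rw [Set.IccExtend_left]
    exact he _ _ rfl h

lemma norm_eq_iSup (F : C(AddCircle ℓ, ℝ)) : ‖F‖ = ⨆ η : Cell ℓ, |restr F η| := by
  have hb : BddAbove (Set.range fun η : Cell ℓ => |restr F η|) :=
    ⟨‖F‖, by rintro _ ⟨η, rfl⟩; exact F.norm_coe_le_norm _⟩
  have : Nonempty (Cell ℓ) := ⟨⟨_, Set.left_mem_Icc.2 half_le⟩⟩
  refine le_antisymm ?_ (ciSup_le fun η => F.norm_coe_le_norm _)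
  refine (ContinuousMap.norm_le _ (Real.iSup_nonneg fun _ => abs_nonneg _)).2 fun t => ?_
  obtain ⟨η, rfl⟩ := exists_cell_eq t
  exact le_ciSup hb η

/-! ### Derivatives on the cell and Fourier coefficients -/

lemma HasDerivOn.congr_deriv {S : Set ℝ} {f g h : S → ℝ} (hS : UniqueDiffOn ℝ S)
    (hg : HasDerivOn f g) (hh : HasDerivOn f h) : g = h :=
  funext fun x => (hS x x.2).eq_deriv _ (hg x) (hh x)

lemma HasDerivOn.derivOn_eq {S : Set ℝ} {f g : S → ℝ} (hS : UniqueDiffOn ℝ S)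
    (hg : HasDerivOn f g) : derivOn f = g :=
  funext fun x => (hg x).derivWithin (hS x x.2)

lemma HasDerivOn.continuous {S : Set ℝ} {f g : S → ℝ} (h : HasDerivOn f g) : Continuous f := by
  have : ContinuousOn (Function.extend Subtype.val f 0) S := fun x hx =>
    (h ⟨x, hx⟩).continuousWithinAt
  have h2 := this.domRestrict
  have e : S.domRestrict (Function.extend Subtype.val f 0) = f := funext fun x => extend_val f x
  rwa [e] at h2

lemma hasDerivOn_of_hasDerivWithinAt {S : Set ℝ} {f g : S → ℝ} {F : ℝ → ℝ} (hF : ∀ x : S, F x = f x)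
    (h : ∀ x : S, HasDerivWithinAt F (g x) S x) : HasDerivOn f g := fun x =>
  (h x).congr_of_mem (fun y hy => (extend_val f ⟨y, hy⟩).trans (hF ⟨y, hy⟩).symm) x.2

lemma HasDerivOn.hasDerivAt {S : Set ℝ} {f g : S → ℝ} (h : HasDerivOn f g) {F : ℝ → ℝ}
    (hF : ∀ x : S, F x = f x) (x : S) (hx : S ∈ 𝓝 (x : ℝ)) : HasDerivAt F (g x) x :=
  ((h x).congr_of_mem (fun y hy => (hF ⟨y, hy⟩).trans (extend_val f ⟨y, hy⟩).symm) x.2).hasDerivAt hx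

lemma uniqueDiffOn_cell : UniqueDiffOn ℝ (Cell ℓ) :=
  uniqueDiffOn_Icc (by have := hℓ.out; linarith)

/-- The dictionary used throughout: every statement about η-derivatives of periodic functions
becomes an identity between coefficients. -/
lemma hasDerivOn_restr_iff {F G : C(AddCircle ℓ, ℝ)} :
    HasDerivOn (restr F) (restr G) ↔ ∀ n, coef G n = freq ℓ n * coef F n := by
  refine ⟨fun h => coef_of_hasDerivAt fun t ht => ?_, fun h => ?_⟩
  · exact h.hasDerivAt (F := fun s : ℝ => F s) (fun x => rfl) ⟨t, Set.Ioo_subset_Icc_self ht⟩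
      (Icc_mem_nhds ht.1 ht.2)
  · exact hasDerivOn_of_hasDerivWithinAt (F := fun s : ℝ => F s) (fun _ => rfl)
      fun x => (hasDerivAt_of_coef h x).hasDerivWithinAt

/-! ### Hölder functions -/

/-- The Hölder condition is on the cell, not on the circle. A shift that crosses the identified end
points is cut there into two pieces of length at most h, whence the factor 2. -/
lemma norm_translate_sub_le {θ : ℝ≥0} {C : ℝ≥0} {F : C(AddCircle ℓ, ℝ)}
    (hF : HolderWith C θ (restr F)) {h : ℝ} (h0 : 0 ≤ h) (h1 : h ≤ ℓ) :
    ‖translate (h : AddCircle ℓ) F - F‖ ≤ 2 * C * h ^ (θ : ℝ) := by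
  have hp : 0 ≤ h ^ (θ : ℝ) := Real.rpow_nonneg h0 _
  have key : ∀ x y : Cell ℓ, (x : ℝ) ≤ y → (y : ℝ) - x ≤ h →
      |restr F y - restr F x| ≤ C * h ^ (θ : ℝ) := fun x y hxy hyx => by
    have := hF.dist_le y x
    rw [Real.dist_eq] at this
    refine this.trans ?_
    gcongr
    rw [Subtype.dist_eq, Real.dist_eq, abs_of_nonneg (by linarith)]
    exact hyx
  refine (ContinuousMap.norm_le _ (by positivity)).2 fun t => ?_
  have hl := hℓ.out
  obtain ⟨x, rfl⟩ := exists_cell_eq t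
  obtain ⟨x, hx⟩ := x
  change |F ((x : AddCircle ℓ) + (h : AddCircle ℓ)) - F (x : AddCircle ℓ)| ≤ _
  rw [← AddCircle.coe_add]
  by_cases hc : x + h ≤ ℓ / 2
  · have := key ⟨x, hx⟩ ⟨x + h, by linarith [hx.1], hc⟩ (by simpa using h0) (by simp)
    change |F ((x + h : ℝ) : AddCircle ℓ) - F (x : AddCircle ℓ)| ≤ _ at this
    nlinarith [mul_nonneg C.coe_nonneg hp]
  · push Not at hc
    have e : ((x + h : ℝ) : AddCircle ℓ) = ((x + h - ℓ : ℝ) : AddCircle ℓ) := by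
      rw [← AddCircle.coe_add_period ℓ (x + h - ℓ)]; congr 1; ring
    have k1 := key ⟨-ℓ / 2, Set.left_mem_Icc.2 half_le⟩ ⟨x + h - ℓ, by linarith, by linarith [hx.2]⟩
      (by change -ℓ / 2 ≤ x + h - ℓ; linarith) (by change x + h - ℓ - -ℓ / 2 ≤ h; linarith [hx.2])
    have k2 := key ⟨x, hx⟩ ⟨ℓ / 2, Set.right_mem_Icc.2 half_le⟩ hx.2
      (by change ℓ / 2 - x ≤ h; linarith)
    rw [restr_apply, restr_apply] at k1 k2
    simp only at k1 k2
    rw [coe_half_eq] at k2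
    rw [e]
    have := abs_sub_le (F ((x + h - ℓ : ℝ) : AddCircle ℓ)) (F ((-ℓ / 2 : ℝ) : AddCircle ℓ))
      (F (x : AddCircle ℓ))
    linarith

/-- For x ≤ y the increment is the value at x of M applied to the translate of F by y - x, minus F;
the sup norm bound for M then suffices. -/
lemma HolderWith.multiplier {θ : ℝ≥0} {C : ℝ≥0} {F : C(AddCircle ℓ, ℝ)} {κ : ℤ → ℂ}
    {M : C(AddCircle ℓ, ℝ) →L[ℝ] C(AddCircle ℓ, ℝ)} (hM : ∀ F n, coef (M F) n = κ n * coef F n)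
    (hF : HolderWith C θ (restr F)) : HolderWith (‖M‖₊ * (2 * C)) θ (restr (M F)) := by
  have key : ∀ x y : Cell ℓ, (x : ℝ) ≤ y →
      |restr (M F) y - restr (M F) x| ≤ (‖M‖₊ * (2 * C) : ℝ≥0) * ((y : ℝ) - x) ^ (θ : ℝ) :=
    fun x y hxy => by
    have h1 := norm_translate_sub_le hF (h := (y : ℝ) - x) (by linarith)
      (by linarith [x.2.1, y.2.2])
    have h2 := M.le_opNorm (translate (((y : ℝ) - x : ℝ) : AddCircle ℓ) F - F)
    rw [map_sub, multiplier_translate hM] at h2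
    have h3 := ContinuousMap.norm_coe_le_norm
      (translate (((y : ℝ) - x : ℝ) : AddCircle ℓ) (M F) - M F) ((x : ℝ) : AddCircle ℓ)
    have e : (translate (((y : ℝ) - x : ℝ) : AddCircle ℓ) (M F) - M F) ((x : ℝ) : AddCircle ℓ) =
        restr (M F) y - restr (M F) x := by
      change M F (((x : ℝ) : AddCircle ℓ) + _) - _ = _
      rw [← AddCircle.coe_add, add_sub_cancel]; rfl
    rw [e, Real.norm_eq_abs] at h3
    refine h3.trans (h2.trans ?_)
    push_cast
    rw [mul_assoc]
    gcongr
  intro x y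
  rw [edist_nndist, edist_nndist, ← ENNReal.coe_rpow_of_nonneg _ θ.coe_nonneg, ← ENNReal.coe_mul,
    ENNReal.coe_le_coe, ← NNReal.coe_le_coe]
  push_cast
  rw [Real.dist_eq, Subtype.dist_eq, Real.dist_eq]
  rcases le_total (x : ℝ) y with h | h
  · rw [abs_sub_comm, abs_sub_comm (x : ℝ), abs_of_nonneg (sub_nonneg.2 h)]
    simpa using key x y h
  · rw [abs_of_nonneg (sub_nonneg.2 h)]
    simpa using key y x h

lemma MemHolder.multiplier {θ : ℝ≥0} {F : C(AddCircle ℓ, ℝ)} {κ : ℤ → ℂ}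
    {M : C(AddCircle ℓ, ℝ) →L[ℝ] C(AddCircle ℓ, ℝ)} (hM : ∀ F n, coef (M F) n = κ n * coef F n)
    (hF : MemHolder θ (restr F)) : MemHolder θ (restr (M F)) :=
  (HolderWith.multiplier hM hF.holderWith).memHolder

lemma nnHolderNorm_multiplier_le {θ : ℝ≥0} {F : C(AddCircle ℓ, ℝ)} {κ : ℤ → ℂ}
    {M : C(AddCircle ℓ, ℝ) →L[ℝ] C(AddCircle ℓ, ℝ)} (hM : ∀ F n, coef (M F) n = κ n * coef F n)
    (hF : MemHolder θ (restr F)) :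
    (nnHolderNorm θ (restr (M F)) : ℝ) ≤ 2 * ‖M‖ * nnHolderNorm θ (restr F) := by
  have h := (HolderWith.multiplier hM hF.holderWith).nnholderNorm_le
  have h2 : (nnHolderNorm θ (restr (M F)) : ℝ) ≤
      ((‖M‖₊ * (2 * nnHolderNorm θ (restr F)) : ℝ≥0) : ℝ) := by exact_mod_cast h
  push_cast at h2
  linarith

/-! ### The spaces `C_♯` in terms of functions on the circle -/

lemma mem_cSharp_zero_iff {θ : ℝ≥0} {f : Cell ℓ → ℝ} :
    f ∈ CSharp ℓ 0 θ ↔ ∃ F : C(AddCircle ℓ, ℝ), restr F = f ∧ MemHolder θ (restr F) := by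
  constructor
  · rintro ⟨d, rfl, -, hc, hh, he⟩
    obtain ⟨F, hF⟩ := exists_restr_eq hc (he 0 le_rfl)
    exact ⟨F, hF, hF ▸ hh⟩
  · rintro ⟨F, rfl, hh⟩
    refine ⟨fun _ => restr F, rfl, fun j hj => absurd hj (Nat.not_lt_zero j), continuous_restr F, hh,
      fun _ _ => endsAgree_restr F⟩

/-- The end point conditions up to order 2 are exactly what lets f and its two derivatives descend
to continuous functions on the circle. -/
lemma mem_cSharp_two_iff {θ : ℝ≥0} {f : Cell ℓ → ℝ} :
    f ∈ CSharp ℓ 2 θ ↔ ∃ F F₁ F₂ : C(AddCircle ℓ, ℝ), restr F = f ∧ (∀ n, coef F₁ n = freq ℓ n * coef F n) ∧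
      (∀ n, coef F₂ n = freq ℓ n * coef F₁ n) ∧ MemHolder θ (restr F₂) := by
  constructor
  · rintro ⟨d, rfl, hd, hc, hh, he⟩
    have h0 := hd 0 (by norm_num)
    have h1 := hd 1 (by norm_num)
    obtain ⟨F, hF⟩ := exists_restr_eq h0.continuous (he 0 (by norm_num))
    obtain ⟨F₁, hF₁⟩ := exists_restr_eq h1.continuous (he 1 (by norm_num))
    obtain ⟨F₂, hF₂⟩ := exists_restr_eq hc (he 2 le_rfl)
    refine ⟨F, F₁, F₂, hF, ?_, ?_, hF₂ ▸ hh⟩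
    · rw [← hasDerivOn_restr_iff, hF, hF₁]; exact h0
    · rw [← hasDerivOn_restr_iff, hF₁, hF₂]; exact h1
  · rintro ⟨F, F₁, F₂, rfl, h0, h1, hh⟩
    refine ⟨fun j => restr (if j = 0 then F else if j = 1 then F₁ else F₂), rfl, fun j hj => ?_,
      continuous_restr _, hh, fun _ _ => endsAgree_restr _⟩
    interval_cases j
    · exact hasDerivOn_restr_iff.2 h0
    · exact hasDerivOn_restr_iff.2 h1

lemma holderNorm_zero_restr (θ : ℝ≥0) (F : C(AddCircle ℓ, ℝ)) :
    holderNorm 0 θ (restr F) = ‖F‖ + nnHolderNorm θ (restr F) := by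
  simp [holderNorm, norm_eq_iSup]

lemma holderNorm_two_restr (θ : ℝ≥0) {F F₁ F₂ : C(AddCircle ℓ, ℝ)}
    (h1 : ∀ n, coef F₁ n = freq ℓ n * coef F n) (h2 : ∀ n, coef F₂ n = freq ℓ n * coef F₁ n) :
    holderNorm 2 θ (restr F) = ‖F‖ + ‖F₁‖ + ‖F₂‖ + nnHolderNorm θ (restr F₂) := by
  have e1 : derivOn (restr F) = restr F₁ :=
    (hasDerivOn_restr_iff.2 h1).derivOn_eq uniqueDiffOn_cell
  have e2 : derivOn (restr F₁) = restr F₂ :=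
    (hasDerivOn_restr_iff.2 h2).derivOn_eq uniqueDiffOn_cell
  simp [holderNorm, norm_eq_iSup, Finset.sum_range_succ, e1, e2]

end Cell

/-! ### Symbols -/

/-- The eigenvalue of `-ε D_ηη` on the `n`-th Fourier mode. -/
def modeEig (ℓ ε : ℝ) (n : ℤ) : ℝ := ε * (2 * Real.pi * n / ℓ) ^ 2

/-- The larger root of `r² - r = μ`. -/
def charRoot (μ : ℝ) : ℝ := (1 + √(1 + 4 * μ)) / 2

lemma charRoot_mul (μ : ℝ) (hμ : 0 ≤ μ) : charRoot μ * (charRoot μ - 1) = μ := by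
  have := Real.sq_sqrt (show 0 ≤ 1 + 4 * μ by linarith)
  rw [charRoot]
  linear_combination this / 4

lemma one_le_charRoot {μ : ℝ} (hμ : 0 ≤ μ) : 1 ≤ charRoot μ := by
  have : 1 ≤ √(1 + 4 * μ) := Real.one_le_sqrt.2 (by linarith)
  rw [charRoot]; linarith

lemma one_lt_charRoot {μ : ℝ} (hμ : 0 < μ) : 1 < charRoot μ := by
  refine lt_of_le_of_ne (one_le_charRoot hμ.le) fun h => ?_
  have := charRoot_mul μ hμ.le
  rw [← h] at this
  linarith

/-- The root `r` for the `n`-th Fourier mode. -/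
def modeRoot (ℓ ε : ℝ) (n : ℤ) : ℝ := charRoot (modeEig ℓ ε n)

section Symbols

variable {ℓ : ℝ} [hℓ : Fact (0 < ℓ)] {ε : ℝ}

lemma modeEig_nonneg (hε : 0 < ε) (n : ℤ) : 0 ≤ modeEig ℓ ε n := by
  unfold modeEig; positivity

lemma modeEig_neg (n : ℤ) : modeEig ℓ ε (-n) = modeEig ℓ ε n := by
  simp only [modeEig]; push_cast; ring

lemma modeEig_eq (n : ℤ) : modeEig ℓ ε n = ε * (2 * Real.pi / ℓ) ^ 2 * (n : ℝ) ^ 2 := by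
  simp only [modeEig]; ring

lemma modeEig_pos (hε : 0 < ε) {n : ℤ} (hn : n ≠ 0) : 0 < modeEig ℓ ε n := by
  have h1 := hℓ.out
  have h2 : (n : ℝ) ≠ 0 := by exact_mod_cast hn
  have h3 := Real.pi_pos
  rw [modeEig_eq]; positivity

lemma modeEig_coe (n : ℤ) : ((modeEig ℓ ε n : ℝ) : ℂ) = -(ε * freq ℓ n ^ 2) := by
  simp only [modeEig, freq]
  push_cast
  linear_combination (ε * (2 * Real.pi * n / ℓ) ^ 2 : ℂ) * Complex.I_sq

lemma one_le_modeRoot (hε : 0 < ε) (n : ℤ) : 1 ≤ modeRoot ℓ ε n :=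
  one_le_charRoot (modeEig_nonneg hε n)

lemma modeRoot_mul (hε : 0 < ε) (n : ℤ) :
    modeRoot ℓ ε n * (modeRoot ℓ ε n - 1) = modeEig ℓ ε n :=
  charRoot_mul _ (modeEig_nonneg hε n)

lemma modeRoot_neg (n : ℤ) : modeRoot ℓ ε (-n) = modeRoot ℓ ε n := by
  rw [modeRoot, modeEig_neg, modeRoot]

lemma summable_inv_modeEig : Summable fun n : ℤ => 1 / modeEig ℓ ε n := by
  have h : Summable fun n : ℤ => 1 / (ε * (2 * Real.pi / ℓ) ^ 2) * (1 / (n : ℝ) ^ 2) :=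
    (Real.summable_one_div_int_pow.2 one_lt_two).mul_left _
  refine h.congr fun n => ?_
  rw [modeEig_eq, one_div_mul_one_div]

/-- For n ≠ 0, r² ≥ r(r - 1) = μ, and μ is a positive multiple of n². -/
lemma summable_inv_modeRoot_sq (hε : 0 < ε) : Summable fun n : ℤ => 1 / modeRoot ℓ ε n ^ 2 := by
  refine Summable.of_norm_bounded_eventually (summable_inv_modeEig (ℓ := ℓ) (ε := ε)) ?_
  filter_upwards [(Set.finite_singleton (0 : ℤ)).compl_mem_cofinite] with n hn
  have h1 := one_le_modeRoot (ℓ := ℓ) hε n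
  have h2 := modeEig_pos (ℓ := ℓ) hε (n := n) hn
  rw [Real.norm_of_nonneg (by positivity)]
  refine one_div_le_one_div_of_le h2 ?_
  rw [← modeRoot_mul hε]; nlinarith

/-- Multipliers whose symbol decays like `1 / |n|`. -/
lemma exists_multiplier_of_le (hε : 0 < ε) {κ : ℤ → ℂ} {C : ℝ}
    (hκ : ∀ n, ‖κ n‖ ≤ C / modeRoot ℓ ε n) (hc : ∀ n, κ (-n) = conj (κ n)) :
    ∃ M : C(AddCircle ℓ, ℝ) →L[ℝ] C(AddCircle ℓ, ℝ), ∀ F n, coef (M F) n = κ n * coef F n := by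
  refine exists_multiplier κ (Summable.of_nonneg_of_le (fun n => by positivity) (fun n => ?_)
    ((summable_inv_modeRoot_sq (ℓ := ℓ) hε).mul_left (C ^ 2))) hc
  calc ‖κ n‖ ^ 2 ≤ (C / modeRoot ℓ ε n) ^ 2 := pow_le_pow_left₀ (norm_nonneg _) (hκ n) 2
    _ = _ := by rw [div_pow]; ring

lemma freq_neg (n : ℤ) : freq ℓ (-n) = conj (freq ℓ n) := by
  simp only [freq, map_div₀, map_mul, Complex.conj_I, Complex.conj_ofReal, map_ofNat, map_intCast]
  push_cast; ring

lemma freq_sq (hε : 0 < ε) (n : ℤ) : freq ℓ n ^ 2 = ((-(modeEig ℓ ε n / ε) : ℝ) : ℂ) := by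
  have : (ε : ℂ) ≠ 0 := by exact_mod_cast hε.ne'
  push_cast
  rw [modeEig_coe]; field_simp

lemma norm_freq_sq (hε : 0 < ε) (n : ℤ) : ‖freq ℓ n‖ ^ 2 = modeEig ℓ ε n / ε := by
  rw [← norm_pow]
  rw [freq_sq hε, Complex.norm_real, norm_neg, Real.norm_of_nonneg]
  exact div_nonneg (modeEig_nonneg hε n) hε.le

/-- One derivative costs at most one factor r, since its squared symbol has modulus r(r - 1)/ε. -/
lemma norm_freq_le (hε : 0 < ε) (n : ℤ) : ‖freq ℓ n‖ ≤ √(1 / ε) * modeRoot ℓ ε n := by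
  have h1 := one_le_modeRoot (ℓ := ℓ) hε n
  refine abs_le_of_sq_le_sq' ?_ (by positivity) |>.2
  rw [norm_freq_sq hε, mul_pow, Real.sq_sqrt (by positivity), one_div, ← modeRoot_mul hε,
    div_eq_inv_mul]
  gcongr
  nlinarith

/-- The symbol of `𝓑_ε`, in terms of the root `r`. -/
def symbB (r : ℝ) : ℝ := 3 * r * (2 * r ^ 2 - 1) / (2 * r + 1)

/-- After clearing the denominator this is r(r - 1)(4r + 3) ≥ 0. It is the ellipticity of 𝓑_ε: the
symbol does not vanish and has order two. -/
lemma le_symbB {r : ℝ} (hr : 1 ≤ r) : r ^ 2 ≤ symbB r := by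
  rw [symbB, le_div_iff₀ (by linarith)]
  nlinarith [mul_nonneg (sub_nonneg.2 hr) (sub_nonneg.2 hr), sq_nonneg r, pow_pos (show 0 < r by linarith) 3]

lemma symbB_pos {r : ℝ} (hr : 1 ≤ r) : 0 < symbB r :=
  lt_of_lt_of_le (by positivity) (le_symbB hr)

/-- With μ = r(r - 1) this separates the symbol 1 + 3μ of ψ - 3ε ψ_ηη from a lower-order part, which
is a smoothing operator applied to ψ_ηη. -/
lemma symbB_eq {r : ℝ} (hr : 1 ≤ r) :
    symbB r = 1 + 3 * (r * (r - 1)) + r * (r - 1) * (1 / r + 1 / (2 * r + 1)) := by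
  have h1 : r ≠ 0 := by linarith
  have h2 : 2 * r + 1 ≠ 0 := by linarith
  rw [symbB]; field_simp; ring

lemma exists_smoothing (hε : 0 < ε) : ∃ K : C(AddCircle ℓ, ℝ) →L[ℝ] C(AddCircle ℓ, ℝ), ∀ F n,
    coef (K F) n = ((1 / modeRoot ℓ ε n + 1 / (2 * modeRoot ℓ ε n + 1) : ℝ) : ℂ) * coef F n := by
  refine exists_multiplier_of_le (C := 2) hε (fun n => ?_)
    fun n => by rw [modeRoot_neg, Complex.conj_ofReal]
  have h1 := one_le_modeRoot (ℓ := ℓ) hε n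
  rw [Complex.norm_real, Real.norm_of_nonneg (by positivity)]
  have : 1 / (2 * modeRoot ℓ ε n + 1) ≤ 1 / modeRoot ℓ ε n :=
    one_div_le_one_div_of_le (by linarith) (by linarith)
  calc _ ≤ 1 / modeRoot ℓ ε n + 1 / modeRoot ℓ ε n := by linarith
    _ = _ := by ring

/-- N is the inverse of 𝓑_ε and N₁ its first derivative. The symbol of the second derivative tends
to -1/(3ε) and is not square-summable; N₂ is what is left, up to a factor, once this limit is split
off. -/
lemma exists_inverse (hε : 0 < ε) : ∃ N N₁ N₂ : C(AddCircle ℓ, ℝ) →L[ℝ] C(AddCircle ℓ, ℝ),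
    (∀ F n, coef (N F) n = ((1 / symbB (modeRoot ℓ ε n) : ℝ) : ℂ) * coef F n) ∧
    (∀ F n, coef (N₁ F) n = freq ℓ n * ((1 / symbB (modeRoot ℓ ε n) : ℝ) : ℂ) * coef F n) ∧
    (∀ F n, coef (N₂ F) n = ((modeRoot ℓ ε n / (2 * modeRoot ℓ ε n ^ 2 - 1) : ℝ) : ℂ) *
      coef F n) := by
  have h4 : ∀ n, modeRoot ℓ ε n ≤ symbB (modeRoot ℓ ε n) := fun n => by
    nlinarith [one_le_modeRoot (ℓ := ℓ) hε n, le_symbB (one_le_modeRoot (ℓ := ℓ) hε n)]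
  obtain ⟨N, hN⟩ := exists_multiplier_of_le (ℓ := ℓ) hε
    (κ := fun n => ((1 / symbB (modeRoot ℓ ε n) : ℝ) : ℂ)) (C := 1) (fun n => by
      have h1 := one_le_modeRoot (ℓ := ℓ) hε n
      have h3 := symbB_pos h1
      rw [Complex.norm_real, Real.norm_of_nonneg (by positivity)]
      exact one_div_le_one_div_of_le (by linarith) (h4 n))
    fun n => by rw [modeRoot_neg, Complex.conj_ofReal]
  obtain ⟨N₁, hN₁⟩ := exists_multiplier_of_le (ℓ := ℓ) hε
    (κ := fun n => freq ℓ n * ((1 / symbB (modeRoot ℓ ε n) : ℝ) : ℂ)) (C := √(1 / ε)) (fun n => by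
      have h1 := one_le_modeRoot (ℓ := ℓ) hε n
      have h2 := le_symbB h1
      have h3 := symbB_pos h1
      rw [norm_mul, Complex.norm_real, Real.norm_of_nonneg (by positivity), mul_one_div,
        div_le_div_iff₀ h3 (by linarith)]
      have h5 := norm_freq_le (ℓ := ℓ) hε n
      calc _ ≤ √(1 / ε) * modeRoot ℓ ε n * modeRoot ℓ ε n := by gcongr
        _ = √(1 / ε) * modeRoot ℓ ε n ^ 2 := by ring
        _ ≤ _ := by gcongr)
    fun n => by rw [modeRoot_neg, map_mul, Complex.conj_ofReal, freq_neg]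
  obtain ⟨N₂, hN₂⟩ := exists_multiplier_of_le (ℓ := ℓ) hε
    (κ := fun n => ((modeRoot ℓ ε n / (2 * modeRoot ℓ ε n ^ 2 - 1) : ℝ) : ℂ)) (C := 1) (fun n => by
      have h1 := one_le_modeRoot (ℓ := ℓ) hε n
      have : 0 < 2 * modeRoot ℓ ε n ^ 2 - 1 := by nlinarith
      rw [Complex.norm_real, Real.norm_of_nonneg (by positivity),
        div_le_div_iff₀ this (by linarith)]
      nlinarith)
    fun n => by rw [modeRoot_neg, Complex.conj_ofReal]
  exact ⟨N, N₁, N₂, hN, hN₁, hN₂⟩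

/-- The second derivative of `N G` is `-(G - N₂ G) / (3ε)`. -/
lemma coef_inverse_deriv (hε : 0 < ε) {N₁ N₂ : C(AddCircle ℓ, ℝ) →L[ℝ] C(AddCircle ℓ, ℝ)}
    (h₁ : ∀ F n, coef (N₁ F) n = freq ℓ n * ((1 / symbB (modeRoot ℓ ε n) : ℝ) : ℂ) * coef F n)
    (h₂ : ∀ F n, coef (N₂ F) n = ((modeRoot ℓ ε n / (2 * modeRoot ℓ ε n ^ 2 - 1) : ℝ) : ℂ) *
      coef F n) (G : C(AddCircle ℓ, ℝ)) (n : ℤ) :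
    coef ((-1 / (3 * ε)) • (G - N₂ G)) n = freq ℓ n * coef (N₁ G) n := by
  have h1 := one_le_modeRoot (ℓ := ℓ) hε n
  have e : -1 / (3 * ε) * (1 - modeRoot ℓ ε n / (2 * modeRoot ℓ ε n ^ 2 - 1)) =
      -(modeEig ℓ ε n / ε) * (1 / symbB (modeRoot ℓ ε n)) := by
    have h3 : (2 * modeRoot ℓ ε n ^ 2 - 1) ≠ 0 := by nlinarith
    rw [← modeRoot_mul hε, symbB, one_sub_div h3]
    field_simp
    ring
  have e2 := freq_sq (ℓ := ℓ) hε n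
  rw [coef_smul, coef_sub, h₁, h₂]
  have e' := congrArg (fun x : ℝ => (x : ℂ)) e
  simp only [Complex.ofReal_mul] at e'
  rw [← e2] at e'
  push_cast at e' ⊢
  linear_combination coef G n * e'

lemma coef_operator (hε : 0 < ε) {K : C(AddCircle ℓ, ℝ) →L[ℝ] C(AddCircle ℓ, ℝ)}
    (hK : ∀ F n, coef (K F) n =
      ((1 / modeRoot ℓ ε n + 1 / (2 * modeRoot ℓ ε n + 1) : ℝ) : ℂ) * coef F n)
    {F F₁ F₂ : C(AddCircle ℓ, ℝ)} (h1 : ∀ n, coef F₁ n = freq ℓ n * coef F n)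
    (h2 : ∀ n, coef F₂ n = freq ℓ n * coef F₁ n) (n : ℤ) :
    coef (F - (3 * ε) • F₂ - ε • K F₂) n = symbB (modeRoot ℓ ε n) * coef F n := by
  rw [coef_sub, coef_sub, coef_smul, coef_smul, hK, h2, h1,
    symbB_eq (one_le_modeRoot hε n), modeRoot_mul hε]
  simp only [Complex.ofReal_add, Complex.ofReal_mul, modeEig_coe, Complex.ofReal_one,
    Complex.ofReal_ofNat]
  ring

/-! ### Lipschitz functions are Hölder continuous -/

/-- F is Lipschitz with constant ‖F₁‖, and d ≤ ℓ^{1-θ} d^θ for distances d in a cell of length ℓ. -/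
lemma holderWith_of_coef {θ : ℝ≥0} (hθ' : θ ≤ 1) {F F₁ : C(AddCircle ℓ, ℝ)}
    (h1 : ∀ n, coef F₁ n = freq ℓ n * coef F n) :
    HolderWith (‖F₁‖₊ * (ℓ ^ (1 - (θ : ℝ))).toNNReal) θ (restr F) := by
  intro x y
  have hθ1 : 0 ≤ 1 - (θ : ℝ) := sub_nonneg.2 (by exact_mod_cast hθ')
  rw [edist_nndist, edist_nndist, ← ENNReal.coe_rpow_of_nonneg _ θ.coe_nonneg, ← ENNReal.coe_mul,
    ENNReal.coe_le_coe, ← NNReal.coe_le_coe]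
  push_cast
  have h := Convex.norm_image_sub_le_of_norm_hasDerivWithin_le (f := fun s : ℝ => F s)
    (f' := fun s : ℝ => F₁ s) (C := ‖F₁‖) (s := Set.univ)
    (fun t _ => (hasDerivAt_of_coef h1 t).hasDerivWithinAt) (fun t _ => F₁.norm_coe_le_norm _)
    convex_univ (Set.mem_univ (y : ℝ)) (Set.mem_univ (x : ℝ))
  have hd : dist x y ≤ ℓ := by
    rw [Subtype.dist_eq, Real.dist_eq, abs_le]
    constructor <;> linarith [x.2.1, x.2.2, y.2.1, y.2.2]
  calc dist (restr F x) (restr F y) ≤ ‖F₁‖ * dist x y := h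
    _ ≤ ‖F₁‖ * (ℓ ^ (1 - (θ : ℝ)) * dist x y ^ (θ : ℝ)) := by
      gcongr
      rcases (dist_nonneg (x := x) (y := y)).eq_or_lt' with h0 | h0
      · rw [h0]; have := hℓ.out; positivity
      · calc dist x y = dist x y ^ (1 - (θ : ℝ)) * dist x y ^ (θ : ℝ) := by
              rw [← Real.rpow_add h0]; simp
          _ ≤ _ := by gcongr
    _ = _ := by
      rw [Real.coe_toNNReal _ (Real.rpow_nonneg hℓ.out.le _), mul_assoc]

end Symbols

/-! ### Estimates for ordinary differential equations on half-lines -/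

lemma norm_sub_le_of_deriv_le {f f' : ℝ → ℂ} {g g' : ℝ → ℝ} {a b : ℝ} (hab : a ≤ b)
    (hf : ContinuousOn f (Set.Icc a b)) (hf' : ContinuousOn f' (Set.Icc a b))
    (hd : ∀ x ∈ Set.Ioo a b, HasDerivAt f (f' x) x)
    (hg : ∀ x, HasDerivAt g (g' x) x) (hg' : Continuous g')
    (h : ∀ x ∈ Set.Ioo a b, ‖f' x‖ ≤ g' x) : ‖f b - f a‖ ≤ g b - g a := by
  have i1 : IntervalIntegrable f' volume a b :=
    ContinuousOn.intervalIntegrable (by rwa [Set.uIcc_of_le hab])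
  rw [← intervalIntegral.integral_eq_sub_of_hasDerivAt_of_le hab hf hd i1,
    ← intervalIntegral.integral_eq_sub_of_hasDerivAt (fun x _ => hg x)
      (hg'.intervalIntegrable _ _)]
  refine intervalIntegral.norm_integral_le_of_norm_le hab ?_ (hg'.intervalIntegrable _ _)
  -- The integrals run over (a, b], the hypothesis over (a, b); the end point b is a null set.
  have : ∀ᵐ x : ℝ, x ≠ b := by simp [ae_iff, measure_singleton]
  filter_upwards [this] with x hx hx'
  exact h x ⟨hx'.1, lt_of_le_of_ne hx'.2 hx⟩

lemma hasDerivAt_exp_mul (k x : ℝ) :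
    HasDerivAt (fun s => Real.exp (k * s)) (k * Real.exp (k * x)) x := by
  have := (((hasDerivAt_id x).const_mul k).exp)
  simpa [mul_comm] using this

lemma hasDerivAt_cexp_mul (k x : ℝ) :
    HasDerivAt (fun s : ℝ => ((Real.exp (k * s) : ℝ) : ℂ)) ((k * Real.exp (k * x) : ℝ) : ℂ) x :=
  (hasDerivAt_exp_mul k x).ofReal_comp

/-- Since D² - D - μ = (D - r)(D + r - 1), the function w = v' + (r - 1)v satisfies (e^{-rx} w)' =
e^{-rx} F. The growth bound e^{x/2} makes e^{-rx} w vanish at +∞, and integration gives |w(0)| ≤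
N/(r - 1/2) ≤ 2N. The constant A enters only qualitatively. -/
lemma ode_pos_bound {v v₁ v₂ F : ℝ → ℂ} {μ r A N : ℝ} (hr : 1 ≤ r) (hμ : r * (r - 1) = μ)
    (hv : Continuous v) (hv₁ : Continuous v₁) (hv₂ : Continuous v₂)
    (d1 : ∀ x, 0 < x → HasDerivAt v (v₁ x) x) (d2 : ∀ x, 0 < x → HasDerivAt v₁ (v₂ x) x)
    (he : ∀ x, 0 ≤ x → v₂ x - v₁ x - μ * v x = F x)
    (hA : ∀ x, 0 ≤ x → ‖v x‖ ≤ A * Real.exp (x / 2))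
    (hN : ∀ x, 0 ≤ x → ‖F x‖ ≤ N * Real.exp (x / 2)) :
    ‖v₁ 0 + (r - 1) * v 0‖ ≤ 2 * N := by
  have hμ0 : 0 ≤ μ := by rw [← hμ]; nlinarith
  have hN0 : 0 ≤ N := by simpa using (norm_nonneg _).trans (hN 0 le_rfl)
  have hA0 : 0 ≤ A := by simpa using (norm_nonneg _).trans (hA 0 le_rfl)
  -- a bound for the first derivative
  obtain ⟨D, hD⟩ : ∃ D, ∀ x, 0 ≤ x → ‖v₁ x‖ ≤ D * Real.exp (x / 2) := by
    refine ⟨A + ‖v₁ 0 - v 0‖ + 2 * (N + μ * A), fun x hx => ?_⟩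
    have h1 := norm_sub_le_of_deriv_le (f := fun s => v₁ s - v s) (f' := fun s => v₂ s - v₁ s)
      (g := fun s => 2 * (N + μ * A) * Real.exp (1 / 2 * s))
      (g' := fun s => 2 * (N + μ * A) * (1 / 2 * Real.exp (1 / 2 * s))) hx
      (hv₁.sub hv).continuousOn (hv₂.sub hv₁).continuousOn
      (fun s hs => (d2 s hs.1).sub (d1 s hs.1))
      (fun s => (hasDerivAt_exp_mul _ s).const_mul _) (by fun_prop)
      (fun s hs => by
        have e : v₂ s - v₁ s = F s + μ * v s := by rw [← he s hs.1.le]; ring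
        rw [e]
        refine (norm_add_le _ _).trans ?_
        rw [norm_mul, Complex.norm_real, Real.norm_of_nonneg hμ0]
        have := hN s hs.1.le
        have h2 := mul_le_mul_of_nonneg_left (hA s hs.1.le) hμ0
        rw [show 1 / 2 * s = s / 2 by ring]
        linarith)
    rw [show 1 / 2 * x = x / 2 by ring] at h1
    have h2 : ‖v₁ x‖ ≤ ‖v x‖ + ‖v₁ 0 - v 0‖ + ‖v₁ x - v x - (v₁ 0 - v 0)‖ := by
      have : v₁ x = v x + (v₁ 0 - v 0) + (v₁ x - v x - (v₁ 0 - v 0)) := by ring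
      nth_rw 1 [this]
      exact (norm_add_le _ _).trans (add_le_add_left (norm_add_le _ _) _)
    have h3 : 1 ≤ Real.exp (x / 2) := Real.one_le_exp (by linarith)
    have h4 := hA x hx
    have h5 : 0 ≤ 2 * (N + μ * A) * Real.exp (1 / 2 * 0) := by positivity
    have h6 := mul_le_mul_of_nonneg_left h3 (norm_nonneg (v₁ 0 - v 0))
    linarith
  set E : ℝ → ℂ := fun x => (Real.exp (-r * x) : ℝ) * (v₁ x + (r - 1) * v x) with hE
  have hEd : ∀ x, 0 < x → HasDerivAt E ((Real.exp (-r * x) : ℝ) * F x) x := fun x hx => by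
    refine ((hasDerivAt_cexp_mul (-r) x).mul
      ((d2 x hx).add ((d1 x hx).const_mul ((r : ℂ) - 1)))).congr_deriv ?_
    rw [← he x hx.le, ← hμ]
    simp only [Pi.add_apply]
    push_cast
    ring
  have hE0 : ∀ x, 0 ≤ x → ‖E x - E 0‖ ≤ 2 * N := fun x hx => by
    have h1 := norm_sub_le_of_deriv_le (f := E) (f' := fun x => (Real.exp (-r * x) : ℝ) * F x)
      (g := fun s => -(N / (r - 1 / 2)) * Real.exp (-(r - 1 / 2) * s))
      (g' := fun s => -(N / (r - 1 / 2)) * (-(r - 1 / 2) * Real.exp (-(r - 1 / 2) * s))) hx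
      (by fun_prop) (by
        refine ContinuousOn.mul (by fun_prop) ?_
        refine ContinuousOn.congr (f := fun x => v₂ x - v₁ x - μ * v x) (by fun_prop) ?_
        exact fun s hs => (he s hs.1).symm)
      (fun s hs => hEd s hs.1) (fun s => (hasDerivAt_exp_mul _ s).const_mul _) (by fun_prop)
      (fun s hs => by
        rw [norm_mul, Complex.norm_real, Real.norm_of_nonneg (Real.exp_nonneg _)]
        have h2 := mul_le_mul_of_nonneg_left (hN s hs.1.le) (Real.exp_nonneg (-r * s))
        have h3 : Real.exp (-r * s) * Real.exp (s / 2) = Real.exp (-(r - 1 / 2) * s) := by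
          rw [← Real.exp_add]; congr 1; ring
        have h4 : r - 1 / 2 ≠ 0 := by linarith
        calc _ ≤ _ := h2
          _ = N * Real.exp (-(r - 1 / 2) * s) := by rw [← h3]; ring
          _ = N / (r - 1 / 2) * (r - 1 / 2) * Real.exp (-(r - 1 / 2) * s) := by
            rw [div_mul_cancel₀ _ h4]
          _ = _ := by ring)
    have h2 : 0 ≤ N / (r - 1 / 2) := div_nonneg hN0 (by linarith)
    have h3 : N / (r - 1 / 2) ≤ 2 * N := by
      rw [div_le_iff₀ (by linarith)]; nlinarith
    have h4 := mul_nonneg h2 (Real.exp_nonneg (-(r - 1 / 2) * x))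
    simp only [mul_zero, Real.exp_zero] at h1
    linarith
  have hlim : Tendsto E atTop (𝓝 0) := by
    have hb : ∀ x, 0 ≤ x → ‖E x‖ ≤ (D + (r - 1) * A) * Real.exp (-(1 / 2) * x) := fun x hx => by
      rw [hE]
      simp only
      rw [norm_mul, Complex.norm_real, Real.norm_of_nonneg (Real.exp_nonneg _)]
      have h1 : ‖v₁ x + (r - 1) * v x‖ ≤ (D + (r - 1) * A) * Real.exp (x / 2) := by
        refine (norm_add_le _ _).trans ?_
        rw [norm_mul, show (r : ℂ) - 1 = ((r - 1 : ℝ) : ℂ) by push_cast; rfl, Complex.norm_real,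
          Real.norm_of_nonneg (by linarith)]
        have := mul_le_mul_of_nonneg_left (hA x hx) (sub_nonneg.2 hr)
        linarith [hD x hx]
      have h0 : 0 ≤ D + (r - 1) * A := by
        have := (norm_nonneg _).trans (hD 0 le_rfl)
        simp only [zero_div, Real.exp_zero, mul_one] at this
        nlinarith
      calc _ ≤ Real.exp (-r * x) * ((D + (r - 1) * A) * Real.exp (x / 2)) := by gcongr
        _ = (D + (r - 1) * A) * Real.exp (-r * x + x / 2) := by rw [Real.exp_add]; ring
        _ ≤ _ := by
          gcongr
          nlinarith
    refine squeeze_zero_norm' (eventually_atTop.2 ⟨0, hb⟩) ?_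
    have : Tendsto (fun x : ℝ => Real.exp (-(1 / 2) * x)) atTop (𝓝 0) :=
      Real.tendsto_exp_atBot.comp (tendsto_id.const_mul_atTop_of_neg (by norm_num))
    simpa using this.const_mul (D + (r - 1) * A)
  have h1 : ‖(0 : ℂ) - E 0‖ ≤ 2 * N :=
    le_of_tendsto (hlim.sub_const (E 0)).norm (eventually_atTop.2 ⟨0, hE0⟩)
  rw [zero_sub, norm_neg] at h1
  simpa [hE] using h1

/-- Here the other order of the factors is used: w = v' - rv satisfies (e^{(r-1)x} w + v(0)
e^{rx}/r)' = e^{(r-1)x} F, the extra term absorbing the nonlocal v(0)e^x. The derivative is only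
shown to be bounded, so the vanishing at -∞ rests on r > 1, that is, on a nonzero mode. -/
lemma ode_neg_bound {v v₁ v₂ F : ℝ → ℂ} {μ r A N : ℝ} (hr : 1 < r) (hμ : r * (r - 1) = μ)
    (hv : Continuous v) (hv₁ : Continuous v₁) (hv₂ : Continuous v₂)
    (d1 : ∀ x < 0, HasDerivAt v (v₁ x) x) (d2 : ∀ x < 0, HasDerivAt v₁ (v₂ x) x)
    (he : ∀ x ≤ 0, v₂ x - v₁ x - μ * v x + v 0 * (Real.exp x : ℝ) = F x)
    (hA : ∀ x ≤ 0, ‖v x‖ ≤ A * Real.exp (x / 2))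
    (hN : ∀ x ≤ 0, ‖F x‖ ≤ N * Real.exp (x / 2)) :
    ‖v₁ 0 - r * v 0 + v 0 / r‖ ≤ 2 * N := by
  have hμ0 : 0 ≤ μ := by rw [← hμ]; nlinarith
  have hN0 : 0 ≤ N := by simpa using (norm_nonneg _).trans (hN 0 le_rfl)
  have hA0 : 0 ≤ A := by simpa using (norm_nonneg _).trans (hA 0 le_rfl)
  have hrC : (r : ℂ) ≠ 0 := by exact_mod_cast (show r ≠ 0 by linarith)
  -- The equation bounds (v' - v)' by a multiple of e^{x/2}, which is integrable on the half-line.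
  obtain ⟨D, hD⟩ : ∃ D, ∀ x ≤ 0, ‖v₁ x‖ ≤ D := by
    refine ⟨A + ‖v₁ 0 - v 0‖ + 2 * (N + μ * A + ‖v 0‖), fun x hx => ?_⟩
    have h1 := norm_sub_le_of_deriv_le (f := fun s => v₁ s - v s) (f' := fun s => v₂ s - v₁ s)
      (g := fun s => 2 * (N + μ * A + ‖v 0‖) * Real.exp (1 / 2 * s))
      (g' := fun s => 2 * (N + μ * A + ‖v 0‖) * (1 / 2 * Real.exp (1 / 2 * s))) hx
      (hv₁.sub hv).continuousOn (hv₂.sub hv₁).continuousOn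
      (fun s hs => (d2 s hs.2).sub (d1 s hs.2))
      (fun s => (hasDerivAt_exp_mul _ s).const_mul _) (by fun_prop)
      (fun s hs => by
        have e : v₂ s - v₁ s = F s + μ * v s - v 0 * (Real.exp s : ℝ) := by
          rw [← he s hs.2.le]; ring
        rw [e]
        refine (norm_sub_le _ _).trans (le_trans (add_le_add_left (norm_add_le _ _) _) ?_)
        rw [norm_mul, norm_mul, Complex.norm_real, Real.norm_of_nonneg hμ0, Complex.norm_real,
          Real.norm_of_nonneg (Real.exp_nonneg _)]
        have := hN s hs.2.le
        have h2 := mul_le_mul_of_nonneg_left (hA s hs.2.le) hμ0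
        have h3 : Real.exp s ≤ Real.exp (s / 2) := Real.exp_le_exp.2 (by linarith [hs.2])
        have h4 := mul_le_mul_of_nonneg_left h3 (norm_nonneg (v 0))
        rw [show 1 / 2 * s = s / 2 by ring]
        linarith)
    simp only [mul_zero, Real.exp_zero] at h1
    have h2 : ‖v₁ x‖ ≤ ‖v x‖ + ‖v₁ 0 - v 0‖ + ‖v₁ 0 - v 0 - (v₁ x - v x)‖ := by
      have : v₁ x = v x + (v₁ 0 - v 0) - (v₁ 0 - v 0 - (v₁ x - v x)) := by ring
      nth_rw 1 [this]
      exact (norm_sub_le _ _).trans (add_le_add_left (norm_add_le _ _) _)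
    have h3 : Real.exp (x / 2) ≤ 1 := Real.exp_le_one_iff.2 (by linarith)
    have h4 := (hA x hx).trans (mul_le_of_le_one_right hA0 h3)
    have h5 : 0 ≤ 2 * (N + μ * A + ‖v 0‖) * Real.exp (1 / 2 * x) := by positivity
    linarith
  set E : ℝ → ℂ := fun x => (Real.exp ((r - 1) * x) : ℝ) * (v₁ x - r * v x) +
    v 0 / r * (Real.exp (r * x) : ℝ) with hE
  have hexp : ∀ x : ℝ, Real.exp (r * x) = Real.exp ((r - 1) * x) * Real.exp x := fun x => by
    rw [← Real.exp_add]; congr 1; ring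
  have hEd : ∀ x < 0, HasDerivAt E ((Real.exp ((r - 1) * x) : ℝ) * F x) x := fun x hx => by
    refine (((hasDerivAt_cexp_mul (r - 1) x).mul
      ((d2 x hx).sub ((d1 x hx).const_mul (r : ℂ)))).add
      ((hasDerivAt_cexp_mul r x).const_mul (v 0 / r))).congr_deriv ?_
    rw [← he x hx.le, ← hμ, hexp]
    simp only [Pi.sub_apply]
    push_cast
    field_simp
    ring
  have hE0 : ∀ x ≤ 0, ‖E 0 - E x‖ ≤ 2 * N := fun x hx => by
    have h1 := norm_sub_le_of_deriv_le (f := E)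
      (f' := fun x => (Real.exp ((r - 1) * x) : ℝ) * F x)
      (g := fun s => N / (r - 1 / 2) * Real.exp ((r - 1 / 2) * s))
      (g' := fun s => N / (r - 1 / 2) * ((r - 1 / 2) * Real.exp ((r - 1 / 2) * s))) hx
      (by fun_prop) (by
        refine ContinuousOn.mul (by fun_prop) ?_
        refine ContinuousOn.congr
          (f := fun x => v₂ x - v₁ x - μ * v x + v 0 * (Real.exp x : ℝ)) (by fun_prop) ?_
        exact fun s hs => (he s hs.2).symm)
      (fun s hs => hEd s hs.2) (fun s => (hasDerivAt_exp_mul _ s).const_mul _) (by fun_prop)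
      (fun s hs => by
        rw [norm_mul, Complex.norm_real, Real.norm_of_nonneg (Real.exp_nonneg _)]
        have h2 := mul_le_mul_of_nonneg_left (hN s hs.2.le) (Real.exp_nonneg ((r - 1) * s))
        have h3 : Real.exp ((r - 1) * s) * Real.exp (s / 2) = Real.exp ((r - 1 / 2) * s) := by
          rw [← Real.exp_add]; congr 1; ring
        have h4 : r - 1 / 2 ≠ 0 := by linarith
        calc _ ≤ _ := h2
          _ = N * Real.exp ((r - 1 / 2) * s) := by rw [← h3]; ring
          _ = N / (r - 1 / 2) * (r - 1 / 2) * Real.exp ((r - 1 / 2) * s) := by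
            rw [div_mul_cancel₀ _ h4]
          _ = _ := by ring)
    have h2 : 0 ≤ N / (r - 1 / 2) := div_nonneg hN0 (by linarith)
    have h3 : N / (r - 1 / 2) ≤ 2 * N := by
      rw [div_le_iff₀ (by linarith)]; nlinarith
    have h4 := mul_nonneg h2 (Real.exp_nonneg ((r - 1 / 2) * x))
    simp only [mul_zero, Real.exp_zero] at h1
    linarith
  have hlim : Tendsto E atBot (𝓝 0) := by
    have hb : ∀ x ≤ 0, ‖E x‖ ≤
        (D + r * A) * Real.exp ((r - 1) * x) + ‖v 0 / r‖ * Real.exp (r * x) := fun x hx => by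
      rw [hE]
      simp only
      refine (norm_add_le _ _).trans ?_
      rw [norm_mul, norm_mul (v 0 / r), Complex.norm_real, Real.norm_of_nonneg (Real.exp_nonneg _),
        Complex.norm_real, Real.norm_of_nonneg (Real.exp_nonneg _)]
      have h1 : ‖v₁ x - r * v x‖ ≤ D + r * A := by
        refine (norm_sub_le _ _).trans ?_
        rw [norm_mul, Complex.norm_real, Real.norm_of_nonneg (by linarith)]
        have h3 : Real.exp (x / 2) ≤ 1 := Real.exp_le_one_iff.2 (by linarith)
        have h4 := (hA x hx).trans (mul_le_of_le_one_right hA0 h3)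
        have := mul_le_mul_of_nonneg_left h4 (show 0 ≤ r by linarith)
        linarith [hD x hx]
      rw [mul_comm]
      gcongr
    refine squeeze_zero_norm' (eventually_atBot.2 ⟨0, hb⟩) ?_
    have t : ∀ k : ℝ, 0 < k → Tendsto (fun x : ℝ => Real.exp (k * x)) atBot (𝓝 0) := fun k hk =>
      Real.tendsto_exp_atBot.comp (tendsto_id.const_mul_atBot hk)
    simpa using ((t (r - 1) (by linarith)).const_mul (D + r * A)).add
      ((t r (by linarith)).const_mul ‖v 0 / r‖)
  have h1 : ‖E 0 - (0 : ℂ)‖ ≤ 2 * N :=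
    le_of_tendsto (hlim.const_sub (E 0)).norm (eventually_atBot.2 ⟨0, hE0⟩)
  simpa [hE] using h1

/-- The half-lines share the trace a and the derivative b. Subtracting eliminates b and leaves the
coefficient (r - 1) + r - 1/r = (2r + 1)(r - 1)/r of a, which degenerates only at r = 1, the root of
the zero mode. -/
lemma ode_matching_bound {a b : ℂ} {r N : ℝ} (hr : 1 < r) (h1 : ‖b + (r - 1) * a‖ ≤ 2 * N)
    (h2 : ‖b - r * a + a / r‖ ≤ 2 * N) : ‖a‖ ≤ 4 * r / ((2 * r + 1) * (r - 1)) * N := by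
  have hrC : (r : ℂ) ≠ 0 := by exact_mod_cast (show r ≠ 0 by linarith)
  have e : (((2 * r + 1) * (r - 1) / r : ℝ) : ℂ) * a =
      (b + (r - 1) * a) - (b - r * a + a / r) := by
    push_cast; field_simp; ring
  have h3 : (2 * r + 1) * (r - 1) / r * ‖a‖ ≤ 4 * N := by
    have h4 := congrArg norm e
    have hp : 0 < (2 * r + 1) * (r - 1) / r :=
      div_pos (mul_pos (by linarith) (by linarith)) (by linarith)
    rw [norm_mul, Complex.norm_real, Real.norm_of_nonneg hp.le] at h4
    rw [h4]
    exact (norm_sub_le _ _).trans (by linarith)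
  have hp : 0 < (2 * r + 1) * (r - 1) := mul_pos (by linarith) (by linarith)
  rw [div_mul_eq_mul_div, le_div_iff₀ hp]
  rw [div_mul_eq_mul_div, div_le_iff₀ (by linarith)] at h3
  linarith

/-! ### Linearity of the graphs -/

section Linear

variable {ℓ : ℝ}

lemma HasDx.add {u v u' v' : Pair ℓ} (h : HasDx u v) (h' : HasDx u' v') : HasDx (u + u') (v + v') :=
  ⟨fun η => (h.1 η).add (h'.1 η), fun η => (h.2 η).add (h'.2 η)⟩

lemma HasDx.smul {u v : Pair ℓ} (c : ℝ) (h : HasDx u v) : HasDx (c • u) (c • v) :=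
  ⟨fun η => (h.1 η).smul c, fun η => (h.2 η).smul c⟩

lemma HasDeta.add {u v u' v' : Pair ℓ} (h : HasDeta u v) (h' : HasDeta u' v') :
    HasDeta (u + u') (v + v') :=
  ⟨fun η => (h.1 η).add (h'.1 η), fun η => (h.2 η).add (h'.2 η)⟩

lemma HasDeta.smul {u v : Pair ℓ} (c : ℝ) (h : HasDeta u v) : HasDeta (c • u) (c • v) :=
  ⟨fun η => (h.1 η).smul c, fun η => (h.2 η).smul c⟩

lemma EndsAgree.add {f g : Cell ℓ → ℝ} (hf : EndsAgree f) (hg : EndsAgree g) :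
    EndsAgree (f + g) := fun a b ha hb => by
  simp only [Pi.add_apply, hf a b ha hb, hg a b ha hb]

lemma EndsAgree.smul {f : Cell ℓ → ℝ} (c : ℝ) (hf : EndsAgree f) : EndsAgree (c • f) :=
  fun a b ha hb => by simp only [Pi.smul_apply, hf a b ha hb]

lemma PeriodicEta.add {u v : Pair ℓ} (hu : PeriodicEta u) (hv : PeriodicEta v) :
    PeriodicEta (u + v) := ⟨fun x => (hu.1 x).add (hv.1 x), fun x => (hu.2 x).add (hv.2 x)⟩

lemma PeriodicEta.smul {u : Pair ℓ} (c : ℝ) (hu : PeriodicEta u) : PeriodicEta (c • u) :=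
  ⟨fun x => (hu.1 x).smul c, fun x => (hu.2 x).smul c⟩

lemma MatchAtZero.add {u v : Pair ℓ} (hu : MatchAtZero u) (hv : MatchAtZero v) :
    MatchAtZero (u + v) := fun η => congrArg₂ (· + ·) (hu η) (hv η)

lemma MatchAtZero.smul {u : Pair ℓ} (c : ℝ) (hu : MatchAtZero u) : MatchAtZero (c • u) :=
  fun η => congrArg (c * ·) (hu η)

lemma GraphLA.add {ε : ℝ} {u f u' f' : XSpace ℓ} (h : GraphLA ε u f) (h' : GraphLA ε u' f') :
    GraphLA ε (u + u') (f + f') := by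
  obtain ⟨ux, uxx, uη, uηη, a1, a2, a3, a4, a5, a6, a7, a8, a9, a10, a11⟩ := h
  obtain ⟨vx, vxx, vη, vηη, b1, b2, b3, b4, b5, b6, b7, b8, b9, b10, b11⟩ := h'
  refine ⟨ux + vx, uxx + vxx, uη + vη, uηη + vηη, a1.add b1, a2.add b2, a3.add b3, a4.add b4,
    add_mem a5 b5, a6.add b6, a7.add b7, a8.add b8, a9.add b9, fun p => ?_, fun p => ?_⟩
  · change f.1.1 p + f'.1.1 p = (uxx.1 p + vxx.1 p) + ε * (uηη.1 p + vηη.1 p) - (ux.1 p + vx.1 p) +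
      (u.1.1 (zeroNeg, p.2) + u'.1.1 (zeroNeg, p.2)) * Real.exp p.1
    rw [a10, b10]; ring
  · change f.1.2 p + f'.1.2 p = (uxx.2 p + vxx.2 p) + ε * (uηη.2 p + vηη.2 p) - (ux.2 p + vx.2 p)
    rw [a11, b11]; ring

lemma GraphLA.smul {ε : ℝ} {u f : XSpace ℓ} (c : ℝ) (h : GraphLA ε u f) :
    GraphLA ε (c • u) (c • f) := by
  obtain ⟨ux, uxx, uη, uηη, a1, a2, a3, a4, a5, a6, a7, a8, a9, a10, a11⟩ := h
  refine ⟨c • ux, c • uxx, c • uη, c • uηη, a1.smul c, a2.smul c, a3.smul c, a4.smul c,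
    (XSpace ℓ).smul_mem c a5, a6.smul c, a7.smul c, a8.smul c, a9.smul c, fun p => ?_, fun p => ?_⟩
  · change c * f.1.1 p = c * uxx.1 p + ε * (c * uηη.1 p) - c * ux.1 p +
      c * u.1.1 (zeroNeg, p.2) * Real.exp p.1
    rw [a10]; ring
  · change c * f.1.2 p = c * uxx.2 p + ε * (c * uηη.2 p) - c * ux.2 p
    rw [a11]; ring

lemma GraphLA.sub {ε : ℝ} {u f u' f' : XSpace ℓ} (h : GraphLA ε u f) (h' : GraphLA ε u' f') :
    GraphLA ε (u - u') (f - f') := by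
  have := h.add (h'.smul (-1))
  have e : ∀ v w : XSpace ℓ, v - w = v + (-1 : ℝ) • w := fun v w => by module
  rwa [e, e]

/-! ### The norm of `𝓧` -/

lemma xNorm_fst_le (f : XSpace ℓ) (p : StripNeg ℓ) :
    |Real.exp (-(p.1 : ℝ) / 2) * f.1.1 p| ≤ xNorm f := by
  obtain ⟨⟨A, hA⟩, -⟩ := f.2
  have h1 := le_ciSup (f := fun p : StripNeg ℓ => |Real.exp (-(p.1 : ℝ) / 2) * f.1.1 p|)
    ⟨A, by rintro _ ⟨q, rfl⟩; exact hA q⟩ p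
  have h2 : 0 ≤ ⨆ p : StripPos ℓ, |Real.exp (-(p.1 : ℝ) / 2) * f.1.2 p| :=
    Real.iSup_nonneg fun _ => abs_nonneg _
  exact h1.trans (le_add_of_nonneg_right h2)

lemma xNorm_snd_le (f : XSpace ℓ) (p : StripPos ℓ) :
    |Real.exp (-(p.1 : ℝ) / 2) * f.1.2 p| ≤ xNorm f := by
  obtain ⟨-, ⟨A, hA⟩⟩ := f.2
  have h1 := le_ciSup (f := fun p : StripPos ℓ => |Real.exp (-(p.1 : ℝ) / 2) * f.1.2 p|)
    ⟨A, by rintro _ ⟨q, rfl⟩; exact hA q⟩ p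
  have h2 : 0 ≤ ⨆ p : StripNeg ℓ, |Real.exp (-(p.1 : ℝ) / 2) * f.1.1 p| :=
    Real.iSup_nonneg fun _ => abs_nonneg _
  exact h1.trans (le_add_of_nonneg_left h2)

lemma abs_weight_le_iff {x y B : ℝ} :
    |Real.exp (-x / 2) * y| ≤ B ↔ |y| ≤ B * Real.exp (x / 2) := by
  have h : Real.exp (-x / 2) = (Real.exp (x / 2))⁻¹ := by rw [← Real.exp_neg]; congr 1; ring
  rw [abs_mul, abs_of_pos (Real.exp_pos _), h, inv_mul_le_iff₀ (Real.exp_pos _), mul_comm]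

lemma abs_fst_le (f : XSpace ℓ) (p : StripNeg ℓ) : |f.1.1 p| ≤ xNorm f * Real.exp ((p.1 : ℝ) / 2) :=
  abs_weight_le_iff.1 (xNorm_fst_le f p)

lemma abs_snd_le (f : XSpace ℓ) (p : StripPos ℓ) : |f.1.2 p| ≤ xNorm f * Real.exp ((p.1 : ℝ) / 2) :=
  abs_weight_le_iff.1 (xNorm_snd_le f p)

lemma xNorm_nonneg (f : XSpace ℓ) : 0 ≤ xNorm f :=
  add_nonneg (Real.iSup_nonneg fun _ => abs_nonneg _) (Real.iSup_nonneg fun _ => abs_nonneg _)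

lemma xNorm_le {f : XSpace ℓ} {A B : ℝ} (hA0 : 0 ≤ A) (hB0 : 0 ≤ B)
    (hA : ∀ p, |f.1.1 p| ≤ A * Real.exp ((p.1 : ℝ) / 2))
    (hB : ∀ p, |f.1.2 p| ≤ B * Real.exp ((p.1 : ℝ) / 2)) : xNorm f ≤ A + B :=
  add_le_add (Real.iSup_le (fun p => abs_weight_le_iff.2 (hA p)) hA0)
    (Real.iSup_le (fun p => abs_weight_le_iff.2 (hB p)) hB0)

/-- The factor 2 comes from bounding each component by the full norm; it is harmless, the estimate
serving only for limits. -/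
lemma xNorm_sub_sub_le (f g h : XSpace ℓ) : xNorm (f - g) ≤ 2 * (xNorm (f - h) + xNorm (g - h)) := by
  have h0 := add_nonneg (xNorm_nonneg (f - h)) (xNorm_nonneg (g - h))
  have := xNorm_le (f := f - g) h0 h0 (fun p => ?_) (fun p => ?_)
  · linarith
  · have a := abs_fst_le (f - h) p
    have b := abs_fst_le (g - h) p
    change |f.1.1 p - h.1.1 p| ≤ _ at a
    change |g.1.1 p - h.1.1 p| ≤ _ at b
    rw [abs_sub_comm] at b
    have := abs_sub_le (f.1.1 p) (h.1.1 p) (g.1.1 p)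
    change |f.1.1 p - g.1.1 p| ≤ _
    linarith
  · have a := abs_snd_le (f - h) p
    have b := abs_snd_le (g - h) p
    change |f.1.2 p - h.1.2 p| ≤ _ at a
    change |g.1.2 p - h.1.2 p| ≤ _ at b
    rw [abs_sub_comm] at b
    have := abs_sub_le (f.1.2 p) (h.1.2 p) (g.1.2 p)
    change |f.1.2 p - g.1.2 p| ≤ _
    linarith

end Linear

/-! ### Fourier modes in `η` of functions on a strip -/

section Modes

variable {ℓ : ℝ} [hℓ : Fact (0 < ℓ)]

/-- The projection of the line onto the cell. -/
def toCell (η : ℝ) : Cell ℓ := Set.projIcc (-ℓ / 2) (ℓ / 2) half_le η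

@[fun_prop]
lemma continuous_toCell : Continuous (toCell (ℓ := ℓ)) := continuous_projIcc (h := half_le)

lemma toCell_of_mem {η : ℝ} (h : η ∈ Cell ℓ) : toCell η = ⟨η, h⟩ := Set.projIcc_of_mem _ h

lemma continuous_fourier_coe (n : ℤ) :
    Continuous fun t : ℝ => (fourier n (t : AddCircle ℓ) : ℂ) :=
  (fourier n : C(AddCircle ℓ, ℂ)).continuous.comp (AddCircle.continuous_mk' ℓ)

lemma norm_fourier_apply (n : ℤ) (t : AddCircle ℓ) : ‖(fourier n t : ℂ)‖ = 1 := by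
  rw [fourier_apply]; exact Circle.norm_coe _

/-- The (unnormalized) `n`-th Fourier coefficient of a function on the cell. -/
def cellMode (n : ℤ) : C(Cell ℓ, ℝ) →ₗ[ℝ] ℂ where
  toFun g := ∫ η in (-ℓ / 2)..(ℓ / 2), fourier (-n) (η : AddCircle ℓ) * (g (toCell η) : ℂ)
  map_add' g h := by
    have c := continuous_fourier_coe (ℓ := ℓ) (-n)
    have hg : Continuous fun η => g (toCell η) := g.continuous.comp continuous_toCell
    have hh : Continuous fun η => h (toCell η) := h.continuous.comp continuous_toCell
    rw [← intervalIntegral.integral_add ((by fun_prop : Continuous _).intervalIntegrable _ _)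
      ((by fun_prop : Continuous _).intervalIntegrable _ _)]
    congr 1; ext η
    simp only [ContinuousMap.add_apply, Complex.ofReal_add]; ring
  map_smul' c g := by
    rw [RingHom.id_apply, Complex.real_smul, ← intervalIntegral.integral_const_mul]
    congr 1; ext η
    simp only [ContinuousMap.smul_apply, smul_eq_mul, Complex.ofReal_mul]; ring

lemma cellMode_apply (n : ℤ) (g : C(Cell ℓ, ℝ)) : cellMode n g =
    ∫ η in (-ℓ / 2)..(ℓ / 2), fourier (-n) (η : AddCircle ℓ) * (g (toCell η) : ℂ) := rfl

lemma norm_cellMode_le (n : ℤ) {g : C(Cell ℓ, ℝ)} {B : ℝ} (h : ∀ η, |g η| ≤ B) :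
    ‖cellMode n g‖ ≤ ℓ * B := by
  have h1 := intervalIntegral.norm_integral_le_of_norm_le_const (a := -ℓ / 2) (b := ℓ / 2)
    (f := fun η : ℝ => fourier (-n) (η : AddCircle ℓ) * (g (toCell η) : ℂ)) (C := B)
    (fun η _ => by
      rw [norm_mul, norm_fourier_apply, one_mul, Complex.norm_real]; exact h _)
  rw [show ℓ / 2 - -ℓ / 2 = ℓ by ring, abs_of_pos hℓ.out] at h1
  rw [cellMode_apply]; linarith

lemma cellMode_restr (n : ℤ) {g : C(Cell ℓ, ℝ)} {F : C(AddCircle ℓ, ℝ)} (h : restr F = g) :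
    coef F n = (1 / ℓ : ℝ) • cellMode n g := by
  rw [coef_eq_intervalIntegral, cellMode_apply]
  congr 1
  refine intervalIntegral.integral_congr fun η hη => ?_
  rw [Set.uIcc_of_le half_le] at hη
  simp only [toCell_of_mem hη, ← h, restr_apply]

lemma cellMode_deriv (n : ℤ) {g g' : C(Cell ℓ, ℝ)} (h : HasDerivOn g g') (he : EndsAgree g) :
    cellMode n g' = freq ℓ n * cellMode n g := by
  have hg : Continuous fun η => g (toCell η) := g.continuous.comp continuous_toCell
  have hg' : Continuous fun η => g' (toCell η) := g'.continuous.comp continuous_toCell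
  rw [cellMode_apply, cellMode_apply]
  refine integral_fourier_mul_deriv (f := fun η => (g (toCell η) : ℂ))
    (f' := fun η => (g' (toCell η) : ℂ)) (by fun_prop) (by fun_prop) (fun t ht => ?_) ?_ n
  · refine HasDerivAt.ofReal_comp ?_
    have := h.hasDerivAt (F := fun η => g (toCell η))
      (fun x => by simp only [toCell_of_mem x.2])
      ⟨t, Set.Ioo_subset_Icc_self ht⟩ (Icc_mem_nhds ht.1 ht.2)
    rwa [toCell_of_mem (Set.Ioo_subset_Icc_self ht)]
  · have h1 := he (toCell (-ℓ / 2)) (toCell (ℓ / 2))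
      (by rw [toCell_of_mem (Set.left_mem_Icc.2 half_le)])
      (by rw [toCell_of_mem (Set.right_mem_Icc.2 half_le)])
    simp only [h1]

variable {S : Set ℝ}

/-- The function `w(x, ·)`. -/
def slice (w : C(S × Cell ℓ, ℝ)) (x : S) : C(Cell ℓ, ℝ) := ⟨fun η => w (x, η), by fun_prop⟩

@[simp] lemma slice_apply (w : C(S × Cell ℓ, ℝ)) (x : S) (η : Cell ℓ) : slice w x η = w (x, η) := rfl

lemma continuous_cellMode_slice (n : ℤ) (w : C(S × Cell ℓ, ℝ)) {π : ℝ → S} (hπ : Continuous π) :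
    Continuous fun x => cellMode n (slice w (π x)) := by
  simp only [cellMode_apply, slice_apply]
  refine intervalIntegral.continuous_parametric_intervalIntegral_of_continuous' ?_ _ _
  have c := continuous_fourier_coe (ℓ := ℓ) (-n)
  have hg : Continuous fun p : ℝ × ℝ => w (π p.1, toCell p.2) :=
    w.continuous.comp ((hπ.comp continuous_fst).prodMk (continuous_toCell.comp continuous_snd))
  exact (c.comp continuous_snd).mul (Complex.continuous_ofReal.comp hg)

/-- Differentiation under the integral sign. The domination is by compactness: w' is bounded on the
product of a closed ball around x inside S and the cell. -/
lemma hasDerivAt_cellMode_slice (n : ℤ) {w w' : C(S × Cell ℓ, ℝ)}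
    (h : ∀ η, HasDerivOn (fun x => w (x, η)) fun x => w' (x, η)) {π : ℝ → S} (hπ : Continuous π)
    (hπS : ∀ x : S, π x = x) {x : ℝ} (hx : S ∈ 𝓝 x) :
    HasDerivAt (fun x => cellMode n (slice w (π x))) (cellMode n (slice w' (π x))) x := by
  simp only [cellMode_apply, slice_apply]
  have c := continuous_fourier_coe (ℓ := ℓ) (-n)
  have cont : ∀ v : C(S × Cell ℓ, ℝ), Continuous fun p : ℝ × ℝ =>
      fourier (-n) (p.2 : AddCircle ℓ) * (v (π p.1, toCell p.2) : ℂ) := fun v => by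
    have hg : Continuous fun p : ℝ × ℝ => v (π p.1, toCell p.2) :=
      v.continuous.comp ((hπ.comp continuous_fst).prodMk (continuous_toCell.comp continuous_snd))
    exact (c.comp continuous_snd).mul (Complex.continuous_ofReal.comp hg)
  have cont' : ∀ (v : C(S × Cell ℓ, ℝ)) (x : ℝ), Continuous fun η : ℝ =>
      fourier (-n) (η : AddCircle ℓ) * (v (π x, toCell η) : ℂ) := fun v x =>
    (cont v).comp (Continuous.prodMk_right x)
  obtain ⟨δ, hδ, hδS⟩ := Metric.nhds_basis_closedBall.mem_iff.1 (interior_mem_nhds.2 hx)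
  have hsub : Metric.closedBall x δ ⊆ S := hδS.trans interior_subset
  obtain ⟨B, hB⟩ := ((isCompact_closedBall x δ).prod (isCompact_Icc (a := -ℓ / 2)
    (b := ℓ / 2))).exists_bound_of_continuousOn (cont w').continuousOn
  refine (intervalIntegral.hasDerivAt_integral_of_dominated_loc_of_deriv_le
    (F := fun x η => fourier (-n) (η : AddCircle ℓ) * (w (π x, toCell η) : ℂ))
    (F' := fun x η => fourier (-n) (η : AddCircle ℓ) * (w' (π x, toCell η) : ℂ))
    (bound := fun _ => B) (Metric.closedBall_mem_nhds x hδ)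
    (Eventually.of_forall fun y => (cont' w y).aestronglyMeasurable)
    ((cont' w x).intervalIntegrable _ _) (cont' w' x).aestronglyMeasurable
    (Eventually.of_forall fun η hη y hy => ?_) intervalIntegrable_const
    (Eventually.of_forall fun η _ y hy => ?_)).2
  · rw [Set.uIoc_of_le half_le] at hη
    exact hB (y, η) ⟨hy, Set.Ioc_subset_Icc_self hη⟩
  · have hyS : S ∈ 𝓝 y := mem_interior_iff_mem_nhds.1 (hδS hy)
    have h1 := (h (toCell η)).hasDerivAt (F := fun s => w (π s, toCell η))
      (fun s => by simp only [hπS]) ⟨y, hsub hy⟩ hyS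
    have e : π y = ⟨y, hsub hy⟩ := hπS ⟨y, hsub hy⟩
    rw [e]
    exact h1.ofReal_comp.const_mul _

/-! ### An a priori estimate and uniqueness -/

lemma continuous_projNeg : Continuous (Set.projIic (0 : ℝ)) :=
  (continuous_const.min continuous_id).subtype_mk _

lemma continuous_projPos : Continuous (Set.projIci (0 : ℝ)) :=
  (continuous_const.max continuous_id).subtype_mk _

/-- Taking the n-th mode in η turns D_ηη into `freq ℓ n ^ 2`, by periodicity, and leaves the two
ODEs above. The bound contains no norm of u, which is why it survives passage to the closure. -/
lemma norm_cellMode_zero_le {ε : ℝ} (hε : 0 < ε) {n : ℤ} (hn : n ≠ 0) {u f : XSpace ℓ}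
    (h : GraphLA ε u f) : ‖cellMode n (slice u.1.1 zeroNeg)‖ ≤
      4 * modeRoot ℓ ε n / ((2 * modeRoot ℓ ε n + 1) * (modeRoot ℓ ε n - 1)) *
        (ℓ * xNorm f) := by
  obtain ⟨ux, uxx, uη, uηη, hux, huxx, huη, huηη, -, hm, hmx, hp, hpη, hneg, hpos⟩ := h
  have hr : 1 < modeRoot ℓ ε n := one_lt_charRoot (modeEig_pos hε hn)
  have hμ := modeRoot_mul (ℓ := ℓ) hε n
  have hμC := modeEig_coe (ℓ := ℓ) (ε := ε) n
  refine ode_matching_bound hr (b := cellMode n (slice ux.1 zeroNeg)) ?_ ?_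
  · have e0 : Set.projIci (0 : ℝ) 0 = zeroPos := Set.projIci_of_mem Set.self_mem_Ici
    have key := ode_pos_bound (v := fun x => cellMode n (slice u.1.2 (Set.projIci 0 x)))
      (v₁ := fun x => cellMode n (slice ux.2 (Set.projIci 0 x)))
      (v₂ := fun x => cellMode n (slice uxx.2 (Set.projIci 0 x)))
      (F := fun x => cellMode n (slice f.1.2 (Set.projIci 0 x))) (A := ℓ * xNorm u)
      (N := ℓ * xNorm f) hr.le hμ
      (continuous_cellMode_slice n _ continuous_projPos)
      (continuous_cellMode_slice n _ continuous_projPos)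
      (continuous_cellMode_slice n _ continuous_projPos)
      (fun x hx => hasDerivAt_cellMode_slice n hux.2 continuous_projPos
        (fun y => Set.projIci_of_mem y.2) (Ici_mem_nhds hx))
      (fun x hx => hasDerivAt_cellMode_slice n huxx.2 continuous_projPos
        (fun y => Set.projIci_of_mem y.2) (Ici_mem_nhds hx))
      (fun x hx => ?_) (fun x hx => ?_) (fun x hx => ?_)
    · simp only [e0] at key
      have e1 : slice u.1.2 zeroPos = slice u.1.1 zeroNeg := by ext η; exact (hm η).symm
      have e2 : slice ux.2 zeroPos = slice ux.1 zeroNeg := by ext η; exact (hmx η).symm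
      rwa [e1, e2] at key
    · set y := Set.projIci (0 : ℝ) x
      have e : slice f.1.2 y = slice uxx.2 y + ε • slice uηη.2 y - slice ux.2 y := by
        ext η; exact hpos (y, η)
      have e2 : cellMode n (slice uηη.2 y) = freq ℓ n ^ 2 * cellMode n (slice u.1.2 y) := by
        rw [cellMode_deriv n (g := slice uη.2 y) (g' := slice uηη.2 y) (huηη.2 y) (hpη.2 y),
          cellMode_deriv n (g := slice u.1.2 y) (g' := slice uη.2 y)
            (huη.2 y) (hp.2 y)]
        ring
      rw [e, map_sub, map_add, map_smul, e2, hμC, Complex.real_smul]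
      ring
    · rw [Set.projIci_of_mem hx, mul_assoc]
      exact norm_cellMode_le n fun η => abs_snd_le u _
    · rw [Set.projIci_of_mem hx, mul_assoc]
      exact norm_cellMode_le n fun η => abs_snd_le f _
  · have e0 : Set.projIic (0 : ℝ) 0 = zeroNeg := Set.projIic_of_mem Set.self_mem_Iic
    have key := ode_neg_bound (v := fun x => cellMode n (slice u.1.1 (Set.projIic 0 x)))
      (v₁ := fun x => cellMode n (slice ux.1 (Set.projIic 0 x)))
      (v₂ := fun x => cellMode n (slice uxx.1 (Set.projIic 0 x)))
      (F := fun x => cellMode n (slice f.1.1 (Set.projIic 0 x))) (A := ℓ * xNorm u)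
      (N := ℓ * xNorm f) hr hμ
      (continuous_cellMode_slice n _ continuous_projNeg)
      (continuous_cellMode_slice n _ continuous_projNeg)
      (continuous_cellMode_slice n _ continuous_projNeg)
      (fun x hx => hasDerivAt_cellMode_slice n hux.1 continuous_projNeg
        (fun y => Set.projIic_of_mem y.2) (Iic_mem_nhds hx))
      (fun x hx => hasDerivAt_cellMode_slice n huxx.1 continuous_projNeg
        (fun y => Set.projIic_of_mem y.2) (Iic_mem_nhds hx))
      (fun x hx => ?_) (fun x hx => ?_) (fun x hx => ?_)
    · simpa only [e0] using key
    · rw [e0]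
      have hy : (Set.projIic (0 : ℝ) x : ℝ) = x := by rw [Set.projIic_of_mem hx]
      set y := Set.projIic (0 : ℝ) x
      have e : slice f.1.1 y = slice uxx.1 y + ε • slice uηη.1 y - slice ux.1 y +
          Real.exp x • slice u.1.1 zeroNeg := by
        ext η
        refine (hneg (y, η)).trans ?_
        simp only [hy, ContinuousMap.add_apply, ContinuousMap.sub_apply, ContinuousMap.smul_apply,
          slice_apply, smul_eq_mul]
        ring
      have e2 : cellMode n (slice uηη.1 y) = freq ℓ n ^ 2 * cellMode n (slice u.1.1 y) := by
        rw [cellMode_deriv n (g := slice uη.1 y) (g' := slice uηη.1 y) (huηη.1 y) (hpη.1 y),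
          cellMode_deriv n (g := slice u.1.1 y) (g' := slice uη.1 y)
            (huη.1 y) (hp.1 y)]
        ring
      rw [e, map_add, map_sub, map_add, map_smul, map_smul, e2, hμC, Complex.real_smul,
        Complex.real_smul]
      ring
    · rw [Set.projIic_of_mem hx, mul_assoc]
      exact norm_cellMode_le n fun η => abs_fst_le u _
    · rw [Set.projIic_of_mem hx, mul_assoc]
      exact norm_cellMode_le n fun η => abs_fst_le f _

lemma tendsto_apply_zero {u : XSpace ℓ} {un : ℕ → XSpace ℓ}
    (h : Tendsto (fun n => xNorm (un n - u)) atTop (𝓝 0)) (η : Cell ℓ) :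
    Tendsto (fun n => (un n).1.1 (zeroNeg, η)) atTop (𝓝 (u.1.1 (zeroNeg, η))) := by
  refine tendsto_iff_norm_sub_tendsto_zero.2 (squeeze_zero (fun _ => norm_nonneg _) (fun n => ?_) h)
  have := xNorm_fst_le (un n - u) (zeroNeg, η)
  simpa [zeroNeg] using this

lemma GraphLEps.endsAgree {ε : ℝ} {u f : XSpace ℓ} (h : GraphLEps ε u f) :
    EndsAgree (slice u.1.1 zeroNeg) := fun a b ha hb => by
  obtain ⟨un, fn, hg, hu, -⟩ := h
  refine tendsto_nhds_unique (tendsto_apply_zero hu a) ?_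
  refine (tendsto_apply_zero hu b).congr fun n => ?_
  obtain ⟨ux, uxx, uη, uηη, -, -, -, -, -, -, -, hp, -⟩ := hg n
  exact (hp.1 zeroNeg a b ha hb).symm

/-- Differences of the approximating solutions lie in the domain of L + εA with right-hand sides
tending to 0, so the a priori estimate applies to them and no regularity of u or u' is needed. -/
lemma GraphLEps.cellMode_eq {ε : ℝ} (hε : 0 < ε) {u u' f : XSpace ℓ} (h : GraphLEps ε u f)
    (h' : GraphLEps ε u' f) {n : ℤ} (hn : n ≠ 0) :
    cellMode n (slice u.1.1 zeroNeg) = cellMode n (slice u'.1.1 zeroNeg) := by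
  obtain ⟨un, fn, hg, hu, hf⟩ := h
  obtain ⟨un', fn', hg', hu', hf'⟩ := h'
  set c := 4 * modeRoot ℓ ε n / ((2 * modeRoot ℓ ε n + 1) * (modeRoot ℓ ε n - 1))
  have hr : 1 < modeRoot ℓ ε n := one_lt_charRoot (modeEig_pos hε hn)
  have hc : 0 ≤ c := div_nonneg (by linarith) (mul_nonneg (by linarith) (by linarith))
  have hl := hℓ.out
  have hb : ∀ k, ‖cellMode n (slice u.1.1 zeroNeg) - cellMode n (slice u'.1.1 zeroNeg)‖ ≤
      ℓ * xNorm (un k - u) + ℓ * xNorm (un' k - u') +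
        c * (ℓ * (2 * (xNorm (fn k - f) + xNorm (fn' k - f)))) := fun k => by
    have h1 := norm_cellMode_zero_le hε hn ((hg k).sub (hg' k))
    have h2 := xNorm_sub_sub_le (fn k) (fn' k) f
    have h3 : ‖cellMode n (slice (un k - u).1.1 zeroNeg)‖ ≤ ℓ * xNorm (un k - u) :=
      norm_cellMode_le n fun η => by
        have := xNorm_fst_le (un k - u) (zeroNeg, η)
        simpa [zeroNeg] using this
    have h4 : ‖cellMode n (slice (un' k - u').1.1 zeroNeg)‖ ≤ ℓ * xNorm (un' k - u') :=
      norm_cellMode_le n fun η => by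
        have := xNorm_fst_le (un' k - u') (zeroNeg, η)
        simpa [zeroNeg] using this
    have e : cellMode n (slice u.1.1 zeroNeg) - cellMode n (slice u'.1.1 zeroNeg) =
        -cellMode n (slice (un k - u).1.1 zeroNeg) + cellMode n (slice (un' k - u').1.1 zeroNeg) +
          cellMode n (slice (un k - un' k).1.1 zeroNeg) := by
      rw [← map_sub, ← map_neg, ← map_add, ← map_add]
      congr 1
      ext η
      change u.1.1 _ - u'.1.1 _ = -((un k).1.1 _ - u.1.1 _) + ((un' k).1.1 _ - u'.1.1 _) +
        ((un k).1.1 _ - (un' k).1.1 _)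
      ring
    rw [e]
    refine (norm_add_le _ _).trans (add_le_add ((norm_add_le _ _).trans ?_) (h1.trans ?_))
    · rw [norm_neg]; exact add_le_add h3 h4
    · gcongr
  have ht : Tendsto (fun k => ℓ * xNorm (un k - u) + ℓ * xNorm (un' k - u') +
      c * (ℓ * (2 * (xNorm (fn k - f) + xNorm (fn' k - f))))) atTop (𝓝 0) := by
    simpa using ((hu.const_mul ℓ).add (hu'.const_mul ℓ)).add
      ((((hf.add hf').const_mul 2).const_mul ℓ).const_mul c)
  have h0 := ge_of_tendsto' ht hb
  exact sub_eq_zero.1 (norm_le_zero_iff.1 h0)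

/-- The trace at `x = 0` of the solution of `L_ε u = f` is unique up to a constant. -/
lemma GraphLEps.trace_unique {ε : ℝ} (hε : 0 < ε) {u u' f : XSpace ℓ} (h : GraphLEps ε u f)
    (h' : GraphLEps ε u' f) :
    ∃ c : ℝ, ∀ η, u.1.1 (zeroNeg, η) = u'.1.1 (zeroNeg, η) + c := by
  obtain ⟨F, hF⟩ := exists_restr_eq (slice u.1.1 zeroNeg).continuous h.endsAgree
  obtain ⟨F', hF'⟩ := exists_restr_eq (slice u'.1.1 zeroNeg).continuous h'.endsAgree
  obtain ⟨c, hc⟩ := eq_const_of_coef (F := F - F') fun n hn => by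
    rw [coef_sub, cellMode_restr n hF, cellMode_restr n hF', h.cellMode_eq hε h' hn, sub_self]
  refine ⟨c, fun η => ?_⟩
  have h1 := hc ((η : ℝ) : AddCircle ℓ)
  have h2 := congrFun hF η
  have h3 := congrFun hF' η
  rw [restr_apply, slice_apply] at h2 h3
  rw [← h2, ← h3, ← h1]
  simp

/-- Derivatives on the cell are unique, so both data share ψ_ηη and the source; the traces differ by
a constant, which the first η-derivative removes. -/
theorem GraphB.unique {ε : ℝ} (hε : 0 < ε) {ψ g g' : Cell ℓ → ℝ} (h : GraphB ε ψ g)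
    (h' : GraphB ε ψ g') : g = g' := by
  obtain ⟨ψ₁, ψ₂, w₁, w₂, f, u, a1, a2, a3, a4, a5, a6, a7, a8⟩ := h
  obtain ⟨ψ₁', ψ₂', w₁', w₂', f', u', b1, b2, b3, b4, b5, b6, b7, b8⟩ := h'
  obtain rfl := a1.congr_deriv uniqueDiffOn_cell b1
  obtain rfl := a2.congr_deriv uniqueDiffOn_cell b2
  have hf : f = f' := by
    refine Subtype.ext (Prod.ext ?_ ?_) <;> ext p
    · rw [a3, b3]
    · rw [a4, b4]
  subst hf
  obtain ⟨c, hc⟩ := a5.2.2.trace_unique hε b5.2.2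
  have a6' : HasDerivOn (fun η => u.1.1 (zeroNeg, η)) w₁' :=
    hasDerivOn_of_hasDerivWithinAt
      (F := fun y => Function.extend Subtype.val (fun η => u'.1.1 (zeroNeg, η)) 0 y + c)
      (fun x => by
        have := extend_val (fun η => u'.1.1 (zeroNeg, η)) x
        rw [this, hc])
      fun x => (b6 x).add_const c
  obtain rfl := a6.congr_deriv uniqueDiffOn_cell a6'
  obtain rfl := a7.congr_deriv uniqueDiffOn_cell b7
  ext η
  rw [a8, b8]

end Modes

/-! ### Profiles in the variable `x` -/

/-- The functions `(a x² + b x + d) e^x + k e^{r x}`. -/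
def negFun (a b d k r : ℝ) : C(ℝ, ℝ) :=
  ⟨fun x => (a * x ^ 2 + b * x + d) * Real.exp x + k * Real.exp (r * x), by fun_prop⟩

/-- The functions `α x + β + k e^{s x}`. -/
def posFun (α β k s : ℝ) : C(ℝ, ℝ) :=
  ⟨fun x => α * x + β + k * Real.exp (s * x), by fun_prop⟩

lemma negFun_apply (a b d k r x : ℝ) : negFun a b d k r x =
    (a * x ^ 2 + b * x + d) * Real.exp x + k * Real.exp (r * x) := rfl

lemma posFun_apply (α β k s x : ℝ) : posFun α β k s x = α * x + β + k * Real.exp (s * x) := rfl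

/-- The family is stable under differentiation, so derivatives and primitives become arithmetic on
the parameters. -/
lemma hasDerivAt_negFun (a b d k r x : ℝ) :
    HasDerivAt (negFun a b d k r) (negFun a (2 * a + b) (b + d) (k * r) r x) x := by
  have h1 : HasDerivAt (fun x : ℝ => a * x ^ 2 + b * x + d) (a * (2 * x) + b) x := by
    simpa using (((hasDerivAt_pow 2 x).const_mul a).add ((hasDerivAt_id x).const_mul b)).add_const d
  refine ((h1.mul (Real.hasDerivAt_exp x)).add
    ((hasDerivAt_exp_mul r x).const_mul k)).congr_deriv ?_
  rw [negFun_apply]; ring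

lemma hasDerivAt_posFun (α β k s x : ℝ) :
    HasDerivAt (posFun α β k s) (posFun 0 α (k * s) s x) x := by
  refine ((((hasDerivAt_id x).const_mul α).add_const β).add
    ((hasDerivAt_exp_mul s x).const_mul k)).congr_deriv ?_
  rw [posFun_apply]; ring

/-- With y = -x/2 ≥ 0, the inequalities y + 1 ≤ e^y and y²/2 ≤ e^y give |x| e^{x/2} ≤ 2 and x²
e^{x/2} ≤ 8. -/
lemma abs_negFun_le {a b d k r x : ℝ} (hr : 1 ≤ r) (hx : x ≤ 0) :
    |negFun a b d k r x| ≤ (8 * |a| + 2 * |b| + |d| + |k|) * Real.exp (x / 2) := by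
  have hy : 0 ≤ -x / 2 := by linarith
  have e1 : Real.exp x = Real.exp (x / 2) * Real.exp (x / 2) := by
    rw [← Real.exp_add]; congr 1; ring
  have e2 : Real.exp (x / 2) * Real.exp (-x / 2) = 1 := by
    rw [← Real.exp_add, ← Real.exp_zero]; congr 1; ring
  have hE := Real.exp_pos (x / 2)
  have h1 : Real.exp (x / 2) ≤ 1 := Real.exp_le_one_iff.2 (by linarith)
  have h2 : -x * Real.exp (x / 2) ≤ 2 := by
    have := Real.add_one_le_exp (-x / 2)
    nlinarith
  have h3 : x ^ 2 * Real.exp (x / 2) ≤ 8 := by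
    have := Real.quadratic_le_exp_of_nonneg hy
    nlinarith
  have h4 : Real.exp (r * x) ≤ Real.exp (x / 2) := Real.exp_le_exp.2 (by nlinarith)
  rw [negFun_apply]
  have t1 : |a * x ^ 2 * Real.exp x| ≤ 8 * |a| * Real.exp (x / 2) := by
    rw [abs_mul, abs_mul, abs_of_nonneg (sq_nonneg x), abs_of_pos (Real.exp_pos x), e1]
    have := mul_le_mul_of_nonneg_left h3 (mul_nonneg (abs_nonneg a) hE.le)
    linarith
  have t2 : |b * x * Real.exp x| ≤ 2 * |b| * Real.exp (x / 2) := by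
    rw [abs_mul, abs_mul, abs_of_nonpos hx, abs_of_pos (Real.exp_pos x), e1]
    have := mul_le_mul_of_nonneg_left h2 (mul_nonneg (abs_nonneg b) hE.le)
    linarith
  have t3 : |d * Real.exp x| ≤ |d| * Real.exp (x / 2) := by
    rw [abs_mul, abs_of_pos (Real.exp_pos x), e1]
    exact mul_le_mul_of_nonneg_left (mul_le_of_le_one_right hE.le h1) (abs_nonneg d)
  have t4 : |k * Real.exp (r * x)| ≤ |k| * Real.exp (x / 2) := by
    rw [abs_mul, abs_of_pos (Real.exp_pos _)]
    exact mul_le_mul_of_nonneg_left h4 (abs_nonneg k)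
  have e : (a * x ^ 2 + b * x + d) * Real.exp x + k * Real.exp (r * x) =
      a * x ^ 2 * Real.exp x + b * x * Real.exp x + d * Real.exp x + k * Real.exp (r * x) := by ring
  rw [e]
  refine (abs_add_le _ _).trans ?_
  have s1 := abs_add_le (a * x ^ 2 * Real.exp x + b * x * Real.exp x) (d * Real.exp x)
  have s2 := abs_add_le (a * x ^ 2 * Real.exp x) (b * x * Real.exp x)
  linarith

lemma abs_posFun_le {α β k s x : ℝ} (hs : s ≤ 0) (hx : 0 ≤ x) :
    |posFun α β k s x| ≤ (2 * |α| + |β| + |k|) * Real.exp (x / 2) := by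
  have h1 : 1 ≤ Real.exp (x / 2) := Real.one_le_exp (by linarith)
  have h2 : x ≤ 2 * Real.exp (x / 2) := by
    have := Real.add_one_le_exp (x / 2)
    linarith
  have h3 : Real.exp (s * x) ≤ Real.exp (x / 2) := Real.exp_le_exp.2 (by nlinarith)
  rw [posFun_apply]
  have t1 : |α * x| ≤ |α| * (2 * Real.exp (x / 2)) := by
    rw [abs_mul, abs_of_nonneg hx]; gcongr
  have t2 : |β| ≤ |β| * Real.exp (x / 2) := le_mul_of_one_le_right (abs_nonneg β) h1
  have t3 : |k * Real.exp (s * x)| ≤ |k| * Real.exp (x / 2) := by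
    rw [abs_mul, abs_of_pos (Real.exp_pos _)]; gcongr
  have s1 := abs_add_le (α * x + β) (k * Real.exp (s * x))
  have s2 := abs_add_le (α * x) β
  linarith

/-! ### The solution of the equation for one mode -/

/-- The value at `x = 0` of the solution, in terms of the root `r`. -/
def traceSymb (r : ℝ) : ℝ := -(8 * r + 3) / (9 * r ^ 2 * (2 * r + 1))

/-- The constant term in the polynomial part of the solution for `x ≤ 0`. -/
def profD (μ : ℝ) : ℝ :=
  (2 * (1 / (6 * μ)) + (1 / (3 * μ ^ 2) - 2 / (9 * μ)) - 4 / 9 + traceSymb (charRoot μ)) / μ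

/-- The constant term in the polynomial part of the solution for `x ≥ 0`. -/
def profBeta (μ : ℝ) : ℝ := -(4 / (9 * μ)) - 1 / (3 * μ ^ 2)

/-- The solution for `x ≤ 0`. -/
def profNeg (μ : ℝ) : C(ℝ, ℝ) :=
  negFun (1 / (6 * μ)) (1 / (3 * μ ^ 2) - 2 / (9 * μ)) (profD μ)
    (traceSymb (charRoot μ) - profD μ) (charRoot μ)

/-- The solution for `x ≥ 0`. -/
def profPos (μ : ℝ) : C(ℝ, ℝ) :=
  posFun (1 / (3 * μ)) (profBeta μ) (traceSymb (charRoot μ) - profBeta μ) (1 - charRoot μ)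

lemma profNeg_zero (μ : ℝ) : profNeg μ 0 = traceSymb (charRoot μ) := by
  simp [profNeg, negFun_apply]

lemma profPos_zero (μ : ℝ) : profPos μ 0 = traceSymb (charRoot μ) := by
  simp [profPos, posFun_apply]

/-- This is the equation that determines `traceSymb`: continuity at 0 is built into the coefficients
of the exponentials, and the trace is then fixed by continuity of the first derivative. -/
lemma prof_deriv_match {μ : ℝ} (hμ : 0 < μ) :
    1 / (3 * μ ^ 2) - 2 / (9 * μ) + profD μ +
      (traceSymb (charRoot μ) - profD μ) * charRoot μ =
    1 / (3 * μ) + (traceSymb (charRoot μ) - profBeta μ) * (1 - charRoot μ) := by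
  have hr := one_lt_charRoot hμ
  have h := charRoot_mul μ hμ.le
  unfold profD profBeta traceSymb
  generalize charRoot μ = r at hr h
  subst h
  have h1 : r ≠ 0 := by linarith
  have h2 : r - 1 ≠ 0 := by linarith
  have h3 : 2 * r + 1 ≠ 0 := by linarith
  field_simp
  ring

/-- The left-hand side is the x-integral defining `Q`, evaluated on the two profiles; its vanishing
places the mode in the kernel of 𝓟. -/
lemma prof_mean {μ : ℝ} (hμ : 0 < μ) :
    profD μ - (1 / (3 * μ ^ 2) - 2 / (9 * μ)) + 2 * (1 / (6 * μ)) +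
      (traceSymb (charRoot μ) - profD μ) / charRoot μ +
    (1 / (3 * μ) + profBeta μ + (traceSymb (charRoot μ) - profBeta μ) / charRoot μ) = 0 := by
  have hr := one_lt_charRoot hμ
  have h := charRoot_mul μ hμ.le
  unfold profD profBeta traceSymb
  generalize charRoot μ = r at hr h
  subst h
  have h1 : r ≠ 0 := by linarith
  have h2 : r - 1 ≠ 0 := by linarith
  have h3 : 2 * r + 1 ≠ 0 := by linarith
  field_simp
  ring

lemma profNeg_ode {μ : ℝ} (hμ : 0 < μ) (x : ℝ) :
    let a := 1 / (6 * μ)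
    let b := 1 / (3 * μ ^ 2) - 2 / (9 * μ)
    let d := profD μ
    let r := charRoot μ
    let k := traceSymb r - d
    negFun a (2 * a + (2 * a + b)) (2 * a + b + (b + d)) (k * r * r) r x - μ * profNeg μ x -
      negFun a (2 * a + b) (b + d) (k * r) r x + traceSymb r * Real.exp x =
    -negFun (1 / 6) (-2 / 9) (-4 / 9) 0 1 x := by
  intro a b d r k
  have h := charRoot_mul μ hμ.le
  -- Comparison of the coefficients of x² e^x, x e^x and e^x; the nonlocal term contributes the
  -- trace to the last. The term in e^{rx} drops out because r² - r = μ.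
  have e1 : μ * a = 1 / 6 := by simp only [a]; field_simp
  have e2 : 2 * a - μ * b = 2 / 9 := by simp only [a, b]; field_simp; ring
  have e3 : 2 * a + b - μ * d + traceSymb r = 4 / 9 := by
    have : μ * d = 2 * a + b - 4 / 9 + traceSymb r := by
      simp only [d, a, b, r, profD]; field_simp
    rw [this]; ring
  rw [profNeg]
  simp only [negFun_apply]
  linear_combination (-x ^ 2 * Real.exp x) * e1 + x * Real.exp x * e2 + Real.exp x * e3 +
    k * Real.exp (r * x) * h

lemma profPos_ode {μ : ℝ} (hμ : 0 < μ) (x : ℝ) :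
    let α := 1 / (3 * μ)
    let s := 1 - charRoot μ
    let k := traceSymb (charRoot μ) - profBeta μ
    posFun 0 0 (k * s * s) s x - μ * profPos μ x - posFun 0 α (k * s) s x =
    -posFun (1 / 3) (-4 / 9) 0 0 x := by
  intro α s k
  have h := charRoot_mul μ hμ.le
  have e1 : μ * α = 1 / 3 := by simp only [α]; field_simp
  have e2 : α + μ * profBeta μ = -4 / 9 := by simp only [α, profBeta]; field_simp; ring
  rw [profPos]
  simp only [posFun_apply]
  linear_combination (-x) * e1 - e2 + k * Real.exp (s * x) * h

/-- Every coefficient of the profiles is 1/μ times a polynomial in 1/μ and the trace, which is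
itself at most 1/μ. The parameter t bounds 1/μ over all modes, so the decay 1/μ holds with one
constant. -/
lemma abs_prof_le {μ t : ℝ} (hμ : 0 < μ) (ht : 1 / μ ≤ t) :
    (∀ x ≤ 0, |profNeg μ x| ≤ 13 * (2 + t) ^ 2 / μ * Real.exp (x / 2)) ∧
    ∀ x, 0 ≤ x → |profPos μ x| ≤ 13 * (2 + t) ^ 2 / μ * Real.exp (x / 2) := by
  have hr := one_lt_charRoot hμ
  have h := charRoot_mul μ hμ.le
  have hm0 : 0 < 1 / μ := by positivity
  set m := 1 / μ with hm
  have e1 : 1 / (6 * μ) = m / 6 := by rw [hm]; field_simp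
  have e2 : 1 / (3 * μ ^ 2) - 2 / (9 * μ) = m * (m / 3 - 2 / 9) := by rw [hm]; field_simp
  have e3 : 1 / (3 * μ) = m / 3 := by rw [hm]; field_simp
  have e4 : profBeta μ = -(m * (4 / 9 + m / 3)) := by
    rw [profBeta, hm]; field_simp; ring
  have hc : |traceSymb (charRoot μ)| ≤ m := by
    have hp : 0 < 9 * charRoot μ ^ 2 * (2 * charRoot μ + 1) := by positivity
    rw [traceSymb, neg_div, abs_neg, abs_of_pos (div_pos (by linarith) hp), hm,
      div_le_div_iff₀ hp hμ]
    nlinarith [mul_pos (show 0 < charRoot μ by linarith) (show 0 < charRoot μ by linarith),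
      pow_pos (show 0 < charRoot μ by linarith) 3]
  have hcl := abs_le.1 hc
  have e5 : profD μ =
      m * (m / 3 + m * (m / 3 - 2 / 9) - 4 / 9 + traceSymb (charRoot μ)) := by
    rw [profD, e1, e2, div_eq_mul_one_div _ μ, ← hm]; ring
  have bA : |1 / (6 * μ)| ≤ m := by rw [e1, abs_of_pos (by positivity)]; linarith
  have bα : |1 / (3 * μ)| ≤ m := by rw [e3, abs_of_pos (by positivity)]; linarith
  have bB : |1 / (3 * μ ^ 2) - 2 / (9 * μ)| ≤ m * (1 + t) := by
    rw [e2, abs_mul, abs_of_pos hm0]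
    gcongr
    rw [abs_le]; constructor <;> linarith
  have bβ : |profBeta μ| ≤ m * (1 + t) := by
    rw [e4, abs_neg, abs_mul, abs_of_pos hm0]
    gcongr
    rw [abs_of_pos (by positivity)]; linarith
  have ht0 : 0 < t := hm0.trans_le ht
  have hmm : m * m ≤ t * t := by gcongr
  have bD : |profD μ| ≤ m * (1 + 3 * t + t ^ 2) := by
    rw [e5, abs_mul, abs_of_pos hm0]
    gcongr
    rw [abs_le]; constructor <;> nlinarith
  have hN : 8 * |1 / (6 * μ)| + 2 * |1 / (3 * μ ^ 2) - 2 / (9 * μ)| + |profD μ| +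
      |traceSymb (charRoot μ) - profD μ| ≤ 13 * (2 + t) ^ 2 / μ := by
    have := abs_sub (traceSymb (charRoot μ)) (profD μ)
    have e : 13 * (2 + t) ^ 2 / μ = m * (13 * (2 + t) ^ 2) := by rw [hm]; ring
    rw [e]
    nlinarith [mul_pos hm0 ht0, mul_pos hm0 (mul_pos ht0 ht0)]
  have hP : 2 * |1 / (3 * μ)| + |profBeta μ| + |traceSymb (charRoot μ) - profBeta μ| ≤
      13 * (2 + t) ^ 2 / μ := by
    have := abs_sub (traceSymb (charRoot μ)) (profBeta μ)
    have e : 13 * (2 + t) ^ 2 / μ = m * (13 * (2 + t) ^ 2) := by rw [hm]; ring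
    rw [e]
    nlinarith [mul_pos hm0 ht0, mul_pos hm0 (mul_pos ht0 ht0)]
  refine ⟨fun x hx => ?_, fun x hx => ?_⟩
  · exact (abs_negFun_le hr.le hx).trans (by gcongr)
  · exact (abs_posFun_le (by linarith) hx).trans (by gcongr)

/-! ### Products of functions of `x` and of `η` -/

section Tensor

variable {ℓ : ℝ} [hℓ : Fact (0 < ℓ)]

/-- The pair `(φ(x) q(η), χ(x) q(η))`. -/
def tensor (φ χ : C(ℝ, ℝ)) (q : C(Cell ℓ, ℝ)) : Pair ℓ :=
  (⟨fun p => φ p.1 * q p.2, by fun_prop⟩, ⟨fun p => χ p.1 * q p.2, by fun_prop⟩)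

lemma tensor_fst (φ χ : C(ℝ, ℝ)) (q : C(Cell ℓ, ℝ)) (p : StripNeg ℓ) :
    (tensor φ χ q).1 p = φ p.1 * q p.2 := rfl

lemma tensor_snd (φ χ : C(ℝ, ℝ)) (q : C(Cell ℓ, ℝ)) (p : StripPos ℓ) :
    (tensor φ χ q).2 p = χ p.1 * q p.2 := rfl

lemma hasDx_tensor {φ χ φ' χ' : C(ℝ, ℝ)} (q : C(Cell ℓ, ℝ)) (h : ∀ x, HasDerivAt φ (φ' x) x)
    (k : ∀ x, HasDerivAt χ (χ' x) x) : HasDx (tensor φ χ q) (tensor φ' χ' q) :=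
  ⟨fun η => hasDerivOn_of_hasDerivWithinAt (F := fun x => φ x * q η) (fun _ => rfl)
      fun x => ((h x).mul_const (q η)).hasDerivWithinAt,
    fun η => hasDerivOn_of_hasDerivWithinAt (F := fun x => χ x * q η) (fun _ => rfl)
      fun x => ((k x).mul_const (q η)).hasDerivWithinAt⟩

lemma hasDeta_tensor (φ χ : C(ℝ, ℝ)) {q q' : C(Cell ℓ, ℝ)} (h : HasDerivOn q q') :
    HasDeta (tensor φ χ q) (tensor φ χ q') :=
  ⟨fun x => h.smul (φ x), fun x => h.smul (χ x)⟩

lemma periodicEta_tensor (φ χ : C(ℝ, ℝ)) {q : C(Cell ℓ, ℝ)} (h : EndsAgree q) :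
    PeriodicEta (tensor φ χ q) := ⟨fun x => h.smul (φ x), fun x => h.smul (χ x)⟩

lemma matchAtZero_tensor {φ χ : C(ℝ, ℝ)} (q : C(Cell ℓ, ℝ)) (h : φ 0 = χ 0) :
    MatchAtZero (tensor φ χ q) := fun η => by
  rw [tensor_fst, tensor_snd]
  exact congrArg (· * q η) h

lemma tensor_mem {φ χ : C(ℝ, ℝ)} {A B : ℝ} (hφ : ∀ x ≤ 0, |φ x| ≤ A * Real.exp (x / 2))
    (hχ : ∀ x, 0 ≤ x → |χ x| ≤ B * Real.exp (x / 2)) (q : C(Cell ℓ, ℝ)) :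
    tensor φ χ q ∈ XSpace ℓ := by
  refine ⟨⟨A * ‖q‖, fun p => ?_⟩, ⟨B * ‖q‖, fun p => ?_⟩⟩
  · rw [abs_weight_le_iff, tensor_fst, abs_mul, mul_right_comm]
    exact mul_le_mul (hφ _ p.1.2) (q.norm_coe_le_norm _) (abs_nonneg _)
      ((abs_nonneg _).trans (hφ _ p.1.2))
  · rw [abs_weight_le_iff, tensor_snd, abs_mul, mul_right_comm]
    exact mul_le_mul (hχ _ p.1.2) (q.norm_coe_le_norm _) (abs_nonneg _)
      ((abs_nonneg _).trans (hχ _ p.1.2))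

/-- Separation of variables: since ε q'' = -μ q, the equation reduces to the profile ODEs multiplied
by q. -/
lemma graphLA_prof {ε μ : ℝ} (hμ : 0 < μ) {q q₁ q₂ : C(Cell ℓ, ℝ)} (h1 : HasDerivOn q q₁)
    (h2 : HasDerivOn q₁ q₂) (hq : EndsAgree q) (hq₁ : EndsAgree q₁) (he : ∀ η, ε * q₂ η = -(μ * q η))
    {u f : XSpace ℓ} (hu : u.1 = tensor (profNeg μ) (profPos μ) q)
    (hf : f.1 = tensor (negFun (1 / 6) (-2 / 9) (-4 / 9) 0 1) (posFun (1 / 3) (-4 / 9) 0 0) q) :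
    GraphLA ε u (-f) := by
  have hr := one_lt_charRoot hμ
  have hb := abs_prof_le hμ le_rfl
  have d1 : HasDx (tensor (profNeg μ) (profPos μ) q) (tensor _ _ q) :=
    hasDx_tensor q (hasDerivAt_negFun _ _ _ _ _) (hasDerivAt_posFun _ _ _ _)
  have d2 := hasDx_tensor q (hasDerivAt_negFun (1 / (6 * μ))
      (2 * (1 / (6 * μ)) + (1 / (3 * μ ^ 2) - 2 / (9 * μ)))
      (1 / (3 * μ ^ 2) - 2 / (9 * μ) + profD μ)
      ((traceSymb (charRoot μ) - profD μ) * charRoot μ) (charRoot μ))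
    (hasDerivAt_posFun 0 (1 / (3 * μ)) ((traceSymb (charRoot μ) - profBeta μ) * (1 - charRoot μ))
      (1 - charRoot μ))
  rw [← hu] at d1
  refine ⟨_, _, tensor (profNeg μ) (profPos μ) q₁, tensor (profNeg μ) (profPos μ) q₂, d1, d2, ?_,
    hasDeta_tensor _ _ h2, tensor_mem hb.1 hb.2 q₂, ?_, ?_, ?_, periodicEta_tensor _ _ hq₁,
    fun p => ?_, fun p => ?_⟩
  · rw [hu]; exact hasDeta_tensor _ _ h1
  · rw [hu]; exact matchAtZero_tensor q (by rw [profNeg_zero, profPos_zero])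
  · refine matchAtZero_tensor q ?_
    have := prof_deriv_match hμ
    simp only [negFun_apply, posFun_apply, mul_zero, Real.exp_zero]
    linarith
  · rw [hu]; exact periodicEta_tensor _ _ hq
  · change -f.1.1 p = _
    rw [hu, hf]
    simp only [tensor_fst]
    have e0 : profNeg μ ((zeroNeg : Set.Iic (0 : ℝ)) : ℝ) = traceSymb (charRoot μ) := profNeg_zero μ
    rw [e0]
    linear_combination (-q p.2) * profNeg_ode hμ p.1 - profNeg μ p.1 * he p.2
  · change -f.1.2 p = _
    rw [hf]
    simp only [tensor_snd]
    linear_combination (-q p.2) * profPos_ode hμ p.1 - profPos μ p.1 * he p.2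

end Tensor

/-! ### Integrals of the profiles -/

lemma tendsto_negFun_atBot {a b d k r : ℝ} (hr : 1 ≤ r) :
    Tendsto (negFun a b d k r) atBot (𝓝 0) := by
  have h : Tendsto (fun x : ℝ => (8 * |a| + 2 * |b| + |d| + |k|) * Real.exp (x / 2)) atBot (𝓝 0) := by
    have := (Real.tendsto_exp_atBot.comp
      (tendsto_id.atBot_div_const (show (0 : ℝ) < 2 by norm_num))).const_mul
      (8 * |a| + 2 * |b| + |d| + |k|)
    simpa using this
  refine squeeze_zero_norm' ?_ h
  filter_upwards [eventually_le_atBot (0 : ℝ)] with x hx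
  exact abs_negFun_le hr hx

lemma integrableOn_Iic_of_abs_le {φ : ℝ → ℝ} (hφ : Continuous φ) {A : ℝ}
    (h : ∀ x ≤ 0, |φ x| ≤ A * Real.exp (x / 2)) : IntegrableOn φ (Set.Iic 0) := by
  have hi : IntegrableOn (fun x : ℝ => A * Real.exp (1 / 2 * x)) (Set.Iic 0) :=
    (integrableOn_exp_mul_Iic (by norm_num) 0).const_mul A
  refine hi.mono' hφ.aestronglyMeasurable ((ae_restrict_mem measurableSet_Iic).mono fun x hx => ?_)
  rw [Real.norm_eq_abs, one_div_mul_eq_div]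
  exact h x hx

lemma integrableOn_Ici_of_abs_le {φ : ℝ → ℝ} (hφ : Continuous φ) {A : ℝ}
    (h : ∀ x, 0 ≤ x → |φ x| ≤ A * Real.exp (x / 2)) :
    IntegrableOn (fun x => Real.exp (-x) * φ x) (Set.Ici 0) := by
  have hi : IntegrableOn (fun x : ℝ => A * Real.exp (-1 / 2 * x)) (Set.Ici 0) := by
    rw [integrableOn_Ici_iff_integrableOn_Ioi]
    exact (integrableOn_exp_mul_Ioi (by norm_num) 0).const_mul A
  refine hi.mono' (by fun_prop) ((ae_restrict_mem measurableSet_Ici).mono fun x hx => ?_)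
  rw [Real.norm_eq_abs, abs_mul, abs_of_pos (Real.exp_pos _)]
  refine (mul_le_mul_of_nonneg_left (h x hx) (Real.exp_pos _).le).trans_eq ?_
  rw [mul_left_comm, ← Real.exp_add]
  congr 2; ring

lemma integral_negFun {a b d k r : ℝ} (hr : 1 ≤ r) :
    ∫ x in Set.Iic (0 : ℝ), negFun a b d k r x = d - b + 2 * a + k / r := by
  have hr0 : r ≠ 0 := by linarith
  have h := integral_Iic_of_hasDerivAt_of_tendsto' (a := 0) (m := 0)
    (f := negFun a (b - 2 * a) (d - b + 2 * a) (k / r) r) (f' := negFun a b d k r)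
    (fun x _ => (hasDerivAt_negFun _ _ _ _ _ x).congr_deriv (by
      simp only [negFun_apply]; field_simp; ring))
    (integrableOn_Iic_of_abs_le (negFun a b d k r).continuous fun x hx => abs_negFun_le hr hx)
    (tendsto_negFun_atBot hr)
  rw [h]
  simp [negFun_apply]

/-- The primitive is minus e^{-x} times a function of the same family, and it vanishes at +∞. -/
lemma integral_posFun {α β k s : ℝ} (hs : s ≤ 0) :
    ∫ x in Set.Ici (0 : ℝ), Real.exp (-x) * posFun α β k s x = α + β + k / (1 - s) := by
  have hs0 : 1 - s ≠ 0 := by linarith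
  rw [integral_Ici_eq_integral_Ioi]
  have hd : ∀ x : ℝ, HasDerivAt (fun x => -(Real.exp (-x) * posFun α (α + β) (k / (1 - s)) s x))
      (Real.exp (-x) * posFun α β k s x) x := fun x => by
    refine (((Real.hasDerivAt_exp (-x)).comp x (hasDerivAt_neg x)).mul
      (hasDerivAt_posFun α (α + β) (k / (1 - s)) s x)).neg.congr_deriv ?_
    simp only [posFun_apply, Function.comp]
    field_simp
    ring
  have ht : Tendsto (fun x => -(Real.exp (-x) * posFun α (α + β) (k / (1 - s)) s x)) atTop (𝓝 0) := by
    have h : Tendsto (fun x : ℝ => (2 * |α| + |α + β| + |k / (1 - s)|) * Real.exp (-x / 2)) atTop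
        (𝓝 0) := by
      have := (Real.tendsto_exp_atBot.comp
        (tendsto_neg_atTop_atBot.atBot_div_const (show (0 : ℝ) < 2 by norm_num))).const_mul
        (2 * |α| + |α + β| + |k / (1 - s)|)
      simpa using this
    refine squeeze_zero_norm' ?_ h
    filter_upwards [eventually_ge_atTop (0 : ℝ)] with x hx
    rw [norm_neg, Real.norm_eq_abs, abs_mul, abs_of_pos (Real.exp_pos _)]
    refine (mul_le_mul_of_nonneg_left (abs_posFun_le hs hx) (Real.exp_pos _).le).trans_eq ?_
    rw [mul_left_comm, ← Real.exp_add]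
    congr 2; ring
  rw [integral_Ioi_of_hasDerivAt_of_tendsto' (fun x _ => hd x)
    ((integrableOn_Ici_of_abs_le (posFun α β k s).continuous
      fun x hx => abs_posFun_le hs hx).mono_set Set.Ioi_subset_Ici_self) ht]
  simp [posFun_apply]

/-! ### The functional defining the projection 𝓟 -/

section Mean

variable {ℓ : ℝ} [hℓ : Fact (0 < ℓ)]

lemma Q_eq (f : XSpace ℓ) (η : Cell ℓ) : Q f η =
    (∫ x in Set.Iic (0 : ℝ), f.1.1 (Set.projIic 0 x, η)) +
      ∫ x in Set.Ici (0 : ℝ), Real.exp (-x) * f.1.2 (Set.projIci 0 x, η) := by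
  rw [Q, ← integral_subtype_comap measurableSet_Iic, ← integral_subtype_comap measurableSet_Ici]
  congr 1
  · refine integral_congr_ae (Eventually.of_forall fun x => ?_)
    change _ = f.1.1 (Set.projIic 0 (x : ℝ), η)
    rw [Set.projIic_coe]
  · refine integral_congr_ae (Eventually.of_forall fun x => ?_)
    change _ = Real.exp (-(x : ℝ)) * f.1.2 (Set.projIci 0 (x : ℝ), η)
    rw [Set.projIci_coe]

lemma abs_fst_proj_le (f : XSpace ℓ) (η : Cell ℓ) {x : ℝ} (hx : x ≤ 0) :
    |f.1.1 (Set.projIic 0 x, η)| ≤ xNorm f * Real.exp (x / 2) := by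
  rw [Set.projIic_of_mem hx]
  exact abs_fst_le f (⟨x, hx⟩, η)

lemma abs_snd_proj_le (f : XSpace ℓ) (η : Cell ℓ) {x : ℝ} (hx : 0 ≤ x) :
    |f.1.2 (Set.projIci 0 x, η)| ≤ xNorm f * Real.exp (x / 2) := by
  rw [Set.projIci_of_mem hx]
  exact abs_snd_le f (⟨x, hx⟩, η)

lemma integrableOn_fst_proj (f : XSpace ℓ) (η : Cell ℓ) :
    IntegrableOn (fun x => f.1.1 (Set.projIic 0 x, η)) (Set.Iic 0) :=
  integrableOn_Iic_of_abs_le (f.1.1.continuous.comp (continuous_projNeg.prodMk continuous_const))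
    fun _ hx => abs_fst_proj_le f η hx

lemma integrableOn_snd_proj (f : XSpace ℓ) (η : Cell ℓ) :
    IntegrableOn (fun x => Real.exp (-x) * f.1.2 (Set.projIci 0 x, η)) (Set.Ici 0) :=
  integrableOn_Ici_of_abs_le (f.1.2.continuous.comp (continuous_projPos.prodMk continuous_const))
    fun _ hx => abs_snd_proj_le f η hx

lemma Q_add (f g : XSpace ℓ) (η : Cell ℓ) : Q (f + g) η = Q f η + Q g η := by
  have e1 := integral_add (integrableOn_fst_proj f η) (integrableOn_fst_proj g η)
  have e2 := integral_add (integrableOn_snd_proj f η) (integrableOn_snd_proj g η)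
  simp only [Q_eq, Submodule.coe_add, Prod.fst_add, Prod.snd_add, ContinuousMap.add_apply, mul_add]
  rw [e1, e2]
  ring

/-- The weight leaves e^{x/2} on the negative half-line and e^{-x/2} on the positive one, both
integrable. The bound lets the condition Q = 0 pass to limits in 𝓧. -/
lemma exists_abs_Q_le : ∃ C : ℝ, ∀ (f : XSpace ℓ) (η : Cell ℓ), |Q f η| ≤ C * xNorm f := by
  have h1 : IntegrableOn (fun x : ℝ => Real.exp (x / 2)) (Set.Iic 0) :=
    integrableOn_Iic_of_abs_le (by fun_prop) (A := 1) fun x _ => by simp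
  have h2 : IntegrableOn (fun x : ℝ => Real.exp (-x) * Real.exp (x / 2)) (Set.Ici 0) :=
    integrableOn_Ici_of_abs_le (φ := fun x => Real.exp (x / 2)) (by fun_prop) (A := 1)
      fun x _ => by simp
  refine ⟨(∫ x in Set.Iic (0 : ℝ), Real.exp (x / 2)) +
    ∫ x in Set.Ici (0 : ℝ), Real.exp (-x) * Real.exp (x / 2), fun f η => ?_⟩
  rw [Q_eq, add_mul]
  refine (abs_add_le _ _).trans (add_le_add ?_ ?_)
  · rw [mul_comm, ← integral_const_mul, ← Real.norm_eq_abs]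
    exact norm_integral_le_of_norm_le (h1.const_mul (xNorm f))
      ((ae_restrict_mem measurableSet_Iic).mono fun x hx => abs_fst_proj_le f η hx)
  · rw [mul_comm, ← integral_const_mul, ← Real.norm_eq_abs]
    refine norm_integral_le_of_norm_le (h2.const_mul (xNorm f))
      ((ae_restrict_mem measurableSet_Ici).mono fun x hx => ?_)
    rw [Real.norm_eq_abs, abs_mul, abs_of_pos (Real.exp_pos _), mul_left_comm]
    exact mul_le_mul_of_nonneg_left (abs_snd_proj_le f η hx) (Real.exp_pos _).le

lemma Q_tensor {φ χ : C(ℝ, ℝ)} {q : C(Cell ℓ, ℝ)} {f : XSpace ℓ} (hf : f.1 = tensor φ χ q)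
    (η : Cell ℓ) : Q f η = ((∫ x in Set.Iic (0 : ℝ), φ x) +
      ∫ x in Set.Ici (0 : ℝ), Real.exp (-x) * χ x) * q η := by
  rw [Q_eq, hf, add_mul, ← integral_mul_const, ← integral_mul_const]
  congr 1
  · refine setIntegral_congr_fun measurableSet_Iic fun x hx => ?_
    simp only [tensor_fst, Set.projIic_of_mem hx]
  · refine setIntegral_congr_fun measurableSet_Ici fun x hx => ?_
    simp only [tensor_snd, Set.projIci_of_mem hx, mul_assoc]

lemma Q_prof {μ : ℝ} (hμ : 0 < μ) {q : C(Cell ℓ, ℝ)} {u : XSpace ℓ}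
    (hu : u.1 = tensor (profNeg μ) (profPos μ) q) (η : Cell ℓ) : Q u η = 0 := by
  have hr := one_lt_charRoot hμ
  rw [Q_tensor hu, profNeg, profPos, integral_negFun hr.le, integral_posFun (by linarith),
    sub_sub_cancel, prof_mean hμ, zero_mul]

/-- The integrals are 1/9 and -1/9. The number 4/3 is the mean of V - T, and U has mean 1, so V - T
- (4/3)U has mean 0. -/
lemma Q_source {q : C(Cell ℓ, ℝ)} {f : XSpace ℓ} (hf : f.1 =
      tensor (negFun (1 / 6) (-2 / 9) (-4 / 9) 0 1) (posFun (1 / 3) (-4 / 9) 0 0) q)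
    (η : Cell ℓ) : Q f η = 0 := by
  rw [Q_tensor hf, integral_negFun le_rfl, integral_posFun le_rfl]
  norm_num

end Mean

section Solution

variable {ℓ : ℝ} [hℓ : Fact (0 < ℓ)] {ε : ℝ}

/-! ### Solution by Fourier series -/

/-- The real part of a function on the circle, as a function on the cell. -/
def reCell : C(AddCircle ℓ, ℂ) →ₗ[ℝ] C(Cell ℓ, ℝ) where
  toFun p := ⟨fun η => (p ((η : ℝ) : AddCircle ℓ)).re, Complex.continuous_re.comp
    (p.continuous.comp ((AddCircle.continuous_mk' ℓ).comp continuous_subtype_val))⟩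
  map_add' p q := by ext η; simp
  map_smul' c p := by ext η; simp

lemma reCell_apply (p : C(AddCircle ℓ, ℂ)) (η : Cell ℓ) :
    reCell p η = (p ((η : ℝ) : AddCircle ℓ)).re := rfl

lemma abs_reCell_le (p : C(AddCircle ℓ, ℂ)) (η : Cell ℓ) : |reCell p η| ≤ ‖p‖ :=
  (Complex.abs_re_le_norm _).trans (p.norm_coe_le_norm _)

lemma hasDerivOn_reCell_fourier (c : ℂ) (n : ℤ) :
    HasDerivOn (reCell (c • (fourier n : C(AddCircle ℓ, ℂ))))
      (reCell ((c * freq ℓ n) • (fourier n : C(AddCircle ℓ, ℂ)))) := by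
  refine hasDerivOn_of_hasDerivWithinAt
    (F := fun s : ℝ => (c * fourier n (s : AddCircle ℓ)).re) (fun _ => rfl) fun x => ?_
  have h := Complex.reCLM.hasFDerivAt.comp_hasDerivAt (x : ℝ)
    ((hasDerivAt_fourier ℓ n x).const_mul c)
  refine (h.congr_deriv ?_).hasDerivWithinAt
  rw [reCell_apply, freq, ContinuousMap.smul_apply, smul_eq_mul, mul_assoc c]
  rfl

lemma endsAgree_reCell (p : C(AddCircle ℓ, ℂ)) : EndsAgree (reCell p) := fun a b ha hb => by
  rw [reCell_apply, reCell_apply, ha, hb, coe_half_eq]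

/-- Series of products of functions of `x` and Fourier modes, on a strip. -/
lemma exists_series {S : Set ℝ} {m : ℤ → C(ℝ, ℝ)} {b : ℤ → ℝ} (hb0 : ∀ n, 0 ≤ b n)
    (hb : Summable b) (hm : ∀ n, ∀ x ∈ S, |m n x| ≤ b n * Real.exp (x / 2)) :
    ∃ R : C(AddCircle ℓ, ℂ) →ₗ[ℝ] C(S × Cell ℓ, ℝ),
      (∀ p y, HasSum (fun n => m n y.1 * reCell (ccoef n p • fourier n) y.2) (R p y)) ∧
      ∀ p y, |R p y| ≤ (∑' n, b n) * ‖p‖ * Real.exp ((y.1 : ℝ) / 2) := by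
  have hterm : ∀ (p : C(AddCircle ℓ, ℂ)) (n : ℤ) (y : S × Cell ℓ),
      ‖Real.exp (-(y.1 : ℝ) / 2) * (m n y.1 * reCell (ccoef n p • fourier n) y.2)‖ ≤ b n * ‖p‖ := by
    intro p n y
    rw [Real.norm_eq_abs, abs_weight_le_iff, abs_mul, mul_right_comm]
    refine mul_le_mul (hm n _ y.1.2) ((abs_reCell_le _ _).trans ?_) (abs_nonneg _)
      (mul_nonneg (hb0 n) (Real.exp_pos _).le)
    rw [norm_smul, fourier_norm, mul_one]
    exact norm_ccoef_le n p
  -- The series is majorized uniformly only after multiplication by e^{-x/2}; the weight is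
  -- therefore factored out of the sum.
  have hcont : ∀ p : C(AddCircle ℓ, ℂ), Continuous fun y : S × Cell ℓ => Real.exp ((y.1 : ℝ) / 2) *
      ∑' n, Real.exp (-(y.1 : ℝ) / 2) * (m n y.1 * reCell (ccoef n p • fourier n) y.2) :=
    fun p => Continuous.mul (by fun_prop)
      (continuous_tsum (fun n => by fun_prop) (hb.mul_right ‖p‖) (hterm p))
  have hs : ∀ (p : C(AddCircle ℓ, ℂ)) (y : S × Cell ℓ),
      HasSum (fun n => m n y.1 * reCell (ccoef n p • fourier n) y.2) (Real.exp ((y.1 : ℝ) / 2) *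
        ∑' n, Real.exp (-(y.1 : ℝ) / 2) * (m n y.1 * reCell (ccoef n p • fourier n) y.2)) := by
    intro p y
    have h := (Summable.of_norm_bounded (hb.mul_right ‖p‖) fun n => hterm p n y).hasSum.mul_left
      (Real.exp ((y.1 : ℝ) / 2))
    refine h.congr_fun fun n => ?_
    rw [← mul_assoc, ← Real.exp_add]
    simp [neg_div]
  refine ⟨{ toFun := fun p => ⟨_, hcont p⟩, map_add' := fun p q => ?_, map_smul' := fun c p => ?_ },
    hs, fun p y => ?_⟩
  · ext y
    refine (hs (p + q) y).unique (((hs p y).add (hs q y)).congr_fun fun n => ?_)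
    rw [map_add, add_smul, map_add, ContinuousMap.add_apply, mul_add]
  · ext y
    refine (hs (c • p) y).unique (((hs p y).mul_left c).congr_fun fun n => ?_)
    have e : ccoef n (c • p) = c • ccoef n p := (ccoef n).map_smul_of_tower c p
    rw [e, smul_assoc, map_smul, ContinuousMap.smul_apply, smul_eq_mul, mul_left_comm]
  · change |Real.exp ((y.1 : ℝ) / 2) * _| ≤ _
    rw [abs_mul, abs_of_pos (Real.exp_pos _), mul_comm, ← tsum_mul_right]
    exact mul_le_mul_of_nonneg_right
      (tsum_of_norm_bounded (hb.mul_right ‖p‖).hasSum fun n => hterm p n y) (Real.exp_pos _).le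

/-- The factor of the `n`-th Fourier mode in the solution for `x ≤ 0`. -/
def modeNeg (ℓ ε : ℝ) (n : ℤ) : C(ℝ, ℝ) := if n = 0 then 0 else profNeg (modeEig ℓ ε n)

/-- The factor of the `n`-th Fourier mode in the solution for `x ≥ 0`. -/
def modePos (ℓ ε : ℝ) (n : ℤ) : C(ℝ, ℝ) := if n = 0 then 0 else profPos (modeEig ℓ ε n)

lemma exists_mode_bound (hε : 0 < ε) : ∃ b : ℤ → ℝ, (∀ n, 0 ≤ b n) ∧ Summable b ∧
    (∀ n, ∀ x ∈ Set.Iic (0 : ℝ), |modeNeg ℓ ε n x| ≤ b n * Real.exp (x / 2)) ∧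
    ∀ n, ∀ x ∈ Set.Ici (0 : ℝ), |modePos ℓ ε n x| ≤ b n * Real.exp (x / 2) := by
  -- The largest 1/μ among nonzero modes is at n = 1. At n = 0 the majorant is a quotient by 0,
  -- hence 0, in accordance with the zero mode being set to 0.
  set t := 1 / modeEig ℓ ε 1 with ht
  have h0 : ∀ n, 0 ≤ 13 * (2 + t) ^ 2 / modeEig ℓ ε n := fun n =>
    div_nonneg (by positivity) (modeEig_nonneg hε n)
  have hb : ∀ n : ℤ, n ≠ 0 → _ := fun n hn => abs_prof_le (modeEig_pos (ℓ := ℓ) hε hn) (t := t) (by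
    rw [ht]
    refine one_div_le_one_div_of_le (modeEig_pos hε one_ne_zero) ?_
    rw [modeEig_eq, modeEig_eq]
    have : (1 : ℝ) ≤ (n : ℝ) ^ 2 := by
      rw [one_le_sq_iff_one_le_abs]; exact_mod_cast Int.one_le_abs hn
    refine mul_le_mul_of_nonneg_left ?_ (by positivity)
    simpa only [Int.cast_one, one_pow] using this)
  refine ⟨fun n => 13 * (2 + t) ^ 2 / modeEig ℓ ε n, h0, ?_, fun n x hx => ?_, fun n x hx => ?_⟩
  · simpa only [mul_one_div] using (summable_inv_modeEig (ℓ := ℓ) (ε := ε)).mul_left (13 * (2 + t) ^ 2)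
  · rw [modeNeg]
    split_ifs with hn
    · simpa using mul_nonneg (h0 n) (Real.exp_pos _).le
    · exact (hb n hn).1 x hx
  · rw [modePos]
    split_ifs with hn
    · simpa using mul_nonneg (h0 n) (Real.exp_pos _).le
    · exact (hb n hn).2 x hx

lemma exists_solution (hε : 0 < ε) : ∃ (R : C(AddCircle ℓ, ℂ) →ₗ[ℝ] XSpace ℓ) (C : ℝ),
    (∀ p, xNorm (R p) ≤ C * ‖p‖) ∧
    (∀ p y, HasSum (fun n => modeNeg ℓ ε n y.1 * reCell (ccoef n p • fourier n) y.2)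
      ((R p).1.1 y)) ∧
    ∀ p y, HasSum (fun n => modePos ℓ ε n y.1 * reCell (ccoef n p • fourier n) y.2)
      ((R p).1.2 y) := by
  obtain ⟨b, hb0, hb, h1, h2⟩ := exists_mode_bound (ℓ := ℓ) hε
  obtain ⟨R₁, hR₁, B₁⟩ := exists_series (ℓ := ℓ) hb0 hb h1
  obtain ⟨R₂, hR₂, B₂⟩ := exists_series (ℓ := ℓ) hb0 hb h2
  have hmem : ∀ p, (R₁.prod R₂) p ∈ XSpace ℓ := fun p =>
    ⟨⟨_, fun y => abs_weight_le_iff.2 (B₁ p y)⟩, ⟨_, fun y => abs_weight_le_iff.2 (B₂ p y)⟩⟩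
  refine ⟨(R₁.prod R₂).codRestrict (XSpace ℓ) hmem, (∑' n, b n) + ∑' n, b n, fun p => ?_, hR₁, hR₂⟩
  have h0 : 0 ≤ (∑' n, b n) * ‖p‖ := mul_nonneg (tsum_nonneg hb0) (norm_nonneg p)
  rw [add_mul]
  exact xNorm_le h0 h0 (B₁ p) (B₂ p)

/-! ### The right-hand side -/

/-- `(V - T - (4/3) U)` for `x ≤ 0`. -/
def sourceNeg : C(ℝ, ℝ) := negFun (1 / 6) (-2 / 9) (-4 / 9) 0 1

/-- `(V - T - (4/3) U)` for `x ≥ 0`. -/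
def sourcePos : C(ℝ, ℝ) := posFun (1 / 3) (-4 / 9) 0 0

/-- The operator taking `p` to the product of `V - T - (4/3) U` with the real part of `p` minus its
mean. -/
def sourceOp : C(AddCircle ℓ, ℂ) →ₗ[ℝ] XSpace ℓ where
  toFun p := ⟨tensor sourceNeg sourcePos (reCell (p - ccoef 0 p • fourier 0)),
    tensor_mem (fun _ => abs_negFun_le le_rfl) (fun _ => abs_posFun_le le_rfl) _⟩
  map_add' p q := by
    have e : reCell (p + q - ccoef 0 (p + q) • fourier 0) =
        reCell (p - ccoef 0 p • fourier 0) + reCell (q - ccoef 0 q • fourier 0) := by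
      rw [← map_add, map_add]; congr 1; module
    refine Subtype.ext (Prod.ext (ContinuousMap.ext fun y => ?_) (ContinuousMap.ext fun y => ?_))
    · change sourceNeg _ * _ = sourceNeg _ * _ + sourceNeg _ * _
      rw [e, ContinuousMap.add_apply, mul_add]
    · change sourcePos _ * _ = sourcePos _ * _ + sourcePos _ * _
      rw [e, ContinuousMap.add_apply, mul_add]
  map_smul' c p := by
    have e : reCell (c • p - ccoef 0 (c • p) • fourier 0) =
        c • reCell (p - ccoef 0 p • fourier 0) := by
      have h : ccoef 0 (c • p) = c • ccoef 0 p := (ccoef 0).map_smul_of_tower c p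
      rw [← map_smul, h, smul_sub, smul_assoc]
    refine Subtype.ext (Prod.ext (ContinuousMap.ext fun y => ?_) (ContinuousMap.ext fun y => ?_))
    · change sourceNeg _ * _ = c * (sourceNeg _ * _)
      rw [e, ContinuousMap.smul_apply, smul_eq_mul, mul_left_comm]
    · change sourcePos _ * _ = c * (sourcePos _ * _)
      rw [e, ContinuousMap.smul_apply, smul_eq_mul, mul_left_comm]

lemma sourceOp_coe (p : C(AddCircle ℓ, ℂ)) :
    (sourceOp p).1 = tensor sourceNeg sourcePos (reCell (p - ccoef 0 p • fourier 0)) := rfl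

lemma exists_xNorm_sourceOp_le : ∃ C : ℝ, ∀ p : C(AddCircle ℓ, ℂ), xNorm (sourceOp p) ≤ C * ‖p‖ := by
  have hq : ∀ (p : C(AddCircle ℓ, ℂ)) (η : Cell ℓ),
      |reCell (p - ccoef 0 p • fourier 0) η| ≤ 2 * ‖p‖ := fun p η => by
    refine (abs_reCell_le _ _).trans ((norm_sub_le _ _).trans ?_)
    rw [norm_smul, fourier_norm, mul_one, two_mul]
    exact add_le_add_right (norm_ccoef_le 0 p) _
  obtain ⟨A, hA0, hA⟩ : ∃ A : ℝ, 0 ≤ A ∧ ∀ x ≤ 0, |sourceNeg x| ≤ A * Real.exp (x / 2) :=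
    ⟨_, by positivity, fun _ => abs_negFun_le le_rfl⟩
  obtain ⟨B, hB0, hB⟩ : ∃ B : ℝ, 0 ≤ B ∧ ∀ x, 0 ≤ x → |sourcePos x| ≤ B * Real.exp (x / 2) :=
    ⟨_, by positivity, fun _ => abs_posFun_le le_rfl⟩
  refine ⟨A * 2 + B * 2, fun p => ?_⟩
  rw [add_mul, mul_assoc, mul_assoc]
  refine xNorm_le (by positivity) (by positivity) (fun y => ?_) fun y => ?_
  · rw [sourceOp_coe, tensor_fst, abs_mul, mul_right_comm]
    exact mul_le_mul (hA _ y.1.2) (hq p _) (abs_nonneg _) (by positivity)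
  · rw [sourceOp_coe, tensor_snd, abs_mul, mul_right_comm]
    exact mul_le_mul (hB _ y.1.2) (hq p _) (abs_nonneg _) (by positivity)

lemma Q_sourceOp (p : C(AddCircle ℓ, ℂ)) (η : Cell ℓ) : Q (sourceOp p) η = 0 :=
  Q_source (sourceOp_coe p) η

/-! ### The resolvent equation -/

lemma monomial_solution {R : C(AddCircle ℓ, ℂ) →ₗ[ℝ] XSpace ℓ}
    (h₁ : ∀ p y, HasSum (fun n => modeNeg ℓ ε n y.1 * reCell (ccoef n p • fourier n) y.2)
      ((R p).1.1 y))
    (h₂ : ∀ p y, HasSum (fun n => modePos ℓ ε n y.1 * reCell (ccoef n p • fourier n) y.2)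
      ((R p).1.2 y)) (c : ℂ) (n : ℤ) :
    (R (c • fourier n)).1 = tensor (modeNeg ℓ ε n) (modePos ℓ ε n) (reCell (c • fourier n)) := by
  have hc : ∀ k : ℤ, ccoef k (c • (fourier n : C(AddCircle ℓ, ℂ))) = if k = n then c else 0 := by
    intro k
    rw [map_smul, ccoef_fourier, smul_eq_mul, mul_ite, mul_one, mul_zero]
  refine Prod.ext (ContinuousMap.ext fun y => ?_) (ContinuousMap.ext fun y => ?_)
  · refine (h₁ _ y).unique ?_
    have h := hasSum_single (f := fun k => modeNeg ℓ ε k y.1 *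
      reCell (ccoef k (c • (fourier n : C(AddCircle ℓ, ℂ))) • fourier k) y.2) n fun k hk => by
        simp [hc, hk]
    simp only [hc, if_true] at h ⊢
    exact h
  · refine (h₂ _ y).unique ?_
    have h := hasSum_single (f := fun k => modePos ℓ ε k y.1 *
      reCell (ccoef k (c • (fourier n : C(AddCircle ℓ, ℂ))) • fourier k) y.2) n fun k hk => by
        simp [hc, hk]
    simp only [hc, if_true] at h ⊢
    exact h

lemma graphLA_monomial (hε : 0 < ε) {R : C(AddCircle ℓ, ℂ) →ₗ[ℝ] XSpace ℓ}
    (hR : ∀ (c : ℂ) (n : ℤ), (R (c • fourier n)).1 =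
      tensor (modeNeg ℓ ε n) (modePos ℓ ε n) (reCell (c • fourier n))) {n : ℤ} (hn : n ≠ 0) (c : ℂ) :
    GraphLA ε (R (c • fourier n)) (-(sourceOp (c • fourier n))) ∧
      ∀ η, Q (R (c • fourier n)) η = 0 := by
  have hu := hR c n
  rw [modeNeg, modePos, if_neg hn, if_neg hn] at hu
  have hf := sourceOp_coe (c • (fourier n : C(AddCircle ℓ, ℂ)))
  have h0 : ccoef 0 (c • (fourier n : C(AddCircle ℓ, ℂ))) = 0 := by
    rw [map_smul, ccoef_fourier, if_neg hn.symm, smul_zero]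
  rw [h0, zero_smul, sub_zero] at hf
  refine ⟨graphLA_prof (modeEig_pos hε hn) (hasDerivOn_reCell_fourier c n)
    (hasDerivOn_reCell_fourier _ n) (endsAgree_reCell _) (endsAgree_reCell _) (fun η => ?_) hu hf,
    Q_prof (modeEig_pos hε hn) hu⟩
  rw [reCell_apply, reCell_apply, ← Complex.re_ofReal_mul, ← Complex.re_ofReal_mul, ← Complex.neg_re,
    modeEig_coe]
  simp only [ContinuousMap.smul_apply, smul_eq_mul]
  congr 1
  ring

lemma graphLA_trigonometric (hε : 0 < ε) {R : C(AddCircle ℓ, ℂ) →ₗ[ℝ] XSpace ℓ}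
    (hR : ∀ (c : ℂ) (n : ℤ), (R (c • fourier n)).1 =
      tensor (modeNeg ℓ ε n) (modePos ℓ ε n) (reCell (c • fourier n))) {p : C(AddCircle ℓ, ℂ)}
    (hp : p ∈ Submodule.span ℂ (Set.range (fourier (T := ℓ)))) :
    GraphLA ε (R p) (-(sourceOp p)) ∧ ∀ η, Q (R p) η = 0 := by
  have hzero : GraphLA ε (0 : XSpace ℓ) (-0) ∧ ∀ η, Q (0 : XSpace ℓ) η = 0 := by
    simpa only [zero_smul, map_zero] using graphLA_monomial hε hR one_ne_zero 0
  -- R and `sourceOp` are only real linear, whereas p lies in a complex span; carrying an arbitrary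
  -- complex factor c makes the induction go through.
  suffices h : ∀ c : ℂ, GraphLA ε (R (c • p)) (-(sourceOp (c • p))) ∧ ∀ η, Q (R (c • p)) η = 0 by
    simpa only [one_smul] using h 1
  induction hp using Submodule.span_induction with
  | mem p hp =>
    obtain ⟨n, rfl⟩ := hp
    intro c
    by_cases hn : n = 0
    · subst hn
      have e1 : R (c • fourier 0) = 0 := by
        refine Subtype.ext ((hR c 0).trans ?_)
        refine Prod.ext (ContinuousMap.ext fun y => ?_) (ContinuousMap.ext fun y => ?_)
        · simp [tensor_fst, modeNeg]
        · simp [tensor_snd, modePos]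
      have e2 : sourceOp (c • (fourier 0 : C(AddCircle ℓ, ℂ))) = 0 := by
        refine Subtype.ext ((sourceOp_coe _).trans ?_)
        rw [map_smul, ccoef_fourier, if_pos rfl, smul_eq_mul, mul_one, sub_self, map_zero]
        refine Prod.ext (ContinuousMap.ext fun y => ?_) (ContinuousMap.ext fun y => ?_)
        · simp [tensor_fst]
        · simp [tensor_snd]
      rw [e1, e2]
      exact hzero
    · exact graphLA_monomial hε hR hn c
  | zero => intro c; rw [smul_zero, map_zero, map_zero]; exact hzero
  | add p q _ _ hp hq =>
    intro c
    rw [smul_add, map_add, map_add, neg_add]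
    exact ⟨(hp c).1.add (hq c).1, fun η => by rw [Q_add, (hp c).2, (hq c).2, add_zero]⟩
  | smul a p _ hp => intro c; rw [smul_smul]; exact hp (c * a)

/-- Trigonometric polynomials are dense in the continuous functions, and R and `sourceOp` are
bounded into 𝓧; exact solutions for polynomials thus converge, together with their right-hand sides,
as the closure demands. -/
lemma isResolventZero_of_monomial (hε : 0 < ε) {R : C(AddCircle ℓ, ℂ) →ₗ[ℝ] XSpace ℓ} {C : ℝ}
    (hC : ∀ p, xNorm (R p) ≤ C * ‖p‖)
    (hR : ∀ (c : ℂ) (n : ℤ), (R (c • fourier n)).1 =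
      tensor (modeNeg ℓ ε n) (modePos ℓ ε n) (reCell (c • fourier n))) (p : C(AddCircle ℓ, ℂ)) :
    IsResolventZero ε (sourceOp p) (R p) := by
  have hp : p ∈ (Submodule.span ℂ (Set.range (fourier (T := ℓ)))).topologicalClosure := by
    rw [span_fourier_closure_eq_top]; trivial
  obtain ⟨q, hq, hlim⟩ := mem_closure_iff_seq_limit.1 hp
  have hg := fun k => graphLA_trigonometric hε hR (hq k)
  obtain ⟨D, hD⟩ := exists_xNorm_sourceOp_le (ℓ := ℓ)
  obtain ⟨E, hE⟩ := exists_abs_Q_le (ℓ := ℓ)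
  have hn := tendsto_iff_norm_sub_tendsto_zero.1 hlim
  have hz : ∀ c : ℝ, Tendsto (fun k => c * ‖q k - p‖) atTop (𝓝 0) := fun c => by
    simpa using hn.const_mul c
  have hu : Tendsto (fun k => xNorm (R (q k) - R p)) atTop (𝓝 0) :=
    squeeze_zero (fun _ => xNorm_nonneg _) (fun k => by rw [← map_sub]; exact hC _) (hz C)
  have hf : Tendsto (fun k => xNorm (-(sourceOp (q k)) - -(sourceOp p))) atTop (𝓝 0) :=
    squeeze_zero (fun _ => xNorm_nonneg _) (fun k => by
      rw [neg_sub_neg, ← map_sub, norm_sub_rev]; exact hD _) (hz D)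
  have hQ : ∀ η, Q (R p) η = 0 := fun η => by
    have h0 : ∀ k, |Q (R p) η| ≤ E * xNorm (R (q k) - R p) := fun k => by
      have h := Q_add (R (q k) - R p) (R p) η
      rw [sub_add_cancel, (hg k).2] at h
      have h' := hE (R (q k) - R p) η
      rwa [show Q (R (q k) - R p) η = -Q (R p) η by linarith, abs_neg] at h'
    have hE0 : Tendsto (fun k => E * xNorm (R (q k) - R p)) atTop (𝓝 0) := by
      simpa using hu.const_mul E
    exact abs_nonpos_iff.1 (ge_of_tendsto' hE0 h0)
  refine ⟨⟨fun y => by rw [Q_sourceOp, zero_mul], fun y => by rw [Q_sourceOp, zero_mul]⟩,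
    ⟨fun y => by rw [hQ, zero_mul], fun y => by rw [hQ, zero_mul]⟩,
    fun k => R (q k), fun k => -(sourceOp (q k)), fun k => (hg k).1, hu, hf⟩

/-! ### Existence of the value of `𝓑_ε` -/

lemma traceSymb_bound {r : ℝ} (hr : 1 ≤ r) : |traceSymb r| ≤ 1 / r ^ 2 := by
  have h : 0 < 9 * r ^ 2 * (2 * r + 1) := by positivity
  rw [traceSymb, neg_div, abs_neg, abs_of_pos (div_pos (by linarith) h),
    div_le_div_iff₀ h (by positivity)]
  nlinarith [pow_pos (show 0 < r by linarith) 2, pow_pos (show 0 < r by linarith) 3]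

/-- The trace symbol is O(1/r²), so one derivative still leaves O(1/r), which is square-summable;
two do not. -/
lemma exists_trace_multipliers (hε : 0 < ε) :
    ∃ M M₁ : C(AddCircle ℓ, ℝ) →L[ℝ] C(AddCircle ℓ, ℝ),
      (∀ F n, coef (M F) n = ((traceSymb (modeRoot ℓ ε n) : ℝ) : ℂ) * coef F n) ∧
      ∀ F n, coef (M₁ F) n = freq ℓ n * ((traceSymb (modeRoot ℓ ε n) : ℝ) : ℂ) * coef F n := by
  have hb : ∀ n, ‖((traceSymb (modeRoot ℓ ε n) : ℝ) : ℂ)‖ ≤ 1 / modeRoot ℓ ε n ^ 2 := fun n => by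
    rw [Complex.norm_real]
    exact traceSymb_bound (one_le_modeRoot hε n)
  obtain ⟨M, hM⟩ := exists_multiplier_of_le (ℓ := ℓ) hε
    (κ := fun n => ((traceSymb (modeRoot ℓ ε n) : ℝ) : ℂ)) (C := 1) (fun n => by
      have h1 := one_le_modeRoot (ℓ := ℓ) hε n
      exact (hb n).trans (one_div_le_one_div_of_le (by linarith) (by nlinarith)))
    fun n => by rw [modeRoot_neg, Complex.conj_ofReal]
  obtain ⟨M₁, hM₁⟩ := exists_multiplier_of_le (ℓ := ℓ) hε
    (κ := fun n => freq ℓ n * ((traceSymb (modeRoot ℓ ε n) : ℝ) : ℂ)) (C := √(1 / ε)) (fun n => by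
      have h1 := one_le_modeRoot (ℓ := ℓ) hε n
      have h5 := norm_freq_le (ℓ := ℓ) hε n
      rw [norm_mul]
      calc _ ≤ √(1 / ε) * modeRoot ℓ ε n * (1 / modeRoot ℓ ε n ^ 2) := by
            gcongr
            exact hb n
        _ = _ := by field_simp)
    fun n => by rw [modeRoot_neg, map_mul, Complex.conj_ofReal, freq_neg]
  exact ⟨M, M₁, hM, hM₁⟩

/-- The trace at `x = 0` of the solution, in terms of Fourier multipliers. -/
lemma trace_eq_restr (hε : 0 < ε) {u : XSpace ℓ} {G V : C(AddCircle ℓ, ℝ)} (hG : coef G 0 = 0)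
    (hu : ∀ y, HasSum (fun n => modeNeg ℓ ε n y.1 * reCell (coef G n • fourier n) y.2) (u.1.1 y))
    (hV : ∀ n, coef V n = ((traceSymb (modeRoot ℓ ε n) : ℝ) : ℂ) * coef G n) (η : Cell ℓ) :
    u.1.1 (zeroNeg, η) = restr V η := by
  have hm : ∀ n, n ≠ 0 → modeNeg ℓ ε n 0 = traceSymb (modeRoot ℓ ε n) := fun n hn => by
    rw [modeNeg, if_neg hn, profNeg_zero, modeRoot]
  have hs : Summable (fourierCoeff (toComplex V)) := by
    obtain ⟨b, hb0, hb, h1, -⟩ := exists_mode_bound (ℓ := ℓ) hε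
    refine Summable.of_norm_bounded (hb.mul_right ‖G‖) fun n => ?_
    change ‖coef V n‖ ≤ _
    rw [hV, norm_mul]
    by_cases hn : n = 0
    · subst hn
      rw [hG, norm_zero, mul_zero]
      exact mul_nonneg (hb0 _) (norm_nonneg _)
    · rw [Complex.norm_real, ← hm n hn]
      have := h1 n 0 Set.self_mem_Iic
      rw [zero_div, Real.exp_zero, mul_one] at this
      exact mul_le_mul this (norm_coef_le G n) (norm_nonneg _) (hb0 n)
  have h := Complex.hasSum_re
    (has_pointwise_sum_fourier_series_of_summable hs ((η : ℝ) : AddCircle ℓ))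
  refine (hu (zeroNeg, η)).unique ?_
  have e : (toComplex V ((η : ℝ) : AddCircle ℓ)).re = restr V η := rfl
  rw [e] at h
  refine h.congr_fun fun n => ?_
  change modeNeg ℓ ε n 0 * _ = (coef V n • fourier n ((η : ℝ) : AddCircle ℓ)).re
  rw [hV, reCell_apply, ContinuousMap.smul_apply]
  by_cases hn : n = 0
  · subst hn; simp [hG]
  · rw [hm n hn, mul_smul, smul_eq_mul, smul_eq_mul, Complex.re_ofReal_mul]

/-- The symbol of the second derivative of the trace tends to 4/(9ε) as r → ∞; the deviation from
this limit is a multiple of the symbol of K. -/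
lemma coef_trace_deriv (hε : 0 < ε) {K M₁ : C(AddCircle ℓ, ℝ) →L[ℝ] C(AddCircle ℓ, ℝ)}
    (hK : ∀ F n, coef (K F) n =
      ((1 / modeRoot ℓ ε n + 1 / (2 * modeRoot ℓ ε n + 1) : ℝ) : ℂ) * coef F n)
    (hM₁ : ∀ F n, coef (M₁ F) n =
      freq ℓ n * ((traceSymb (modeRoot ℓ ε n) : ℝ) : ℂ) * coef F n) (F : C(AddCircle ℓ, ℝ)) (n : ℤ) :
    coef ((4 / (9 * ε)) • F - (1 / (3 * ε)) • K F) n = freq ℓ n * coef (M₁ F) n := by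
  have h1 := one_le_modeRoot (ℓ := ℓ) hε n
  have e : 4 / (9 * ε) - 1 / (3 * ε) * (1 / modeRoot ℓ ε n + 1 / (2 * modeRoot ℓ ε n + 1)) =
      -(modeEig ℓ ε n / ε) * traceSymb (modeRoot ℓ ε n) := by
    rw [← modeRoot_mul hε, traceSymb]
    field_simp
    ring
  have e2 := freq_sq (ℓ := ℓ) hε n
  rw [coef_sub, coef_smul, coef_smul, hK, hM₁]
  have e' := congrArg (fun s : ℝ => (s : ℂ)) e
  simp only [Complex.ofReal_sub, Complex.ofReal_mul] at e'
  rw [← e2] at e'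
  linear_combination coef F n * e'

theorem graphB_restr (hε : 0 < ε) {K : C(AddCircle ℓ, ℝ) →L[ℝ] C(AddCircle ℓ, ℝ)}
    (hK : ∀ F n, coef (K F) n =
      ((1 / modeRoot ℓ ε n + 1 / (2 * modeRoot ℓ ε n + 1) : ℝ) : ℂ) * coef F n)
    {F F₁ F₂ : C(AddCircle ℓ, ℝ)} (h1 : ∀ n, coef F₁ n = freq ℓ n * coef F n)
    (h2 : ∀ n, coef F₂ n = freq ℓ n * coef F₁ n) :
    GraphB ε (restr F) (restr (F - (3 * ε) • F₂ - ε • K F₂)) := by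
  obtain ⟨R, C, hC, hR₁, hR₂⟩ := exists_solution (ℓ := ℓ) hε
  obtain ⟨M, M₁, hM, hM₁⟩ := exists_trace_multipliers (ℓ := ℓ) hε
  have h0 : coef F₂ 0 = 0 := by rw [h2]; simp [freq]
  have hsrc : ∀ η, reCell (toComplex F₂ - ccoef 0 (toComplex F₂) • fourier 0) η = restr F₂ η := by
    intro η
    have : ccoef 0 (toComplex F₂) = 0 := h0
    rw [this, zero_smul, sub_zero]
    rfl
  have htr : (fun η => (R (toComplex F₂)).1.1 (zeroNeg, η)) = restr (M F₂) := funext fun η =>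
    trace_eq_restr hε h0 (hR₁ (toComplex F₂)) (hM F₂) η
  refine ⟨restr F₁, restr F₂, restr (M₁ F₂), restr ((4 / (9 * ε)) • F₂ - (1 / (3 * ε)) • K F₂),
    sourceOp (toComplex F₂), R (toComplex F₂), hasDerivOn_restr_iff.2 h1, hasDerivOn_restr_iff.2 h2,
    fun y => ?_, fun y => ?_, isResolventZero_of_monomial hε hC (monomial_solution hR₁ hR₂) _, ?_,
    hasDerivOn_restr_iff.2 (coef_trace_deriv hε hK hM₁ F₂), fun η => ?_⟩
  · rw [sourceOp_coe, tensor_fst, hsrc, mul_comm, sourceNeg, negFun_apply, V₁, T₁, U₁]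
    ring
  · rw [sourceOp_coe, tensor_snd, hsrc, mul_comm, sourcePos, posFun_apply, V₂, T₂, U₂]
    ring
  · rw [htr, hasDerivOn_restr_iff]
    intro n
    rw [hM₁, hM, mul_assoc]
  -- The factor 3ε² turns 4/(9ε) into 4ε/3, and -13ε/3 + 4ε/3 = -3ε.
  · simp only [restr_apply, ContinuousMap.sub_apply, ContinuousMap.smul_apply, smul_eq_mul]
    field_simp
    ring

end Solution

/-! ### Invertibility of `𝓑_ε` -/

section Final

variable {ℓ : ℝ} [hℓ : Fact (0 < ℓ)] {ε : ℝ}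

lemma holderNorm_zero_operator_le (hε : 0 < ε) {θ : ℝ≥0} (hθ : θ ≤ 1) {κ : ℤ → ℂ}
    {K : C(AddCircle ℓ, ℝ) →L[ℝ] C(AddCircle ℓ, ℝ)} (hK : ∀ F n, coef (K F) n = κ n * coef F n)
    {F F₁ F₂ : C(AddCircle ℓ, ℝ)} (h1 : ∀ n, coef F₁ n = freq ℓ n * coef F n)
    (hF₂ : MemHolder θ (restr F₂)) :
    MemHolder θ (restr (F - (3 * ε) • F₂ - ε • K F₂)) ∧
    holderNorm 0 θ (restr (F - (3 * ε) • F₂ - ε • K F₂)) ≤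
      (1 + ℓ ^ (1 - (θ : ℝ)) + 3 * ε + 2 * ε * ‖K‖) *
        (‖F‖ + ‖F₁‖ + ‖F₂‖ + nnHolderNorm θ (restr F₂)) := by
  have hlp : 0 ≤ ℓ ^ (1 - (θ : ℝ)) := Real.rpow_nonneg hℓ.out.le _
  have hF := holderWith_of_coef hθ h1
  have hKF := MemHolder.multiplier hK hF₂
  have e : restr (F - (3 * ε) • F₂ - ε • K F₂) =
      restr F + ((-(3 * ε)) • restr F₂ + (-ε) • restr (K F₂)) := by
    simp only [map_sub, map_smul]; module
  have m1 : MemHolder θ ((-(3 * ε)) • restr F₂) := hF₂.smul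
  have m2 : MemHolder θ ((-ε) • restr (K F₂)) := hKF.smul
  refine ⟨e ▸ hF.memHolder.add (m1.add m2), ?_⟩
  have s1 : (nnHolderNorm θ (restr (F - (3 * ε) • F₂ - ε • K F₂)) : ℝ) ≤
      nnHolderNorm θ (restr F) + (3 * ε * nnHolderNorm θ (restr F₂) +
        ε * nnHolderNorm θ (restr (K F₂))) := by
    rw [e]
    have a1 := hF.memHolder.nnHolderNorm_add_le (m1.add m2)
    have a2 := m1.nnHolderNorm_add_le m2
    rw [hF₂.nnHolderNorm_smul, hKF.nnHolderNorm_smul] at a2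
    have a3 := a1.trans (add_le_add_right a2 _)
    have a4 := NNReal.coe_le_coe.2 a3
    push_cast [norm_neg] at a4
    rwa [Real.norm_of_nonneg (by positivity : 0 ≤ 3 * ε), Real.norm_of_nonneg hε.le] at a4
  have s2 : (nnHolderNorm θ (restr F) : ℝ) ≤ ‖F₁‖ * ℓ ^ (1 - (θ : ℝ)) := by
    have := NNReal.coe_le_coe.2 hF.nnholderNorm_le
    rwa [NNReal.coe_mul, Real.coe_toNNReal _ hlp, coe_nnnorm] at this
  have s3 := nnHolderNorm_multiplier_le hK hF₂
  have s4 : ‖F - (3 * ε) • F₂ - ε • K F₂‖ ≤ ‖F‖ + 3 * ε * ‖F₂‖ + ε * (‖K‖ * ‖F₂‖) := by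
    refine (norm_sub_le _ _).trans (add_le_add ((norm_sub_le _ _).trans ?_) ?_)
    · rw [norm_smul, Real.norm_of_nonneg (by positivity : 0 ≤ 3 * ε)]
    · rw [norm_smul, Real.norm_of_nonneg hε.le]
      gcongr
      exact K.le_opNorm _
  rw [holderNorm_zero_restr]
  have n1 := norm_nonneg F
  have n2 := norm_nonneg F₁
  have n3 := norm_nonneg F₂
  have n4 := (nnHolderNorm θ (restr F₂)).coe_nonneg
  have n5 := norm_nonneg K
  have t1 : ε * (nnHolderNorm θ (restr (K F₂)) : ℝ) ≤
      ε * (2 * ‖K‖ * nnHolderNorm θ (restr F₂)) := by gcongr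
  set H := (nnHolderNorm θ (restr F₂) : ℝ)
  set l := ℓ ^ (1 - (θ : ℝ))
  have p1 := mul_nonneg hε.le n5
  -- The surplus of the expanded right-hand side over the sum of the individual estimates.
  have : 0 ≤ ‖F₁‖ + H + l * (‖F‖ + ‖F₂‖ + H) + 3 * ε * (‖F‖ + ‖F₁‖) +
      ε * ‖K‖ * (2 * ‖F‖ + 2 * ‖F₁‖ + ‖F₂‖) + ‖F₂‖ := by positivity
  nlinarith

lemma holderNorm_two_inverse_le (hε : 0 < ε) {θ : ℝ≥0} {κ : ℤ → ℂ}
    {N N₁ N₂ : C(AddCircle ℓ, ℝ) →L[ℝ] C(AddCircle ℓ, ℝ)}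
    (hN₂ : ∀ F n, coef (N₂ F) n = κ n * coef F n) {G : C(AddCircle ℓ, ℝ)}
    (h1 : ∀ n, coef (N₁ G) n = freq ℓ n * coef (N G) n)
    (h2 : ∀ n, coef ((-1 / (3 * ε)) • (G - N₂ G)) n = freq ℓ n * coef (N₁ G) n)
    (hG : MemHolder θ (restr G)) :
    MemHolder θ (restr ((-1 / (3 * ε)) • (G - N₂ G))) ∧
    holderNorm 2 θ (restr (N G)) ≤
      (‖N‖ + ‖N₁‖ + 1 / (3 * ε) * (1 + 2 * ‖N₂‖)) * (‖G‖ + nnHolderNorm θ (restr G)) := by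
  have m0 := MemHolder.multiplier hN₂ hG
  have m1 : MemHolder θ ((-1 / (3 * ε)) • restr G) := hG.smul
  have m2 : MemHolder θ ((1 / (3 * ε)) • restr (N₂ G)) := m0.smul
  have e : restr ((-1 / (3 * ε)) • (G - N₂ G)) =
      (-1 / (3 * ε)) • restr G + (1 / (3 * ε)) • restr (N₂ G) := by
    simp only [map_sub, map_smul]; module
  have hp : 0 < 1 / (3 * ε) := by positivity
  have hn : ‖-1 / (3 * ε)‖ = 1 / (3 * ε) := by
    rw [neg_div, norm_neg, Real.norm_of_nonneg hp.le]
  refine ⟨e ▸ m1.add m2, ?_⟩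
  rw [holderNorm_two_restr θ h1 h2]
  have s1 : (nnHolderNorm θ (restr ((-1 / (3 * ε)) • (G - N₂ G))) : ℝ) ≤
      1 / (3 * ε) * nnHolderNorm θ (restr G) + 1 / (3 * ε) * nnHolderNorm θ (restr (N₂ G)) := by
    rw [e]
    have a2 := m1.nnHolderNorm_add_le m2
    rw [hG.nnHolderNorm_smul, m0.nnHolderNorm_smul] at a2
    have a4 := NNReal.coe_le_coe.2 a2
    rwa [NNReal.coe_add, NNReal.coe_mul, NNReal.coe_mul, coe_nnnorm, coe_nnnorm, hn,
      Real.norm_of_nonneg hp.le] at a4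
  have s2 := nnHolderNorm_multiplier_le hN₂ hG
  have s3 : ‖(-1 / (3 * ε)) • (G - N₂ G)‖ ≤ 1 / (3 * ε) * (‖G‖ + ‖N₂‖ * ‖G‖) := by
    rw [norm_smul, hn]
    gcongr
    exact (norm_sub_le _ _).trans (add_le_add_right (N₂.le_opNorm G) _)
  have s4 := N.le_opNorm G
  have s5 := N₁.le_opNorm G
  have t : 1 / (3 * ε) * (nnHolderNorm θ (restr (N₂ G)) : ℝ) ≤
      1 / (3 * ε) * (2 * ‖N₂‖ * nnHolderNorm θ (restr G)) := by gcongr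
  have n0 := (nnHolderNorm θ (restr G)).coe_nonneg
  set H := (nnHolderNorm θ (restr G) : ℝ)
  set c := 1 / (3 * ε)
  have : 0 ≤ ‖N‖ * H + ‖N₁‖ * H + c * (‖N₂‖ * ‖G‖) := by positivity
  nlinarith

end Final

end FrontB

end

/-! ### Construction of 𝓑_ε as the inverse of an explicit multiplier -/

open FrontB in
theorem mainTheorem9 (ℓ₀ : ℝ) (hℓ₀ : 0 < ℓ₀) (ε : ℝ) (hε : 0 < ε) (hε' : ε ≤ 1 / 2)
    (θ : ℝ≥0) (hθ : 0 < θ) (hθ' : θ < 1) :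
    ∃ B : FrontB.CSharp ℓ₀ 2 θ ≃ₗ[ℝ] FrontB.CSharp ℓ₀ 0 θ,
      (∀ (ψ : FrontB.CSharp ℓ₀ 2 θ) (g : FrontB.Cell ℓ₀ → ℝ),
        FrontB.GraphB ε (ψ : FrontB.Cell ℓ₀ → ℝ) g ↔ g = B ψ) ∧
      ∃ C : ℝ, ∀ ψ : FrontB.CSharp ℓ₀ 2 θ,
        FrontB.holderNorm 0 θ (B ψ : FrontB.Cell ℓ₀ → ℝ)
            ≤ C * FrontB.holderNorm 2 θ (ψ : FrontB.Cell ℓ₀ → ℝ) ∧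
        FrontB.holderNorm 2 θ (ψ : FrontB.Cell ℓ₀ → ℝ)
            ≤ C * FrontB.holderNorm 0 θ (B ψ : FrontB.Cell ℓ₀ → ℝ) := by
  have : Fact (0 < ℓ₀) := ⟨hℓ₀⟩
  obtain ⟨K, hK⟩ := exists_smoothing (ℓ := ℓ₀) hε
  obtain ⟨N, N₁, N₂, hN, hN₁, hN₂⟩ := exists_inverse (ℓ := ℓ₀) hε
  have hb : ∀ n, ((symbB (modeRoot ℓ₀ ε n) : ℝ) : ℂ) ≠ 0 := fun n => by
    exact_mod_cast (symbB_pos (one_le_modeRoot hε n)).ne'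
  choose L hL hLH using fun f : CSharp ℓ₀ 0 θ => mem_cSharp_zero_iff.1 f.2
  have d1 : ∀ G n, coef (N₁ G) n = freq ℓ₀ n * coef (N G) n := fun G n => by
    rw [hN, hN₁, mul_assoc]
  have d2 : ∀ G n, coef ((-1 / (3 * ε)) • (G - N₂ G)) n = freq ℓ₀ n * coef (N₁ G) n :=
    coef_inverse_deriv hε hN₁ hN₂
  -- The multiplier form of 𝓑_ε, applied to N G with its second derivative written out, returns G
  -- since the symbols are reciprocal.
  have hop : ∀ G, N G - (3 * ε) • ((-1 / (3 * ε)) • (G - N₂ G)) -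
      ε • K ((-1 / (3 * ε)) • (G - N₂ G)) = G := fun G => coef_ext fun n => by
    rw [coef_operator hε hK (d1 G) (d2 G), hN]
    push_cast
    rw [← mul_assoc, mul_one_div_cancel (hb n), one_mul]
  let S : CSharp ℓ₀ 0 θ →ₗ[ℝ] CSharp ℓ₀ 2 θ :=
    { toFun := fun f => ⟨restr (N (L f)), mem_cSharp_two_iff.2 ⟨_, _, _, rfl, d1 (L f), d2 (L f),
        (holderNorm_two_inverse_le hε hN₂ (d1 _) (d2 _) (hLH f)).1⟩⟩
      map_add' := fun f g => by
        have : L (f + g) = L f + L g := restr_injective (by rw [map_add, hL, hL, hL]; rfl)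
        ext η
        simp [this]
      map_smul' := fun c f => by
        have : L (c • f) = c • L f := restr_injective (by rw [map_smul, hL, hL]; rfl)
        ext η
        simp [this] }
  have hS : ∀ f, (S f : Cell ℓ₀ → ℝ) = restr (N (L f)) := fun f => rfl
  have hinj : Function.Injective S := fun f g h => by
    have h1 : N (L f) = N (L g) := restr_injective (congrArg Subtype.val h)
    have h2 : L f = L g := by
      rw [← hop (L f), ← hop (L g)]
      refine coef_ext fun n => ?_
      rw [coef_operator hε hK (d1 _) (d2 _), coef_operator hε hK (d1 _) (d2 _), h1]
    exact Subtype.ext (by rw [← hL, ← hL, h2])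
  -- The preimage of ψ is the multiplier form of 𝓑_ε applied to ψ, which is Hölder by the forward
  -- estimate.
  have hsurj : Function.Surjective S := fun ψ => by
    obtain ⟨F, F₁, F₂, hF, h1, h2, hH⟩ := mem_cSharp_two_iff.1 ψ.2
    refine ⟨⟨_, mem_cSharp_zero_iff.2 ⟨F - (3 * ε) • F₂ - ε • K F₂, rfl,
      (holderNorm_zero_operator_le hε hθ'.le hK h1 hH).1⟩⟩, Subtype.ext ?_⟩
    rw [hS, ← hF]
    congr 1
    rw [restr_injective (hL ⟨_, _⟩)]
    refine coef_ext fun n => ?_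
    rw [hN, coef_operator hε hK h1 h2]
    push_cast
    rw [← mul_assoc, one_div_mul_cancel (hb n), one_mul]
  refine ⟨(LinearEquiv.ofBijective S ⟨hinj, hsurj⟩).symm, ?_, ?_⟩
  · intro ψ g
    -- Every ψ is S f, so it suffices that `GraphB` relates S f to f, and then to nothing else by
    -- uniqueness.
    obtain ⟨f, rfl⟩ := hsurj ψ
    have e : (LinearEquiv.ofBijective S ⟨hinj, hsurj⟩).symm (S f) = f :=
      LinearEquiv.symm_apply_apply (LinearEquiv.ofBijective S ⟨hinj, hsurj⟩) f
    have h := graphB_restr hε hK (d1 (L f)) (d2 (L f))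
    rw [hop, hL, ← hS] at h
    rw [e]
    exact ⟨fun hg => hg.unique hε h, fun hg => hg ▸ h⟩
  · refine ⟨max (1 + ℓ₀ ^ (1 - (θ : ℝ)) + 3 * ε + 2 * ε * ‖K‖)
      (‖N‖ + ‖N₁‖ + 1 / (3 * ε) * (1 + 2 * ‖N₂‖)), fun ψ => ?_⟩
    obtain ⟨f, rfl⟩ := hsurj ψ
    have e : (LinearEquiv.ofBijective S ⟨hinj, hsurj⟩).symm (S f) = f :=
      LinearEquiv.symm_apply_apply (LinearEquiv.ofBijective S ⟨hinj, hsurj⟩) f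
    obtain ⟨m, b2⟩ := holderNorm_two_inverse_le hε hN₂ (d1 _) (d2 _) (hLH f)
    have b1 := (holderNorm_zero_operator_le hε hθ'.le hK (d1 (L f)) m).2
    rw [hop] at b1
    rw [e, hS, ← hL f]
    constructor
    · rw [holderNorm_two_restr θ (d1 (L f)) (d2 (L f))]
      exact b1.trans (mul_le_mul_of_nonneg_right (le_max_left _ _) (by positivity))
    · rw [holderNorm_zero_restr]
      exact b2.trans (mul_le_mul_of_nonneg_right (le_max_right _ _) (by positivity))
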